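/- **Setting.** Let $W$ be a finite group of unitary $n\times n$ matrices acting on $V=\mathbb C^n$, with standard basis $y_1,\dots,y_n$ and dual basis $x_1,\dots,x_n$ of $V^*$, and let $S=S(V^*)=\mathbb C[x_1,\dots,x_n]$. The group $W$ acts diagonally on $S\otimes\wedge V^*\otimes\wedge V$, contragrediently on $V^*$. Assume that $W$ is a *coincidental reflection group*, that is: * $W$ is generated by reflections (elements whose fixed space is a hyperplane) and acts irreducibly on $V$; * with degrees $d_1\le\dots\le d_n$, exponents $e_i=d_i-1$ and coexponents $e_1^*\le\dots\le e_n^*$, one has $e_i+e^*_{n+1-i}=\max_j d_j$ for all $i$ (duality group); * $e_1,\dots,e_n$ is an arithmetic sequence with positive integer gap. Let $f_1,\dots,f_n$ be any basic invariants, i.e. homogeneous, algebraically independent generators of the algebra $S^W$, indexed so that $\deg f_1\le\dots\le\deg f_n$; these degrees are the $d_i$. Let $\theta_1,\dots,\theta_n$ be any basic derivations, i.e. an $S^W$-basis of $(S\otimes V)^W$ such that all coefficients of $\theta_i$ are homogeneous of degree $e_i^*$, with $e_1^*\le\dots\le e_n^*$. Put $df=\sum_i\frac{\partial f}{\partial x_i}\otimes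 x_i$. For $\theta=\sum_j h_j\otimes y_j$ let $\tilde\theta$ be the operator on $S\otimes\wedge V^*\otimes\wedge V$ with $$\tilde\theta(f\otimes\eta\otimes\eta')=\sum_j \overline{h_j}\big(\tfrac{\partial}{\partial x_1},\dots,\tfrac{\partial}{\partial x_n}\big)(f)\otimes (x_j\wedge\eta)\otimes\eta',$$ where the bar conjugates the coefficients of the polynomial. For $0\le r\le n$ let $M_r=(S\otimes\wedge V^*\otimes\wedge^r V)^W$, a module over $(S\otimes\wedge V^*)^W$ via multiplication into the first two tensor factors, and let $R_r=\wedge_{S^W}\{df_1,\dots,df_{n-r}\}$ be the $S^W$-subalgebra of $(S\otimes\wedge V^*)^W$ generated by $df_1,\dots,df_{n-r}$. For index sets write $df_L=df_{l_1}\wedge\cdots\wedge df_{l_m}$, $\tilde\theta_I=\tilde\theta_{i_1}\cdots\tilde\theta_{i_k}$ and $\theta_J=\theta_{j_1}\wedge\dots\wedge\theta_{j_r}$, with indices in increasing order. **Proposition.** Fix $1\le r\le n$. Suppose that the forms $$df_L\cdot\tilde\theta_I(\theta_J),\qquad L\subseteq\{1,\dots,n-r\},\quad I\subseteq\{1,\dots,r\},\quad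 J\subseteq\{1,\dots,n\},\ |J|=r,$$ are linearly independent over the fraction field $\mathrm{Frac}(S)$. Then the forms $$\tilde\theta_{i_1}\cdots\tilde\theta_{i_k}(\theta_{j_1}\wedge\cdots\wedge\theta_{j_r}),\qquad 0\le k\le r,\quad 1\le i_1<\dots<i_k\le r,\quad 1\le j_1<\dots<j_r\le n,$$ form a basis of $M_r$ over $R_r$. In particular $M_r$ is a free $R_r$-module. -/

import Mathlib

open scoped TensorProduct

noncomputable section

namespace MixedForms

/-! The group acts on `V = ℂⁿ` with standard basis `y₁, …, yₙ` by unitary matrices; `x₁, …, xₙ` is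
the dual basis of `V*`. -/

/-- The space `V = ℂⁿ`. -/
abbrev V (n : ℕ) : Type := Fin n → ℂ

/-- The symmetric algebra `S = S(V*) = ℂ[x₁, …, xₙ]`. -/
abbrev S (n : ℕ) : Type := MvPolynomial (Fin n) ℂ

/-- The algebra `S(V*) ⊗ ∧V*` of polynomial differential forms. -/
abbrev DForms (n : ℕ) : Type := S n ⊗[ℂ] ExteriorAlgebra ℂ (Module.Dual ℂ (V n))

/-- The algebra `S(V*) ⊗ ∧V* ⊗ ∧V` of mixed derivation differential forms. -/
abbrev Forms (n : ℕ) : Type := DForms n ⊗[ℂ] ExteriorAlgebra ℂ (V n)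

variable {n : ℕ}

/-! Shortcuts for instance search; they introduce no new data. -/

instance : Ring (DForms n) := Algebra.TensorProduct.instRing

instance : Ring (Forms n) := Algebra.TensorProduct.instRing

instance : NonUnitalNonAssocSemiring (DForms n) :=
  NonUnitalNonAssocRing.toNonUnitalNonAssocSemiring

instance : NonUnitalNonAssocSemiring (Forms n) :=
  NonUnitalNonAssocRing.toNonUnitalNonAssocSemiring

/-- The basis vector `yⱼ` of `V`. -/
def y (j : Fin n) : V n := Pi.single j 1

/-- The coordinate function `xⱼ`, as an element of `V*`. -/
def x (j : Fin n) : Module.Dual ℂ (V n) := LinearMap.proj j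

/-! ### The group actions -/

/-- The action of a unitary matrix on `V`. -/
def actV (g : Matrix.unitaryGroup (Fin n) ℂ) : V n →ₗ[ℂ] V n :=
  Matrix.toLin' (g : Matrix (Fin n) (Fin n) ℂ)

/-- The contragredient action on `V*`: `g φ = φ ∘ g⁻¹`. -/
def actDual (g : Matrix.unitaryGroup (Fin n) ℂ) :
    Module.Dual ℂ (V n) →ₗ[ℂ] Module.Dual ℂ (V n) :=
  (actV g⁻¹).dualMap

/-- The action on `S(V*)`: the algebra automorphism that extends the action on `V*`, that is, the
linear substitution `xᵢ ↦ xᵢ ∘ g⁻¹ = ∑ₖ (g⁻¹)ᵢₖ xₖ`. -/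
def actS (g : Matrix.unitaryGroup (Fin n) ℂ) : S n →ₐ[ℂ] S n :=
  MvPolynomial.aeval fun i => ∑ k,
    MvPolynomial.C ((g⁻¹ : Matrix.unitaryGroup (Fin n) ℂ) i k) * MvPolynomial.X k

/-- The diagonal action on `S(V*) ⊗ ∧V*`. -/
def actDForms (g : Matrix.unitaryGroup (Fin n) ℂ) : DForms n →ₐ[ℂ] DForms n :=
  Algebra.TensorProduct.map (actS g) (ExteriorAlgebra.map (actDual g))

/-- The diagonal action on `S(V*) ⊗ ∧V* ⊗ ∧V`. -/
def actForms (g : Matrix.unitaryGroup (Fin n) ℂ) : Forms n →ₐ[ℂ] Forms n :=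
  Algebra.TensorProduct.map (actDForms g) (ExteriorAlgebra.map (actV g))

theorem actDForms_smul (g : Matrix.unitaryGroup (Fin n) ℂ) (s : S n) (a : DForms n) :
    actDForms g (s • a) = actS g s • actDForms g a := by
  induction a using TensorProduct.induction_on with
  | zero => simp
  | add u v hu hv => rw [smul_add, map_add, hu, hv, map_add, smul_add]
  | tmul u v => simp [actDForms, TensorProduct.smul_tmul']

theorem actForms_smul (g : Matrix.unitaryGroup (Fin n) ℂ) (a : DForms n) (ω : Forms n) :
    actForms g (a • ω) = actDForms g a • actForms g ω := by
  induction ω using TensorProduct.induction_on with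
  | zero => simp
  | add u v hu hv => rw [smul_add, map_add, hu, hv, map_add, smul_add]
  | tmul u v => simp [actForms, TensorProduct.smul_tmul']

/-! ### Invariants -/

/-- The ring of invariants `S(V*)^W`. -/
def invS (W : Subgroup (Matrix.unitaryGroup (Fin n) ℂ)) : Subalgebra ℂ (S n) where
  carrier := {p | ∀ g ∈ W, actS g p = p}
  mul_mem' ha hb g hg := by rw [map_mul, ha g hg, hb g hg]
  add_mem' ha hb g hg := by rw [map_add, ha g hg, hb g hg]
  algebraMap_mem' c g _ := AlgHom.commutes _ c

/-- The invariant differential forms `(S(V*) ⊗ ∧V*)^W`, an algebra over `S(V*)^W`. -/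
def invDForms (W : Subgroup (Matrix.unitaryGroup (Fin n) ℂ)) :
    Subalgebra (invS W) (DForms n) where
  carrier := {a | ∀ g ∈ W, actDForms g a = a}
  mul_mem' ha hb g hg := by rw [map_mul, ha g hg, hb g hg]
  add_mem' ha hb g hg := by rw [map_add, ha g hg, hb g hg]
  algebraMap_mem' s g hg := by
    have h := actDForms_smul g (s : S n) (1 : DForms n)
    rw [s.2 g hg, map_one] at h
    rw [Algebra.algebraMap_eq_smul_one]
    exact h

instance (W : Subgroup (Matrix.unitaryGroup (Fin n) ℂ)) : Ring (invDForms W) :=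
  Subalgebra.toRing _

/-- `M_r = (S(V*) ⊗ ∧V* ⊗ ∧^r V)^W`, a module over `(S(V*) ⊗ ∧V*)^W` via multiplication into the
first two tensor factors. -/
def M (W : Subgroup (Matrix.unitaryGroup (Fin n) ℂ)) (r : ℕ) :
    Submodule (invDForms W) (Forms n) where
  carrier := {ω | (∀ g ∈ W, actForms g ω = ω) ∧
    ω ∈ Submodule.baseChange (DForms n) (⋀[ℂ]^r (V n))}
  add_mem' ha hb :=
    ⟨fun g hg => by rw [map_add, ha.1 g hg, hb.1 g hg], Submodule.add_mem _ ha.2 hb.2⟩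
  zero_mem' := ⟨fun g _ => map_zero _, Submodule.zero_mem _⟩
  smul_mem' a ω hω := by
    refine ⟨fun g hg => ?_, Submodule.smul_mem _ (a : DForms n) hω.2⟩
    have h := actForms_smul g (a : DForms n) ω
    rw [a.2 g hg, hω.1 g hg] at h
    exact h

instance (W : Subgroup (Matrix.unitaryGroup (Fin n) ℂ)) (r : ℕ) : AddCommGroup (M W r) :=
  Submodule.addCommGroup _

instance (W : Subgroup (Matrix.unitaryGroup (Fin n) ℂ)) (r : ℕ) : Module (invDForms W) (M W r) :=
  Submodule.module _

/-! ### Exterior derivative, derivations and the operators attached to derivations -/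

/-- The exterior derivative `df = ∑ᵢ ∂f/∂xᵢ ⊗ xᵢ` of a polynomial. -/
def d (f : S n) : DForms n :=
  ∑ i, MvPolynomial.pderiv i f ⊗ₜ[ℂ] ExteriorAlgebra.ι ℂ (x i)

theorem d_add (f h : S n) : d (f + h) = d f + d h := by
  simp [d, TensorProduct.add_tmul, Finset.sum_add_distrib]

theorem d_mul (f h : S n) : d (f * h) = f • d h + h • d f := by
  simp [d, TensorProduct.add_tmul, Finset.sum_add_distrib, Finset.smul_sum,
    TensorProduct.smul_tmul']

theorem d_C (c : ℂ) : d (MvPolynomial.C c : S n) = 0 := by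
  simp [d]

theorem actDForms_d (g : Matrix.unitaryGroup (Fin n) ℂ) (f : S n) :
    actDForms g (d f) = d (actS g f) := by
  induction f using MvPolynomial.induction_on with
  | C c => simp [d_C, actS]
  | add p q hp hq => rw [d_add, map_add, hp, hq, map_add, d_add]
  | mul_X p i hp =>
    have hX : actDForms g (d (MvPolynomial.X i)) = d (actS g (MvPolynomial.X i)) := by
      have hx : actDual g (x i)
          = ∑ k, ((g⁻¹ : Matrix.unitaryGroup (Fin n) ℂ) i k) • (x k : Module.Dual ℂ (V n)) := by
        ext v
        simp [actDual, actV, x, Matrix.toLin'_apply, Pi.single_apply]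
      have hl : d (MvPolynomial.X i : S n) = 1 ⊗ₜ[ℂ] ExteriorAlgebra.ι ℂ (x i) := by
        unfold d
        rw [Finset.sum_eq_single i]
        · simp
        · intro b _ hb
          simp [MvPolynomial.pderiv_X, hb.symm]
        · simp
      have hs : ∀ (t : Finset (Fin n)) (c : Fin n → ℂ),
          d (∑ k ∈ t, MvPolynomial.C (c k) * MvPolynomial.X k : S n)
            = 1 ⊗ₜ[ℂ] ExteriorAlgebra.ι ℂ (∑ k ∈ t, c k • (x k : Module.Dual ℂ (V n))) := by
        intro t c
        induction t using Finset.induction_on with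
        | empty => simp [d]
        | insert a t ha ih =>
          rw [Finset.sum_insert ha, d_add, ih, d_mul, d_C, smul_zero, add_zero,
            Finset.sum_insert ha, map_add, TensorProduct.tmul_add]
          congr 1
          have hl' : d (MvPolynomial.X a : S n) = 1 ⊗ₜ[ℂ] ExteriorAlgebra.ι ℂ (x a) := by
            unfold d
            rw [Finset.sum_eq_single a]
            · simp
            · intro b _ hb
              simp [MvPolynomial.pderiv_X, hb.symm]
            · simp
          rw [hl', map_smul, TensorProduct.smul_tmul', TensorProduct.tmul_smul,
            TensorProduct.smul_tmul']
          congr 1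
          simp [MvPolynomial.smul_eq_C_mul]
      rw [hl]
      simp only [actDForms, Algebra.TensorProduct.map_tmul, map_one, ExteriorAlgebra.map_apply_ι,
        hx]
      simp only [actS, MvPolynomial.aeval_X]
      rw [hs]
    rw [d_mul, map_add, actDForms_smul, actDForms_smul, hp, hX, map_mul, d_mul]

/-- The differential of an invariant polynomial, as an invariant differential form. -/
def dInv {W : Subgroup (Matrix.unitaryGroup (Fin n) ℂ)} (f : invS W) : invDForms W :=
  ⟨d (f : S n), fun g hg => by rw [actDForms_d, f.2 g hg]⟩

/-- A derivation `θ = ∑ⱼ hⱼ ⊗ yⱼ` in `S(V*) ⊗ V` is given by its coefficients `h₁, …, hₙ`; this is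
the corresponding element of `S(V*) ⊗ ∧⁰V* ⊗ ∧¹V`. -/
def derivForm (h : Fin n → S n) : Forms n :=
  ∑ j, (h j ⊗ₜ[ℂ] 1) ⊗ₜ[ℂ] ExteriorAlgebra.ι ℂ (y j)

/-- The `S(V*)^W`-module of invariant derivations `(S(V*) ⊗ V)^W`. -/
def invDer (W : Subgroup (Matrix.unitaryGroup (Fin n) ℂ)) :
    Submodule (invS W) (Fin n → S n) where
  carrier := {h | ∀ g ∈ W, actForms g (derivForm h) = derivForm h}
  add_mem' {a b} ha hb g hg := by
    have h : derivForm (a + b) = derivForm a + derivForm b := by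
      simp [derivForm, TensorProduct.add_tmul, Finset.sum_add_distrib]
    rw [h, map_add, ha g hg, hb g hg]
  zero_mem' g _ := by simp [derivForm]
  smul_mem' s h hh g hg := by
    have e : derivForm (s • h) = (((s : S n) ⊗ₜ[ℂ] 1 : DForms n)) • derivForm h := by
      simp [derivForm, Finset.smul_sum, TensorProduct.smul_tmul', Subalgebra.smul_def]
    rw [e, actForms_smul, hh g hg]
    simp [actDForms, s.2 g hg]

instance (W : Subgroup (Matrix.unitaryGroup (Fin n) ℂ)) : AddCommGroup (invDer W) :=
  Submodule.addCommGroup _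

instance (W : Subgroup (Matrix.unitaryGroup (Fin n) ℂ)) : Module (invS W) (invDer W) :=
  Submodule.module _

instance (W : Subgroup (Matrix.unitaryGroup (Fin n) ℂ)) : DistribSMul (invS W) (invDer W) :=
  Module.toDistribMulAction.toDistribSMul

instance (W : Subgroup (Matrix.unitaryGroup (Fin n) ℂ)) : SMul (invS W) (invDer W) :=
  Module.toDistribMulAction.toSMul

/-- The constant coefficient differential operator `p(∂/∂x₁, …, ∂/∂xₙ)` on `S(V*)`. -/
def diffOp (p : S n) : Module.End ℂ (S n) :=
  ∑ m ∈ p.support,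
    p.coeff m • (List.ofFn fun i => (MvPolynomial.pderiv i).toLinearMap ^ m i).prod

/-- For `θ = ∑ⱼ hⱼ ⊗ yⱼ`, the operator `θ̃` on `S(V*) ⊗ ∧V* ⊗ ∧V` given by
`f ⊗ η ⊗ η' ↦ ∑ⱼ h̄ⱼ(∂/∂x₁, …, ∂/∂xₙ)(f) ⊗ (xⱼ ∧ η) ⊗ η'`, where `h̄ⱼ` is `hⱼ` with its
coefficients conjugated. -/
def tilde (h : Fin n → S n) : Module.End ℂ (Forms n) :=
  ∑ j, TensorProduct.map
    (TensorProduct.map (diffOp (MvPolynomial.map (starRingEnd ℂ) (h j)))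
      (LinearMap.mulLeft ℂ (ExteriorAlgebra.ι ℂ (x j))))
    LinearMap.id

/-! ### Reflection groups -/

/-- A reflection is a transformation whose fixed space is a hyperplane. -/
def IsReflection (g : Matrix.unitaryGroup (Fin n) ℂ) : Prop :=
  Module.finrank ℂ (LinearMap.ker (actV g - 1)) + 1 = n

/-- `W` is generated by the reflections it contains. -/
def IsReflectionGroup (W : Subgroup (Matrix.unitaryGroup (Fin n) ℂ)) : Prop :=
  Subgroup.closure {g | g ∈ W ∧ IsReflection g} = W

/-- The representation of `W` on `V`. -/
def rep (W : Subgroup (Matrix.unitaryGroup (Fin n) ℂ)) : Representation ℂ W (V n) where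
  toFun g := actV (g : Matrix.unitaryGroup (Fin n) ℂ)
  map_one' := by simp [actV]; rfl
  map_mul' a b := by simp [actV, Matrix.toLin'_mul]; rfl

/-- `f₁, …, fₙ` are basic invariants of degrees `deg₁ ≤ ⋯ ≤ degₙ`: homogeneous, algebraically
independent generators of the algebra `S(V*)^W`. -/
structure IsBasicInvariants {W : Subgroup (Matrix.unitaryGroup (Fin n) ℂ)}
    (f : Fin n → invS W) (deg : Fin n → ℕ) : Prop where
  homogeneous : ∀ i, (f i : S n).IsHomogeneous (deg i)
  monotone : Monotone deg
  algebraicIndependent : AlgebraicIndependent ℂ f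
  generate : Algebra.adjoin ℂ (Set.range f) = ⊤

/-- The basis `θ₁, …, θₙ` of the `S(V*)^W`-module `(S(V*) ⊗ V)^W` is a set of basic derivations,
with coexponents `e*₁ ≤ ⋯ ≤ e*ₙ`: all coefficients of `θᵢ` are homogeneous of degree `e*ᵢ`. -/
structure IsBasicDerivations {W : Subgroup (Matrix.unitaryGroup (Fin n) ℂ)}
    (θ : Module.Basis (Fin n) (invS W) (invDer W)) (coexp : Fin n → ℕ) : Prop where
  homogeneous : ∀ i j, ((θ i : Fin n → S n) j).IsHomogeneous (coexp i)
  monotone : Monotone coexp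

/-- `deg₁ ≤ ⋯ ≤ degₙ` are the degrees of `W`. -/
def IsDegrees (W : Subgroup (Matrix.unitaryGroup (Fin n) ℂ)) (deg : Fin n → ℕ) : Prop :=
  ∃ f : Fin n → invS W, IsBasicInvariants f deg

/-- `e*₁ ≤ ⋯ ≤ e*ₙ` are the coexponents of `W`. -/
def IsCoexponents (W : Subgroup (Matrix.unitaryGroup (Fin n) ℂ)) (coexp : Fin n → ℕ) : Prop :=
  ∃ θ : Module.Basis (Fin n) (invS W) (invDer W), IsBasicDerivations θ coexp

/-- A coincidental reflection group: an irreducible reflection group that is a duality group,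
`eᵢ + e*ₙ₊₁₋ᵢ = max dⱼ` with exponents `eᵢ = dᵢ - 1`, and whose exponents form an arithmetic
sequence with a positive gap `a`. The degrees and the coexponents exist for every finite reflection
group, and do not depend on the choice of basic invariants and derivations. -/
structure IsCoincidental (W : Subgroup (Matrix.unitaryGroup (Fin n) ℂ)) : Prop where
  finite : Finite W
  reflectionGroup : IsReflectionGroup W
  irreducible : (rep W).IsIrreducible
  exists_degrees : ∃ deg, IsDegrees W deg
  exists_coexponents : ∃ coexp, IsCoexponents W coexp
  duality : ∀ deg coexp, IsDegrees W deg → IsCoexponents W coexp →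
    ∀ i, (deg i - 1) + coexp (Fin.rev i) = Finset.univ.sup deg
  arithmetic : ∀ deg, IsDegrees W deg → ∃ e₁ a : ℕ, 0 < a ∧ ∀ i, deg i - 1 = e₁ + i * a

/-! ### The module `M_r` over the exterior subalgebra, and the candidate basis -/

/-- The exterior subalgebra `R_r = ∧_{S(V*)^W} {df₁, …, dfₙ₋ᵣ}`, as the `S(V*)^W`-subalgebra of
`(S(V*) ⊗ ∧V*)^W` generated by `df₁, …, dfₙ₋ᵣ`. -/
def R {W : Subgroup (Matrix.unitaryGroup (Fin n) ℂ)} (f : Fin n → invS W) (r : ℕ) :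
    Subalgebra (invS W) (invDForms W) :=
  Algebra.adjoin (invS W) (Set.range fun l : Fin (n - r) => dInv (f (Fin.castLE (n.sub_le r) l)))

instance {W : Subgroup (Matrix.unitaryGroup (Fin n) ℂ)} (f : Fin n → invS W) (r : ℕ) :
    Module (R f r) (M W r) :=
  Subalgebra.moduleLeft _

instance {W : Subgroup (Matrix.unitaryGroup (Fin n) ℂ)} (f : Fin n → invS W) (r : ℕ) :
    DistribSMul (R f r) (M W r) :=
  Module.toDistribMulAction.toDistribSMul

instance {W : Subgroup (Matrix.unitaryGroup (Fin n) ℂ)} (f : Fin n → invS W) (r : ℕ) :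
    SMul (R f r) (M W r) :=
  Module.toDistribMulAction.toSMul

/-- `df_L = df_{l₁} ∧ ⋯ ∧ df_{lₘ}` for `L = {l₁ < ⋯ < lₘ} ⊆ {1, …, n - r}`. -/
def dWedge {W : Subgroup (Matrix.unitaryGroup (Fin n) ℂ)} (f : Fin n → invS W) (r : ℕ)
    (L : Finset (Fin (n - r))) : DForms n :=
  ((L.sort (· ≤ ·)).map fun l => d (f (Fin.castLE (n.sub_le r) l) : S n)).prod

/-- `θ_J = θ_{j₁} ∧ ⋯ ∧ θ_{jᵣ}` for `J = {j₁ < ⋯ < jᵣ} ⊆ {1, …, n}`. -/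
def thetaWedge (θ : Fin n → Fin n → S n) (J : Finset (Fin n)) : Forms n :=
  ((J.sort (· ≤ ·)).map fun j => derivForm (θ j)).prod

/-- `θ̃_I = θ̃_{i₁} ⋯ θ̃_{iₖ}` for `I = {i₁ < ⋯ < iₖ} ⊆ {1, …, r}`. -/
def tildeProd (θ : Fin n → Fin n → S n) {r : ℕ} (hr : r ≤ n) (I : Finset (Fin r)) :
    Module.End ℂ (Forms n) :=
  ((I.sort (· ≤ ·)).map fun i => tilde (θ (Fin.castLE hr i))).prod

/-- Pairs `(I, J)` with `I ⊆ {1, …, r}`, `J ⊆ {1, …, n}` and `|J| = r`. -/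
abbrev Idx (n r : ℕ) : Type := Finset (Fin r) × {J : Finset (Fin n) // J.card = r}

/-- The form `θ̃_I(θ_J)`. -/
def elt (θ : Fin n → Fin n → S n) {r : ℕ} (hr : r ≤ n) (p : Idx n r) : Forms n :=
  tildeProd θ hr p.1 (thetaWedge θ p.2.1)

end MixedForms

end

open MixedForms

/-!
The forms `df_L θ̃_I(θ_J)` are invariant, and there are as many of them as the rank
`2ⁿ (n choose r)` of `S ⊗ ∧V* ⊗ ∧^r V` over `S`. The proof is a determinant criterion in the style
of Saito: a linearly independent family of that size spans the invariant forms over the invariants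
as soon as the determinant `Δ` of its coefficients has the smallest possible degree.

*Lower bound.* Let `J` be the Jacobian determinant of the basic invariants (`jac`) and `Q` the
determinant of the basic derivations (`derDet`). The determinant of every family of
`2ⁿ (n choose r)` invariant forms in `S ⊗ ∧V* ⊗ ∧^r V` is divisible by `J ^ A * Q ^ B` with
`A = 2 ^ (n - 1) * (n - 1).choose r` and `B = 2 ^ (n - 1) * (n - 1).choose (r - 1)`
(`jac_pow_mul_derDet_pow_dvd`). This is checked at one prime `p` of `S` at a time, through the
elements of `W` that act trivially on `S / p`. If only the identity does, then `p` divides neither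
`J` nor `Q`. Otherwise `p` is a linear form; after a unitary change of coordinates it is a
coordinate `x_{i₀}`, and its inertia group is generated by a diagonal reflection of some order `e`.
The eigenvalues of this reflection show that the column of the determinant at
`x_A ⊗ y_B` is divisible by `x_{i₀} ^ (e - 1)` if `i₀ ∈ A \ B` and by `x_{i₀}` if `i₀ ∈ B \ A`
(`X_pow_dvd_det_coordMatrix`), while `x_{i₀} ^ e` does not divide `J` and `x_{i₀} ^ 2` does not
divide `Q`. These upper bounds hold because a further factor would give, modulo `x_{i₀}`, a linear
relation between the coefficients of all invariants or of all invariant derivations. For the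
invariants it amounts to a derivation that kills all of them, and orbit polynomials with simple
roots exclude that (`derivation_eq_zero`); for the invariant derivations, averaging over `W` and
Dedekind's independence of characters do (`sum_filter_eq_zero_of_forall`).

*Degrees.* By the arithmetic progression of the exponents and by duality, the coexponents form an
arithmetic progression with the same gap, so the degrees of the forms `df_L θ̃_I(θ_J)` add up to the
degree of `J ^ A * Q ^ B` (`sum_degrees`). As `Δ ≠ 0`, it is a nonzero scalar multiple of
`J ^ A * Q ^ B`.

*Conclusion.* By Cramer's rule the coefficients of an invariant form with respect to the family are
quotients by `Δ` of determinants of invariant families, hence polynomials (`exists_combination`),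
and by uniqueness they are invariant. As `R_r` is spanned over the invariants by the `df_L`, the
forms `θ̃_I(θ_J)` are a basis over `R_r` (`exists_basis`).
-/

noncomputable section

namespace MixedForms

variable {n : ℕ}

/-! ### The group actions are actions -/

theorem actS_X (g : Matrix.unitaryGroup (Fin n) ℂ) (i : Fin n) :
    actS g (MvPolynomial.X i) = ∑ k,
      MvPolynomial.C ((g⁻¹ : Matrix.unitaryGroup (Fin n) ℂ) i k) * MvPolynomial.X k := by
  simp [actS]

theorem actS_C (g : Matrix.unitaryGroup (Fin n) ℂ) (c : ℂ) :
    actS g (MvPolynomial.C c) = MvPolynomial.C c :=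
  (actS g).commutes c

theorem actS_one : actS (1 : Matrix.unitaryGroup (Fin n) ℂ) = AlgHom.id ℂ (S n) := by
  refine MvPolynomial.algHom_ext fun i => ?_
  rw [actS_X]
  simp [Matrix.one_apply]

theorem actS_mul (g h : Matrix.unitaryGroup (Fin n) ℂ) :
    actS (g * h) = (actS g).comp (actS h) := by
  refine MvPolynomial.algHom_ext fun i => ?_
  simp only [AlgHom.comp_apply, actS_X, map_sum, map_mul, actS_C, mul_inv_rev,
    Matrix.UnitaryGroup.mul_val, Matrix.mul_apply, Finset.sum_mul, Finset.mul_sum, mul_assoc]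
  exact Finset.sum_comm

theorem actS_mul_apply (g h : Matrix.unitaryGroup (Fin n) ℂ) (p : S n) :
    actS (g * h) p = actS g (actS h p) := by
  rw [actS_mul]; rfl

@[simp] theorem actS_inv_apply (g : Matrix.unitaryGroup (Fin n) ℂ) (p : S n) :
    actS g⁻¹ (actS g p) = p := by
  rw [← actS_mul_apply, inv_mul_cancel, actS_one]; rfl

@[simp] theorem actS_apply_inv (g : Matrix.unitaryGroup (Fin n) ℂ) (p : S n) :
    actS g (actS g⁻¹ p) = p := by
  rw [← actS_mul_apply, mul_inv_cancel, actS_one]; rfl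

theorem actS_injective (g : Matrix.unitaryGroup (Fin n) ℂ) : Function.Injective (actS g) :=
  Function.LeftInverse.injective (actS_inv_apply g)

theorem actS_dvd_iff (g : Matrix.unitaryGroup (Fin n) ℂ) {p q : S n} :
    actS g p ∣ actS g q ↔ p ∣ q := by
  refine ⟨fun h => ?_, map_dvd _⟩
  simpa using map_dvd (actS g⁻¹) h

theorem inv_apply (g : Matrix.unitaryGroup (Fin n) ℂ) (i j : Fin n) :
    (g⁻¹ : Matrix.unitaryGroup (Fin n) ℂ) i j = starRingEnd ℂ (g j i) := by
  rfl

theorem actV_mul (g h : Matrix.unitaryGroup (Fin n) ℂ) :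
    actV (g * h) = actV g ∘ₗ actV h := by
  simp [actV, Matrix.toLin'_mul]

theorem actDual_mul (g h : Matrix.unitaryGroup (Fin n) ℂ) :
    actDual (g * h) = actDual g ∘ₗ actDual h := by
  simp [actDual, actV_mul, LinearMap.dualMap_comp_dualMap]

theorem actDual_x (g : Matrix.unitaryGroup (Fin n) ℂ) (i : Fin n) :
    actDual g (x i)
      = ∑ k, ((g⁻¹ : Matrix.unitaryGroup (Fin n) ℂ) i k) • (x k : Module.Dual ℂ (V n)) := by
  ext v
  simp [actDual, actV, x, Matrix.toLin'_apply, Pi.single_apply]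

theorem actV_y (g : Matrix.unitaryGroup (Fin n) ℂ) (j : Fin n) :
    actV g (y j) = ∑ k, (g k j) • (y k : V n) := by
  ext v
  simp [actV, y, Matrix.toLin'_apply, Pi.single_apply]

theorem actForms_tmul (g : Matrix.unitaryGroup (Fin n) ℂ) (p : S n)
    (η : ExteriorAlgebra ℂ (Module.Dual ℂ (V n))) (η' : ExteriorAlgebra ℂ (V n)) :
    actForms g ((p ⊗ₜ η) ⊗ₜ η') = (actS g p ⊗ₜ ExteriorAlgebra.map (actDual g) η) ⊗ₜ
      ExteriorAlgebra.map (actV g) η' := by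
  simp [actForms, actDForms]

/-- Linear maps out of the space of forms agree as soon as they agree on pure tensors. -/
theorem forms_hom_ext {E : Type*} [AddCommGroup E] [Module ℂ E] {F G : Forms n →ₗ[ℂ] E}
    (h : ∀ p η η', F ((p ⊗ₜ η) ⊗ₜ η') = G ((p ⊗ₜ η) ⊗ₜ η')) : F = G := by
  refine TensorProduct.ext' fun a η' => ?_
  induction a using TensorProduct.induction_on with
  | zero => simp
  | add u v hu hv => rw [TensorProduct.add_tmul, map_add, map_add, hu, hv]
  | tmul p η => exact h p η η'

theorem actForms_mul_apply (g h : Matrix.unitaryGroup (Fin n) ℂ) (ω : Forms n) :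
    actForms (g * h) ω = actForms g (actForms h ω) := by
  have : (actForms (g * h)).toLinearMap
      = (actForms g).toLinearMap ∘ₗ (actForms h).toLinearMap := by
    refine forms_hom_ext fun p η η' => ?_
    simp only [AlgHom.toLinearMap_apply, LinearMap.comp_apply, actForms_tmul, actS_mul_apply,
      actDual_mul, actV_mul]
    rw [← ExteriorAlgebra.map_comp_map, ← ExteriorAlgebra.map_comp_map]
    rfl
  exact congrArg (fun F => F ω) this

theorem actForms_one_apply (ω : Forms n) :
    actForms (1 : Matrix.unitaryGroup (Fin n) ℂ) ω = ω := by
  have : (actForms (1 : Matrix.unitaryGroup (Fin n) ℂ)).toLinearMap = LinearMap.id := by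
    refine forms_hom_ext fun p η η' => ?_
    have h1 : actV (1 : Matrix.unitaryGroup (Fin n) ℂ) = LinearMap.id := by simp [actV]
    have h2 : actDual (1 : Matrix.unitaryGroup (Fin n) ℂ) = LinearMap.id := by
      simp [actDual, h1]
    simp only [AlgHom.toLinearMap_apply, actForms_tmul, actS_one, h1, h2,
      ExteriorAlgebra.map_id]
    rfl
  exact congrArg (fun F => F ω) this

theorem actForms_smul_poly (g : Matrix.unitaryGroup (Fin n) ℂ) (p : S n) (ω : Forms n) :
    actForms g (p • ω) = actS g p • actForms g ω := by
  rw [← one_smul (DForms n) ω, ← smul_assoc, actForms_smul, actDForms_smul, map_one, one_smul,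
    smul_assoc, one_smul]

theorem actForms_derivForm (g : Matrix.unitaryGroup (Fin n) ℂ) (h : Fin n → S n) :
    actForms g (derivForm h)
      = derivForm fun k => ∑ j, MvPolynomial.C (g k j) * actS g (h j) := by
  simp only [derivForm, map_sum, actForms_tmul, ExteriorAlgebra.map_apply_ι, actV_y, map_one,
    map_smul, TensorProduct.tmul_sum, TensorProduct.sum_tmul]
  rw [Finset.sum_comm]
  refine Finset.sum_congr rfl fun k _ => Finset.sum_congr rfl fun j _ => ?_
  rw [TensorProduct.tmul_smul, TensorProduct.smul_tmul', TensorProduct.smul_tmul',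
    MvPolynomial.smul_eq_C_mul]

/-! ### Derivatives and constant coefficient differential operators -/

theorem pderiv_comm (i j : Fin n) (p : S n) :
    MvPolynomial.pderiv i (MvPolynomial.pderiv j p)
      = MvPolynomial.pderiv j (MvPolynomial.pderiv i p) := by
  have : ⁅(MvPolynomial.pderiv i : Derivation ℂ (S n) (S n)),
      (MvPolynomial.pderiv j : Derivation ℂ (S n) (S n))⁆ = 0 := by
    refine MvPolynomial.derivation_ext fun k => ?_
    have key : ∀ a b : Fin n,
        MvPolynomial.pderiv a (MvPolynomial.pderiv b (MvPolynomial.X k : S n)) = 0 := by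
      intro a b
      rw [MvPolynomial.pderiv_X, Pi.single_apply]
      split_ifs <;> simp
    rw [Derivation.commutator_apply, key, key, sub_zero, Derivation.zero_apply]
  have h := congrArg (fun D : Derivation ℂ (S n) (S n) => D p) this
  simpa [Derivation.commutator_apply, sub_eq_zero] using h

/-- The chain rule for the linear substitution `actS g`. -/
theorem pderiv_actS (g : Matrix.unitaryGroup (Fin n) ℂ) (j : Fin n) (p : S n) :
    MvPolynomial.pderiv j (actS g p) = ∑ k,
      MvPolynomial.C ((g⁻¹ : Matrix.unitaryGroup (Fin n) ℂ) k j)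
        * actS g (MvPolynomial.pderiv k p) := by
  induction p using MvPolynomial.induction_on with
  | C c => simp
  | add p q hp hq => simp [hp, hq, mul_add, Finset.sum_add_distrib]
  | mul_X p i hp =>
    have hX : MvPolynomial.pderiv j (actS g (MvPolynomial.X i))
        = MvPolynomial.C ((g⁻¹ : Matrix.unitaryGroup (Fin n) ℂ) i j) := by
      rw [actS_X, map_sum, Finset.sum_eq_single j]
      · simp
      · intro b _ hb
        simp [MvPolynomial.pderiv_X, hb]
      · simp
    have hk : ∀ k, MvPolynomial.pderiv k (p * MvPolynomial.X i)
        = (if k = i then p else 0) + MvPolynomial.X i * MvPolynomial.pderiv k p := by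
      intro k
      rw [Derivation.leibniz, MvPolynomial.pderiv_X]
      by_cases h : k = i
      · subst h; simp
      · simp [h]
    rw [map_mul, Derivation.leibniz, hp, hX]
    simp only [hk, smul_eq_mul, map_add, map_mul, mul_add, Finset.sum_add_distrib]
    congr 1
    · simp [apply_ite (actS g), mul_comm]
    · rw [Finset.mul_sum]
      exact Finset.sum_congr rfl fun k _ => by ring

/-- The differential operator attached to a monomial. -/
def monOp (m : Fin n →₀ ℕ) : Module.End ℂ (S n) :=
  (List.ofFn fun i => (MvPolynomial.pderiv i : Derivation ℂ (S n) (S n)).toLinearMap ^ m i).prod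

theorem diffOp_eq_sum (p : S n) {t : Finset (Fin n →₀ ℕ)} (ht : p.support ⊆ t) :
    diffOp p = ∑ m ∈ t, p.coeff m • monOp m :=
  Finset.sum_subset ht fun m _ hm => by
    rw [MvPolynomial.notMem_support_iff.mp hm, zero_smul]

theorem commute_pderiv (i j : Fin n) :
    Commute (MvPolynomial.pderiv i : Derivation ℂ (S n) (S n)).toLinearMap
      (MvPolynomial.pderiv j : Derivation ℂ (S n) (S n)).toLinearMap :=
  LinearMap.ext fun p => pderiv_comm i j p

theorem monOp_add (m m' : Fin n →₀ ℕ) : monOp (m + m') = monOp m * monOp m' := by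
  have key : ∀ l : List (Fin n),
      (l.map fun i => (MvPolynomial.pderiv i : Derivation ℂ (S n) (S n)).toLinearMap
        ^ (m + m') i).prod
      = (l.map fun i => (MvPolynomial.pderiv i : Derivation ℂ (S n) (S n)).toLinearMap
        ^ m i).prod * (l.map fun i =>
          (MvPolynomial.pderiv i : Derivation ℂ (S n) (S n)).toLinearMap ^ m' i).prod := by
    intro l
    induction l with
    | nil => simp
    | cons a l ih =>
      have hc : Commute ((MvPolynomial.pderiv a : Derivation ℂ (S n) (S n)).toLinearMap ^ m' a)
          (l.map fun i => (MvPolynomial.pderiv i : Derivation ℂ (S n) (S n)).toLinearMap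
            ^ m i).prod := by
        refine Commute.list_prod_right _ _ fun b hb => ?_
        obtain ⟨i, -, rfl⟩ := List.mem_map.mp hb
        exact (commute_pderiv a i).pow_pow _ _
      rw [List.map_cons, List.prod_cons, ih, List.map_cons, List.prod_cons, List.map_cons,
        List.prod_cons, Finsupp.add_apply, pow_add, mul_assoc, mul_assoc, ← mul_assoc _ _
          (List.prod _), hc.eq, mul_assoc]
  unfold monOp
  rw [List.ofFn_eq_map, List.ofFn_eq_map, List.ofFn_eq_map]
  exact key _

theorem monOp_single (i : Fin n) :
    monOp (Finsupp.single i 1)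
      = (MvPolynomial.pderiv i : Derivation ℂ (S n) (S n)).toLinearMap := by
  unfold monOp
  rw [List.ofFn_eq_map, List.prod_map_eq_pow_single i]
  · rw [(List.nodup_finRange n).count, if_pos (List.mem_finRange i)]
    simp
  · intro j hj _
    rw [Finsupp.single_apply, if_neg (Ne.symm hj), pow_zero]

theorem monOp_zero : monOp (0 : Fin n →₀ ℕ) = 1 := by
  unfold monOp
  rw [List.ofFn_eq_map]
  simp

theorem diffOp_add (p q : S n) : diffOp (p + q) = diffOp p + diffOp q := by
  classical
  rw [diffOp_eq_sum (p + q) MvPolynomial.support_add,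
    diffOp_eq_sum p Finset.subset_union_left, diffOp_eq_sum q Finset.subset_union_right,
    ← Finset.sum_add_distrib]
  exact Finset.sum_congr rfl fun m _ => by rw [MvPolynomial.coeff_add, add_smul]

theorem diffOp_monomial (m : Fin n →₀ ℕ) (c : ℂ) :
    diffOp (MvPolynomial.monomial m c) = c • monOp m := by
  rw [diffOp_eq_sum _ MvPolynomial.support_monomial_subset]
  simp

theorem diffOp_C_mul (c : ℂ) (p : S n) : diffOp (MvPolynomial.C c * p) = c • diffOp p := by
  induction p using MvPolynomial.induction_on' with
  | monomial m a => rw [MvPolynomial.C_mul_monomial, diffOp_monomial, diffOp_monomial, mul_smul]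
  | add p q hp hq => rw [mul_add, diffOp_add, hp, hq, diffOp_add, smul_add]

theorem diffOp_C (c : ℂ) : diffOp (MvPolynomial.C c : S n) = c • 1 := by
  rw [MvPolynomial.C_apply, diffOp_monomial, monOp_zero]

theorem diffOp_mul_X (p : S n) (i : Fin n) : diffOp (p * MvPolynomial.X i)
    = diffOp p * (MvPolynomial.pderiv i : Derivation ℂ (S n) (S n)).toLinearMap := by
  induction p using MvPolynomial.induction_on' with
  | monomial m a =>
    rw [MvPolynomial.X, MvPolynomial.monomial_mul, diffOp_monomial, diffOp_monomial, monOp_add,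
      monOp_single, mul_one, smul_mul_assoc]
  | add p q hp hq => rw [add_mul, diffOp_add, hp, hq, diffOp_add, add_mul]

theorem diffOp_sum {ι : Type*} (t : Finset ι) (p : ι → S n) :
    diffOp (∑ i ∈ t, p i) = ∑ i ∈ t, diffOp (p i) := by
  classical
  induction t using Finset.induction_on with
  | empty => simp [diffOp]
  | insert a t ha ih => rw [Finset.sum_insert ha, Finset.sum_insert ha, diffOp_add, ih]

/-- The operator `p̄(∂/∂x₁, …, ∂/∂xₙ)`. -/
abbrev conjOp (p : S n) : Module.End ℂ (S n) := diffOp (MvPolynomial.map (starRingEnd ℂ) p)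

/-- Unitarity makes `p ↦ p̄(∂)` equivariant. -/
theorem actS_conjOp (g : Matrix.unitaryGroup (Fin n) ℂ) (p q : S n) :
    actS g (conjOp p q) = conjOp (actS g p) (actS g q) := by
  induction p using MvPolynomial.induction_on generalizing q with
  | C c => simp [conjOp, diffOp_C]
  | add p p' hp hp' =>
    simp only [conjOp, map_add, diffOp_add, LinearMap.add_apply] at hp hp' ⊢
    rw [hp, hp']
  | mul_X p i hp =>
    have h1 : conjOp (p * MvPolynomial.X i) q = conjOp p (MvPolynomial.pderiv i q) := by
      simp [conjOp, diffOp_mul_X]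
    rw [h1, hp, map_mul, actS_X]
    simp only [conjOp, map_mul, map_sum, MvPolynomial.map_C, MvPolynomial.map_X, Finset.mul_sum,
      diffOp_sum, LinearMap.sum_apply]
    have h2 : ∀ k, diffOp (MvPolynomial.map (starRingEnd ℂ) (actS g p)
          * (MvPolynomial.C (starRingEnd ℂ ((g⁻¹ : Matrix.unitaryGroup (Fin n) ℂ) i k))
            * MvPolynomial.X k)) (actS g q)
        = diffOp (MvPolynomial.map (starRingEnd ℂ) (actS g p)) (MvPolynomial.C (g k i)
            * MvPolynomial.pderiv k (actS g q)) := by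
      intro k
      rw [mul_left_comm, diffOp_C_mul, diffOp_mul_X, inv_apply, Complex.conj_conj,
        ← MvPolynomial.smul_eq_C_mul, map_smul]
      rfl
    rw [Finset.sum_congr rfl fun k _ => h2 k, ← map_sum]
    congr 1
    simp only [pderiv_actS, Finset.mul_sum]
    rw [Finset.sum_comm]
    have h3 : ∀ l, ∑ k, MvPolynomial.C (g k i) *
        (MvPolynomial.C ((g⁻¹ : Matrix.unitaryGroup (Fin n) ℂ) l k)
          * actS g (MvPolynomial.pderiv l q))
        = MvPolynomial.C ((1 : Matrix (Fin n) (Fin n) ℂ) l i)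
          * actS g (MvPolynomial.pderiv l q) := by
      intro l
      have : (1 : Matrix (Fin n) (Fin n) ℂ) l i
          = ∑ k, (g⁻¹ : Matrix.unitaryGroup (Fin n) ℂ) l k * g k i := by
        rw [← Matrix.mul_apply, ← Matrix.UnitaryGroup.mul_val, inv_mul_cancel]
        rfl
      rw [this, map_sum, Finset.sum_mul]
      refine Finset.sum_congr rfl fun k _ => ?_
      rw [map_mul]
      ring
    rw [Finset.sum_congr rfl fun l _ => h3 l]
    simp [Matrix.one_apply]

theorem tilde_tmul (h : Fin n → S n) (p : S n)
    (η : ExteriorAlgebra ℂ (Module.Dual ℂ (V n))) (η' : ExteriorAlgebra ℂ (V n)) :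
    tilde h ((p ⊗ₜ η) ⊗ₜ η')
      = ∑ j, (conjOp (h j) p ⊗ₜ (ExteriorAlgebra.ι ℂ (x j) * η)) ⊗ₜ η' := by
  simp [tilde, conjOp]

/-- The standard basis of `V`. -/
def basisV (n : ℕ) : Module.Basis (Fin n) ℂ (V n) := Pi.basisFun ℂ (Fin n)

/-- The dual basis of `V*`. -/
def basisDual (n : ℕ) : Module.Basis (Fin n) ℂ (Module.Dual ℂ (V n)) :=
  (Pi.basisFun ℂ (Fin n)).dualBasis

theorem basisV_apply (j : Fin n) : basisV n j = y j := by
  simp [basisV, y]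

theorem basisDual_apply (j : Fin n) : basisDual n j = x j := by
  ext v
  simp [basisDual, x]

/-- The basis of the `S`-module of mixed forms that consists of the products
`x_{a₁} ∧ ⋯ ∧ x_{aₖ} ⊗ y_{b₁} ∧ ⋯ ∧ y_{bₗ}`, indexed by pairs `(A, B)` of subsets of `{1, …, n}`. -/
def formBasis (n : ℕ) : Module.Basis (Finset (Fin n) × Finset (Fin n)) (S n) (Forms n) :=
  (Algebra.TensorProduct.basis (S n) (basisDual n).ExteriorAlgebra).smulTower
    (Algebra.TensorProduct.basis (DForms n) (basisV n).ExteriorAlgebra)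

theorem formBasis_apply (A B : Finset (Fin n)) : formBasis n (A, B)
    = ((1 : S n) ⊗ₜ[ℂ] (basisDual n).ExteriorAlgebra A) ⊗ₜ[ℂ] (basisV n).ExteriorAlgebra B := by
  simp [formBasis, TensorProduct.smul_tmul']

theorem formBasis_repr_tmul (p : S n) (η : ExteriorAlgebra ℂ (Module.Dual ℂ (V n)))
    (η' : ExteriorAlgebra ℂ (V n)) (c : Finset (Fin n) × Finset (Fin n)) :
    (formBasis n).repr ((p ⊗ₜ η) ⊗ₜ η') c
      = MvPolynomial.C ((basisV n).ExteriorAlgebra.repr η' c.2) *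
        (MvPolynomial.C ((basisDual n).ExteriorAlgebra.repr η c.1) * p) := by
  simp only [formBasis, Module.Basis.smulTower_repr, Algebra.TensorProduct.basis_repr_tmul,
    Finsupp.smul_apply, Finsupp.mapRange_apply]
  simp
  ring

theorem exteriorAlgebra_empty {E : Type*} [AddCommGroup E] [Module ℂ E]
    (b : Module.Basis (Fin n) ℂ E) : b.ExteriorAlgebra ∅ = 1 := by
  rw [ExteriorAlgebra.basis_apply_ofCard b Finset.card_empty, ExteriorAlgebra.ιMulti_family,
    ExteriorAlgebra.ιMulti_zero_apply]

theorem exteriorAlgebra_singleton {E : Type*} [AddCommGroup E] [Module ℂ E]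
    (b : Module.Basis (Fin n) ℂ E) (j : Fin n) :
    b.ExteriorAlgebra {j} = ExteriorAlgebra.ι ℂ (b j) := by
  rw [ExteriorAlgebra.basis_apply_ofCard b (Finset.card_singleton j), ExteriorAlgebra.ιMulti_family,
    ExteriorAlgebra.ιMulti_apply]
  simp [Set.powersetCard.ofFinEmbEquiv_symm_apply]

theorem derivForm_injective : Function.Injective (derivForm (n := n)) := by
  have key : ∀ u : Fin n → S n, derivForm u = ∑ j, u j • formBasis n (∅, {j}) := by
    intro u
    refine Finset.sum_congr rfl fun j _ => ?_
    rw [formBasis_apply, exteriorAlgebra_empty, exteriorAlgebra_singleton, basisV_apply,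
      TensorProduct.smul_tmul', TensorProduct.smul_tmul', smul_eq_mul, mul_one]
  have key' : ∀ (u : Fin n → S n) (k), (formBasis n).repr (derivForm u) (∅, {k}) = u k := by
    intro u k
    simp [key, Finsupp.single_apply]
  intro h h' e
  funext k
  rw [← key' h k, e, key' h' k]

/-- The invariance of a derivation, in coordinates. -/
theorem mem_invDer_iff {W : Subgroup (Matrix.unitaryGroup (Fin n) ℂ)} {h : Fin n → S n} :
    h ∈ invDer W ↔
      ∀ g ∈ W, ∀ k, ∑ j, MvPolynomial.C (g k j) * actS g (h j) = h k := by
  refine forall₂_congr fun g _ => ?_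
  rw [actForms_derivForm, derivForm_injective.eq_iff, funext_iff]

/-- The operator attached to an invariant derivation commutes with the group. -/
theorem actForms_tilde (g : Matrix.unitaryGroup (Fin n) ℂ) {h : Fin n → S n}
    (hg : ∀ k, ∑ j, MvPolynomial.C (g k j) * actS g (h j) = h k) (ω : Forms n) :
    actForms g (tilde h ω) = tilde h (actForms g ω) := by
  have : (actForms g).toLinearMap ∘ₗ tilde h = tilde h ∘ₗ (actForms g).toLinearMap := by
    refine forms_hom_ext fun p η η' => ?_
    simp only [LinearMap.comp_apply, AlgHom.toLinearMap_apply, tilde_tmul, map_sum, actForms_tmul,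
      actS_conjOp, map_mul, ExteriorAlgebra.map_apply_ι, actDual_x, Finset.sum_mul,
      TensorProduct.tmul_sum, TensorProduct.sum_tmul]
    rw [Finset.sum_comm]
    refine Finset.sum_congr rfl fun k _ => ?_
    rw [← TensorProduct.sum_tmul]
    congr 1
    have e : ∀ j, conjOp (actS g (h j)) (actS g p) ⊗ₜ[ℂ]
          (ExteriorAlgebra.ι ℂ
              ((g⁻¹ : Matrix.unitaryGroup (Fin n) ℂ) j k • (x k : Module.Dual ℂ (V n)))
            * ExteriorAlgebra.map (actDual g) η)
        = (conjOp (MvPolynomial.C (g k j) * actS g (h j)) (actS g p)) ⊗ₜ[ℂ]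
          (ExteriorAlgebra.ι ℂ (x k) * ExteriorAlgebra.map (actDual g) η) := by
      intro j
      rw [map_smul, smul_mul_assoc, TensorProduct.tmul_smul, TensorProduct.smul_tmul', inv_apply]
      congr 1
      simp only [conjOp, map_mul, MvPolynomial.map_C, diffOp_C_mul]
      rfl
    rw [Finset.sum_congr rfl fun j _ => e j, ← TensorProduct.sum_tmul]
    congr 1
    rw [← hg k]
    simp only [conjOp, map_sum, diffOp_sum, LinearMap.sum_apply]
  exact congrArg (fun F => F ω) this

/-! ### Forms of exterior degree `r` in `V` -/

/-- The `S`-module `S ⊗ ∧V* ⊗ ∧^r V`. -/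
abbrev block (n r : ℕ) : Submodule (DForms n) (Forms n) :=
  Submodule.baseChange (DForms n) (⋀[ℂ]^r (V n))

/-- The index set of the part of `formBasis` that lies in `S ⊗ ∧V* ⊗ ∧^r V`. -/
abbrev Col (n r : ℕ) : Type := Finset (Fin n) × {B : Finset (Fin n) // B.card = r}

theorem smul_mem_block {r : ℕ} (p : S n) {ω : Forms n} (h : ω ∈ block n r) : p • ω ∈ block n r := by
  rw [← one_smul (DForms n) ω, ← smul_assoc]
  exact Submodule.smul_mem _ _ h

theorem block_induction {r : ℕ} {P : Forms n → Prop} (h0 : P 0)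
    (hadd : ∀ ω ω', P ω → P ω' → P (ω + ω'))
    (ht : ∀ p η, ∀ v ∈ ⋀[ℂ]^r (V n), P ((p ⊗ₜ η) ⊗ₜ v)) {ω : Forms n} (h : ω ∈ block n r) :
    P ω := by
  have h' : ω ∈ Submodule.span (DForms n)
      ((⋀[ℂ]^r (V n)).map (TensorProduct.mk ℂ (DForms n) _ 1) : Set (Forms n)) := by
    rw [← Submodule.baseChange_eq_span]
    exact h
  refine Submodule.closure_induction (p := fun ω _ => P ω) h0 (fun a b _ _ => hadd a b) ?_ h'
  rintro a _ ⟨v, hv, rfl⟩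
  induction a using TensorProduct.induction_on with
  | zero => simpa using h0
  | add a b ha hb => rw [add_smul]; exact hadd _ _ ha hb
  | tmul p η => simpa [TensorProduct.smul_tmul'] using ht p η v hv

theorem formBasis_mem_block {r : ℕ} (A B : Finset (Fin n)) (hB : B.card = r) :
    formBasis n (A, B) ∈ block n r := by
  rw [formBasis_apply]
  refine Submodule.tmul_mem_baseChange_of_mem _ ?_
  subst hB
  have := ExteriorAlgebra.basis_eq_coe_basis (basisV n) (⟨B, rfl⟩ : Set.powersetCard (Fin n) B.card)
  rw [show (basisV n).ExteriorAlgebra B = _ from this]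
  exact Subtype.property _

theorem repr_eq_zero_of_mem_block {r : ℕ} {ω : Forms n} (h : ω ∈ block n r)
    (A B : Finset (Fin n)) (hB : B.card ≠ r) : (formBasis n).repr ω (A, B) = 0 := by
  refine block_induction (P := fun ω => (formBasis n).repr ω (A, B) = 0) ?_ ?_ ?_ h
  · simp
  · intro a b ha hb
    simp [ha, hb]
  · intro p η v hv
    rw [formBasis_repr_tmul]
    have : (basisV n).ExteriorAlgebra.repr v B = 0 := by
      rw [← exteriorPower.ιMulti_family_span_fixedDegree_of_span ℂ (basisV n).span_eq] at hv
      induction hv using Submodule.span_induction with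
      | mem _ hx =>
        obtain ⟨s, rfl⟩ := hx
        rw [← ExteriorAlgebra.basis_apply_powersetCard, Module.Basis.repr_self,
          Finsupp.single_apply, if_neg]
        rintro rfl
        exact hB s.2
      | zero => simp
      | add a b _ _ ha hb => simp [ha, hb]
      | smul c a _ ha => simp [ha]
    simp [this]

theorem eq_sum_of_mem_block {r : ℕ} {ω : Forms n} (h : ω ∈ block n r) :
    ω = ∑ c : Col n r, (formBasis n).repr ω (c.1, c.2.1) • formBasis n (c.1, c.2.1) := by
  conv_lhs => rw [← (formBasis n).sum_repr ω]
  rw [Fintype.sum_prod_type, Fintype.sum_prod_type]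
  refine Finset.sum_congr rfl fun A _ => ?_
  symm
  refine Fintype.sum_of_injective Subtype.val Subtype.val_injective _ _ ?_ fun _ => rfl
  intro B hB
  rw [repr_eq_zero_of_mem_block h, zero_smul]
  rintro rfl
  exact hB ⟨⟨B, rfl⟩, rfl⟩

theorem actForms_mem_block {r : ℕ} (g : Matrix.unitaryGroup (Fin n) ℂ) {ω : Forms n}
    (h : ω ∈ block n r) : actForms g ω ∈ block n r := by
  refine block_induction (P := fun ω => actForms g ω ∈ block n r) ?_ ?_ ?_ h
  · rw [map_zero]; exact Submodule.zero_mem _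
  · intro a b ha hb
    rw [map_add]
    exact Submodule.add_mem _ ha hb
  · intro p η v hv
    rw [actForms_tmul]
    refine Submodule.tmul_mem_baseChange_of_mem _ ?_
    have : (⋀[ℂ]^r (V n)).map (ExteriorAlgebra.map (actV g)).toLinearMap ≤ ⋀[ℂ]^r (V n) := by
      rw [Submodule.map_pow]
      refine pow_le_pow_left' ?_ _
      rintro _ ⟨_, ⟨u, rfl⟩, rfl⟩
      exact ⟨actV g u, by simp⟩
    exact this ⟨v, hv, rfl⟩

/-- The matrix of coefficients of a family of forms in `S ⊗ ∧V* ⊗ ∧^r V`. -/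
def coordMatrix {n r : ℕ} {ι : Type*} (w : ι → Forms n) : Matrix ι (Col n r) (S n) :=
  Matrix.of fun q c => (formBasis n).repr (w q) (c.1, c.2.1)

/-- The action of a unitary matrix changes the coefficients of forms by a substitution and an
invertible constant matrix. -/
theorem exists_det_coordMatrix_act {r : ℕ} (g : Matrix.unitaryGroup (Fin n) ℂ) :
    ∃ u : S n, IsUnit u ∧ ∀ w : Col n r → Forms n, (∀ q, w q ∈ block n r) →
      (coordMatrix (r := r) fun q => actForms g (w q)).det
        = actS g (coordMatrix (r := r) w).det * u := by
  classical
  let T : Matrix (Col n r) (Col n r) (S n) :=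
    coordMatrix fun c : Col n r => actForms g (formBasis n (c.1, c.2.1))
  have key : ∀ w : Col n r → Forms n, (∀ q, w q ∈ block n r) →
      (coordMatrix (r := r) fun q => actForms g (w q)).det
        = actS g (coordMatrix (r := r) w).det * T.det := by
    intro w hw
    rw [AlgHom.map_det, ← Matrix.det_mul]
    congr 1
    refine Matrix.ext fun q c => ?_
    have e := congrArg (fun ω => (formBasis n).repr (actForms g ω) (c.1, c.2.1))
      (eq_sum_of_mem_block (hw q))
    simp only [map_sum, actForms_smul_poly, map_smul, Finsupp.coe_finsetSum, Finset.sum_apply,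
      Finsupp.smul_apply, smul_eq_mul] at e
    rw [Matrix.mul_apply]
    exact e
  refine ⟨T.det, ?_, key⟩
  have h1 := key (fun c => actForms g⁻¹ (formBasis n (c.1, c.2.1))) fun c =>
    actForms_mem_block _ (formBasis_mem_block _ _ c.2.2)
  have h2 : (coordMatrix (r := r) fun c : Col n r => actForms g (actForms g⁻¹
      (formBasis n (c.1, c.2.1)))) = 1 := by
    refine Matrix.ext fun c c' => ?_
    simp only [coordMatrix, Matrix.of_apply, ← actForms_mul_apply, mul_inv_cancel,
      actForms_one_apply, Module.Basis.repr_self, Finsupp.single_apply,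
      Matrix.one_apply, Prod.ext_iff, Subtype.ext_iff]
  rw [h2, Matrix.det_one] at h1
  exact IsUnit.of_mul_eq_one_right _ h1.symm

/-! ### Diagonal matrices -/

theorem exteriorAlgebra_map_diagonal {E : Type*} [AddCommGroup E] [Module ℂ E]
    (b : Module.Basis (Fin n) ℂ E) (F : E →ₗ[ℂ] E) (c : Fin n → ℂ) (h : ∀ i, F (b i) = c i • b i)
    (A : Finset (Fin n)) :
    ExteriorAlgebra.map F (b.ExteriorAlgebra A) = (∏ i ∈ A, c i) • b.ExteriorAlgebra A := by
  rw [ExteriorAlgebra.basis_apply_ofCard b rfl, ExteriorAlgebra.ιMulti_family,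
    ExteriorAlgebra.map_apply_ιMulti]
  have : F ∘ (b ∘ (Set.powersetCard.ofFinEmbEquiv.symm
        (Set.powersetCard.ofCard (rfl : A.card = A.card))))
      = fun i => c (A.orderEmbOfFin rfl i) • b (A.orderEmbOfFin rfl i) := by
    funext i
    exact h _
  have hp : ∏ i, c (A.orderEmbOfFin rfl i) = ∏ i ∈ A, c i := by
    conv_rhs => rw [← Finset.image_orderEmbOfFin_univ A rfl]
    rw [Finset.prod_image fun _ _ _ _ h => (A.orderEmbOfFin rfl).injective h]
  rw [this, ← hp]
  exact (ExteriorAlgebra.ιMulti ℂ A.card).toMultilinearMap.map_smul_univ _ _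

theorem repr_actForms_of_diagonal (s : Matrix.unitaryGroup (Fin n) ℂ) (c : Fin n → ℂ)
    (hs : (s : Matrix (Fin n) (Fin n) ℂ) = Matrix.diagonal c) (ω : Forms n)
    (A B : Finset (Fin n)) :
    (formBasis n).repr (actForms s ω) (A, B)
      = MvPolynomial.C ((∏ i ∈ A, starRingEnd ℂ (c i)) * ∏ i ∈ B, c i)
        * actS s ((formBasis n).repr ω (A, B)) := by
  have hV : ∀ i, actV s (basisV n i) = c i • basisV n i := by
    intro i
    rw [basisV_apply, actV_y, Finset.sum_eq_single i]
    · rw [hs, Matrix.diagonal_apply_eq]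
    · intro k _ hk
      rw [hs, Matrix.diagonal_apply_ne _ hk, zero_smul]
    · simp
  have hD : ∀ i, actDual s (basisDual n i) = starRingEnd ℂ (c i) • basisDual n i := by
    intro i
    rw [basisDual_apply, actDual_x, Finset.sum_eq_single i]
    · rw [inv_apply, hs, Matrix.diagonal_apply_eq]
    · intro k _ hk
      rw [inv_apply, hs, Matrix.diagonal_apply_ne _ hk, map_zero, zero_smul]
    · simp
  have hb : ∀ A B : Finset (Fin n), actForms s (formBasis n (A, B))
      = (MvPolynomial.C ((∏ i ∈ A, starRingEnd ℂ (c i)) * ∏ i ∈ B, c i) : S n)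
        • formBasis n (A, B) := by
    intro A B
    rw [formBasis_apply, actForms_tmul, map_one, exteriorAlgebra_map_diagonal _ _ _ hV,
      exteriorAlgebra_map_diagonal _ _ _ hD]
    rw [TensorProduct.tmul_smul, TensorProduct.tmul_smul, TensorProduct.smul_tmul',
      TensorProduct.smul_tmul', TensorProduct.smul_tmul', TensorProduct.smul_tmul',
      TensorProduct.smul_tmul', smul_smul, MvPolynomial.smul_eq_C_mul, smul_eq_mul,
      mul_comm (∏ i ∈ B, c i)]
  conv_lhs => rw [← (formBasis n).sum_repr ω]
  simp only [map_sum, actForms_smul_poly, map_smul, Finsupp.coe_finsetSum, Finset.sum_apply,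
      Finsupp.smul_apply, smul_eq_mul, hb, Module.Basis.repr_self]
  rw [Finset.sum_eq_single (A, B)]
  · simp [mul_comm]
  · rintro c' - hc'
    simp [hc']
  · simp

/-! ### Determinants of differentials and of derivations -/

/-- The Jacobian determinant of `f₁, …, fₙ`. -/
def jac (f : Fin n → S n) : S n := (Matrix.of fun i j => MvPolynomial.pderiv j (f i)).det

/-- The determinant of the coefficients of `θ₁, …, θₙ`. -/
def derDet (θ : Fin n → Fin n → S n) : S n := (Matrix.of θ).det

/-- The action of a matrix on derivations, in coordinates. -/
def actDer (g : Matrix.unitaryGroup (Fin n) ℂ) (h : Fin n → S n) : Fin n → S n :=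
  fun k => ∑ j, MvPolynomial.C (g k j) * actS g (h j)

theorem isUnit_det_map_C (g : Matrix.unitaryGroup (Fin n) ℂ) :
    IsUnit ((g : Matrix (Fin n) (Fin n) ℂ).map (MvPolynomial.C : ℂ →+* S n)).det := by
  have := (Matrix.UnitaryGroup.det_isUnit g).map (MvPolynomial.C : ℂ →+* S n)
  rwa [RingHom.map_det] at this

theorem associated_jac_act (g : Matrix.unitaryGroup (Fin n) ℂ) (f : Fin n → S n) :
    Associated (jac fun i => actS g (f i)) (actS g (jac f)) := by
  have : (Matrix.of fun i j => MvPolynomial.pderiv j (actS g (f i)))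
      = (actS g).mapMatrix (Matrix.of fun i j => MvPolynomial.pderiv j (f i))
        * ((g⁻¹ : Matrix.unitaryGroup (Fin n) ℂ) : Matrix (Fin n) (Fin n) ℂ).map
          (MvPolynomial.C : ℂ →+* S n) := by
    refine Matrix.ext fun i j => ?_
    rw [Matrix.mul_apply, Matrix.of_apply, pderiv_actS]
    exact Finset.sum_congr rfl fun k _ => mul_comm _ _
  rw [jac, this, Matrix.det_mul, jac, AlgHom.map_det]
  exact associated_mul_unit_left _ _ (isUnit_det_map_C g⁻¹)

theorem associated_derDet_act (g : Matrix.unitaryGroup (Fin n) ℂ) (θ : Fin n → Fin n → S n) :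
    Associated (derDet fun i => actDer g (θ i)) (actS g (derDet θ)) := by
  have : (Matrix.of fun i => actDer g (θ i)) = (actS g).mapMatrix (Matrix.of θ)
      * ((g : Matrix (Fin n) (Fin n) ℂ).map (MvPolynomial.C : ℂ →+* S n)).transpose := by
    refine Matrix.ext fun i j => ?_
    rw [Matrix.mul_apply, Matrix.of_apply, actDer]
    exact Finset.sum_congr rfl fun k _ => mul_comm (MvPolynomial.C (g j k)) _
  rw [derDet, this, Matrix.det_mul, derDet, AlgHom.map_det, Matrix.det_transpose]
  exact associated_mul_unit_left _ _ (isUnit_det_map_C g)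

/-! ### Degrees -/

/-- Homogeneous polynomials whose degree is an integer `k`; only `0` if `k < 0`. With degrees in `ℤ`
a constant coefficient operator of degree `e` lowers degrees by `e` without exception. -/
def homZ (n : ℕ) (k : ℤ) : Submodule ℂ (S n) where
  carrier := {p | ∀ m, p.coeff m ≠ 0 → (m.degree : ℤ) = k}
  zero_mem' m hm := absurd (MvPolynomial.coeff_zero m) hm
  add_mem' {p q} hp hq m hm := by
    by_cases h : p.coeff m = 0
    · refine hq m fun h' => hm ?_
      rw [MvPolynomial.coeff_add, h, h', add_zero]
    · exact hp m h
  smul_mem' c p hp m hm := hp m fun h => hm (by rw [MvPolynomial.coeff_smul, h, smul_zero])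

theorem mem_homZ_of_isHomogeneous {p : S n} {k : ℕ} (hp : p.IsHomogeneous k) :
    p ∈ homZ n k := by
  intro m hm
  have h : m.degree = k := (DFunLike.congr_fun Finsupp.degree_eq_weight_one m).trans (hp hm)
  exact_mod_cast h

theorem C_mem_homZ (c : ℂ) : MvPolynomial.C c ∈ homZ n 0 :=
  mem_homZ_of_isHomogeneous (MvPolynomial.isHomogeneous_C _ c)

theorem one_mem_homZ : (1 : S n) ∈ homZ n 0 := C_mem_homZ 1

theorem mul_mem_homZ {p q : S n} {k l : ℤ} (hp : p ∈ homZ n k) (hq : q ∈ homZ n l) :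
    p * q ∈ homZ n (k + l) := by
  classical
  intro m hm
  rw [MvPolynomial.coeff_mul] at hm
  obtain ⟨⟨a, b⟩, hab, h⟩ := Finset.exists_ne_zero_of_sum_ne_zero hm
  rw [← hp a (left_ne_zero_of_mul h), ← hq b (right_ne_zero_of_mul h),
    ← Finset.HasAntidiagonal.mem_antidiagonal.mp hab, map_add]
  push_cast
  rfl

theorem C_mul_mem_homZ (c : ℂ) {p : S n} {k : ℤ} (hp : p ∈ homZ n k) :
    MvPolynomial.C c * p ∈ homZ n k := by
  rw [← MvPolynomial.smul_eq_C_mul]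
  exact Submodule.smul_mem _ _ hp

theorem prod_mem_homZ {ι : Type*} (t : Finset ι) (p : ι → S n) (k : ι → ℤ)
    (h : ∀ i ∈ t, p i ∈ homZ n (k i)) : ∏ i ∈ t, p i ∈ homZ n (∑ i ∈ t, k i) := by
  classical
  induction t using Finset.induction_on with
  | empty => simpa using one_mem_homZ
  | insert a t ha ih =>
    rw [Finset.prod_insert ha, Finset.sum_insert ha]
    exact mul_mem_homZ (h a (Finset.mem_insert_self _ _))
      (ih fun i hi => h i (Finset.mem_insert_of_mem hi))

theorem pow_mem_homZ {p : S n} {k : ℤ} (hp : p ∈ homZ n k) (m : ℕ) : p ^ m ∈ homZ n (m * k) := by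
  simpa using prod_mem_homZ (Finset.range m) (fun _ => p) (fun _ => k) fun _ _ => hp

theorem det_mem_homZ {ι : Type*} [Fintype ι] [DecidableEq ι] (X : Matrix ι ι (S n)) (k : ι → ℤ)
    (h : ∀ i j, X i j ∈ homZ n (k i)) : X.det ∈ homZ n (∑ i, k i) := by
  rw [Matrix.det_apply]
  refine Submodule.sum_mem _ fun σ _ => ?_
  rw [← Equiv.sum_comp σ k]
  rw [Units.smul_def, ← Int.cast_smul_eq_zsmul ℂ]
  exact Submodule.smul_mem _ _ (prod_mem_homZ _ _ _ fun i _ => h _ _)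

theorem totalDegree_of_mem_homZ {p : S n} {k : ℤ} (hp : p ∈ homZ n k) (h0 : p ≠ 0) :
    (p.totalDegree : ℤ) = k := by
  obtain ⟨m, hm⟩ := MvPolynomial.ne_zero_iff.mp h0
  have hk := hp m hm
  have : p.IsHomogeneous m.degree := by
    intro m' hm'
    have h := hp m' hm'
    have h' : m'.degree = m.degree := by omega
    exact (DFunLike.congr_fun Finsupp.degree_eq_weight_one m').symm.trans h'
  rw [this.totalDegree h0, hk]

theorem pderiv_mem_homZ {p : S n} {k : ℤ} (hp : p ∈ homZ n k) (i : Fin n) :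
    MvPolynomial.pderiv i p ∈ homZ n (k - 1) := by
  intro m hm
  rw [MvPolynomial.coeff_pderiv] at hm
  have := hp _ (left_ne_zero_of_mul hm)
  rw [map_add, Finsupp.degree_single] at this
  push_cast at this
  linarith

theorem monOp_mem_homZ (m : Fin n →₀ ℕ) {q : S n} {k : ℤ} (hq : q ∈ homZ n k) :
    monOp m q ∈ homZ n (k - m.degree) := by
  have key : ∀ (j : ℕ) (i : Fin n) {q : S n} {k : ℤ}, q ∈ homZ n k →
      monOp (Finsupp.single i j) q ∈ homZ n (k - j) := by
    intro j i
    induction j with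
    | zero => intro q k hq; simpa [monOp_zero] using hq
    | succ j ih =>
      intro q k hq
      rw [Finsupp.single_add, monOp_add, monOp_single]
      have := ih (pderiv_mem_homZ hq i)
      rw [show k - ((j + 1 : ℕ) : ℤ) = k - 1 - j by push_cast; ring]
      exact this
  induction m using Finsupp.induction_linear generalizing q k with
  | zero => simpa [monOp_zero] using hq
  | add a b ha hb =>
    have := ha (hb hq)
    rw [monOp_add, map_add]
    push_cast
    rw [show k - ((a.degree : ℤ) + b.degree) = k - b.degree - a.degree by ring]
    exact this
  | single i j => rw [Finsupp.degree_single]; exact key j i hq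

theorem conjOp_mem_homZ {p q : S n} {e k : ℤ} (hp : p ∈ homZ n e) (hq : q ∈ homZ n k) :
    conjOp p q ∈ homZ n (k - e) := by
  rw [conjOp, diffOp_eq_sum _ subset_rfl, LinearMap.sum_apply]
  refine Submodule.sum_mem _ fun m hm => Submodule.smul_mem _ _ ?_
  rw [MvPolynomial.mem_support_iff, MvPolynomial.coeff_map] at hm
  rw [← hp m fun h => hm (by rw [h, map_zero])]
  exact monOp_mem_homZ m hq

/-- The forms all of whose coefficients are homogeneous of the integral degree `k`. -/
def formsZ (n : ℕ) (k : ℤ) : Submodule ℂ (Forms n) :=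
  Submodule.span ℂ {ω | ∃ p ∈ homZ n k, ∃ η η', ω = (p ⊗ₜ η) ⊗ₜ η'}

theorem tmul_mem_formsZ {p : S n} {k : ℤ} (hp : p ∈ homZ n k)
    (η : ExteriorAlgebra ℂ (Module.Dual ℂ (V n))) (η' : ExteriorAlgebra ℂ (V n)) :
    ((p ⊗ₜ η) ⊗ₜ η' : Forms n) ∈ formsZ n k :=
  Submodule.subset_span ⟨p, hp, η, η', rfl⟩

theorem one_mem_formsZ : (1 : Forms n) ∈ formsZ n 0 := tmul_mem_formsZ one_mem_homZ 1 1

theorem mul_mem_formsZ {ω ω' : Forms n} {k l : ℤ} (hω : ω ∈ formsZ n k) (hω' : ω' ∈ formsZ n l) :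
    ω * ω' ∈ formsZ n (k + l) := by
  induction hω, hω' using Submodule.span_induction₂ with
  | mem_mem _ _ h h' =>
    obtain ⟨p, hp, η, η', rfl⟩ := h
    obtain ⟨q, hq, ξ, ξ', rfl⟩ := h'
    rw [Algebra.TensorProduct.tmul_mul_tmul, Algebra.TensorProduct.tmul_mul_tmul]
    exact tmul_mem_formsZ (mul_mem_homZ hp hq) _ _
  | zero_left _ _ => rw [zero_mul]; exact Submodule.zero_mem _
  | zero_right _ _ => rw [mul_zero]; exact Submodule.zero_mem _
  | add_left _ _ _ _ _ _ h h' => rw [add_mul]; exact Submodule.add_mem _ h h'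
  | add_right _ _ _ _ _ _ h h' => rw [mul_add]; exact Submodule.add_mem _ h h'
  | smul_left c _ _ _ _ h => rw [smul_mul_assoc]; exact Submodule.smul_mem _ _ h
  | smul_right c _ _ _ _ h => rw [mul_smul_comm]; exact Submodule.smul_mem _ _ h

theorem tilde_mem_formsZ {h : Fin n → S n} {e k : ℤ} (hh : ∀ j, h j ∈ homZ n e) {ω : Forms n}
    (hω : ω ∈ formsZ n k) : tilde h ω ∈ formsZ n (k - e) := by
  induction hω using Submodule.span_induction with
  | mem _ h' =>
    obtain ⟨p, hp, η, η', rfl⟩ := h'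
    rw [tilde_tmul]
    exact Submodule.sum_mem _ fun j _ => tmul_mem_formsZ (conjOp_mem_homZ (hh j) hp) _ _
  | zero => rw [map_zero]; exact Submodule.zero_mem _
  | add _ _ _ _ h h' => rw [map_add]; exact Submodule.add_mem _ h h'
  | smul c _ _ h => rw [map_smul]; exact Submodule.smul_mem _ _ h

theorem derivForm_mem_formsZ {h : Fin n → S n} {e : ℤ} (hh : ∀ j, h j ∈ homZ n e) :
    derivForm h ∈ formsZ n e :=
  Submodule.sum_mem _ fun j _ => tmul_mem_formsZ (hh j) _ _

theorem d_tmul_one_mem_formsZ {f : S n} {k : ℤ} (hf : ∀ i, MvPolynomial.pderiv i f ∈ homZ n k) :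
    (d f ⊗ₜ[ℂ] 1 : Forms n) ∈ formsZ n k := by
  rw [d, TensorProduct.sum_tmul]
  exact Submodule.sum_mem _ fun j _ => tmul_mem_formsZ (hf j) _ _

theorem sum_sort {m : ℕ} (t : Finset (Fin m)) (k : Fin m → ℤ) :
    ((t.sort (· ≤ ·)).map k).sum = ∑ i ∈ t, k i := by
  rw [Finset.sum, ← Multiset.sum_coe, ← Multiset.map_coe, Finset.sort_eq]

theorem prod_mem_formsZ {m : ℕ} (l : List (Fin m)) (F : Fin m → Forms n) (k : Fin m → ℤ)
    (h : ∀ i, F i ∈ formsZ n (k i)) : (l.map F).prod ∈ formsZ n (l.map k).sum := by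
  induction l with
  | nil => exact one_mem_formsZ
  | cons a l ih =>
    simp only [List.map_cons, List.prod_cons, List.sum_cons]
    exact mul_mem_formsZ (h a) ih

theorem thetaWedge_mem_formsZ {θ : Fin n → Fin n → S n} {e : Fin n → ℤ}
    (h : ∀ i j, θ i j ∈ homZ n (e i)) (J : Finset (Fin n)) :
    thetaWedge θ J ∈ formsZ n (∑ j ∈ J, e j) := by
  rw [← sum_sort]
  exact prod_mem_formsZ _ _ _ fun i => derivForm_mem_formsZ (h i)

theorem tildeProd_mem_formsZ {θ : Fin n → Fin n → S n} {e : Fin n → ℤ}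
    (h : ∀ i j, θ i j ∈ homZ n (e i)) {r : ℕ} (hr : r ≤ n) (I : Finset (Fin r)) {ω : Forms n}
    {k : ℤ} (hω : ω ∈ formsZ n k) :
    tildeProd θ hr I ω ∈ formsZ n (k - ∑ i ∈ I, e (Fin.castLE hr i)) := by
  rw [← sum_sort I fun i => e (Fin.castLE hr i), tildeProd]
  induction I.sort (· ≤ ·) with
  | nil => simpa using hω
  | cons a l ih =>
    simp only [List.map_cons, List.prod_cons, List.sum_cons]
    rw [sub_add_eq_sub_sub_swap]
    exact tilde_mem_formsZ (h _) ih

theorem smul_eq_tmul_one_mul (a : DForms n) (ω : Forms n) : a • ω = (a ⊗ₜ[ℂ] 1 : Forms n) * ω := by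
  induction ω using TensorProduct.induction_on with
  | zero => simp
  | add u v hu hv => rw [smul_add, mul_add, hu, hv]
  | tmul u v => simp [TensorProduct.smul_tmul']

theorem dWedge_smul_mem_formsZ {W : Subgroup (Matrix.unitaryGroup (Fin n) ℂ)} {f : Fin n → invS W}
    {e : Fin n → ℤ} (h : ∀ i j, MvPolynomial.pderiv j (f i : S n) ∈ homZ n (e i)) {r : ℕ}
    (L : Finset (Fin (n - r))) {ω : Forms n} {k : ℤ} (hω : ω ∈ formsZ n k) :
    dWedge f r L • ω ∈ formsZ n (∑ l ∈ L, e (Fin.castLE (n.sub_le r) l) + k) := by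
  rw [← sum_sort L fun l => e (Fin.castLE (n.sub_le r) l), dWedge]
  induction L.sort (· ≤ ·) with
  | nil => simpa using hω
  | cons a l ih =>
    simp only [List.map_cons, List.prod_cons, List.sum_cons]
    rw [add_assoc, mul_smul, smul_eq_tmul_one_mul]
    exact mul_mem_formsZ (d_tmul_one_mem_formsZ (h _)) ih

theorem repr_mem_homZ {ω : Forms n} {k : ℤ} (hω : ω ∈ formsZ n k)
    (c : Finset (Fin n) × Finset (Fin n)) : (formBasis n).repr ω c ∈ homZ n k := by
  induction hω using Submodule.span_induction with
  | mem _ h' =>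
    obtain ⟨p, hp, η, η', rfl⟩ := h'
    rw [formBasis_repr_tmul]
    exact C_mul_mem_homZ _ (C_mul_mem_homZ _ hp)
  | zero => simp
  | add _ _ _ _ h h' => rw [map_add]; exact Submodule.add_mem _ h h'
  | smul a ω _ h =>
    rw [show a • ω = (MvPolynomial.C a : S n) • ω by
      rw [← MvPolynomial.algebraMap_eq, algebraMap_smul], map_smul]
    exact C_mul_mem_homZ _ h

/-! ### Derivations that vanish on the invariants -/

/-- A derivation over `φ` that kills the generators `fᵢ` kills everything they generate. -/
theorem derivation_eq_zero_of_mem_adjoin {A : Subalgebra ℂ (S n)} {K : Type*} [CommRing K]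
    [Algebra ℂ K] (φ : S n →ₐ[ℂ] K) (D : A →ₗ[ℂ] K)
    (hD : ∀ a b : A, D (a * b) = φ a * D b + φ b * D a) (f : Fin n → S n)
    (hf : ∀ i, ∃ h : f i ∈ A, D ⟨f i, h⟩ = 0) {p : S n} (hp : p ∈ Algebra.adjoin ℂ (Set.range f)) :
    ∃ h : p ∈ A, D ⟨p, h⟩ = 0 := by
  induction hp using Algebra.adjoin_induction with
  | mem _ h => obtain ⟨i, rfl⟩ := h; exact hf i
  | algebraMap c =>
    have h1 : D 1 = 0 := by
      have := hD 1 1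
      simpa using this
    refine ⟨A.algebraMap_mem c, ?_⟩
    rw [show (⟨algebraMap ℂ (S n) c, A.algebraMap_mem c⟩ : A) = c • 1 from
      (Algebra.algebraMap_eq_smul_one (A := A) c), map_smul, h1, smul_zero]
  | add a b _ _ ha hb =>
    obtain ⟨ha, ha'⟩ := ha
    obtain ⟨hb, hb'⟩ := hb
    exact ⟨A.add_mem ha hb, by
      rw [show (⟨a + b, A.add_mem ha hb⟩ : A) = ⟨a, ha⟩ + ⟨b, hb⟩ from rfl, map_add, ha', hb',
        add_zero]⟩
  | mul a b _ _ ha hb =>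
    obtain ⟨ha, ha'⟩ := ha
    obtain ⟨hb, hb'⟩ := hb
    exact ⟨A.mul_mem ha hb, by
      rw [show (⟨a * b, A.mul_mem ha hb⟩ : A) = ⟨a, ha⟩ * ⟨b, hb⟩ from rfl, hD, ha', hb',
        mul_zero, mul_zero, add_zero]⟩

/-- If the coefficients of `F` are killed by the derivation `D`, then `D(F(b)) = F'(b) D(b)`. -/
theorem derivation_eval {A : Subalgebra ℂ (S n)} {K : Type*} [CommRing K]
    [Algebra ℂ K] (φ : S n →ₐ[ℂ] K) (D : A →ₗ[ℂ] K)
    (hD : ∀ a b : A, D (a * b) = φ a * D b + φ b * D a) (F : Polynomial (S n))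
    (hF : ∀ k, ∃ h : F.coeff k ∈ A, D ⟨F.coeff k, h⟩ = 0) (b : A) (hb : F.eval (b : S n) = 0) :
    φ (F.derivative.eval (b : S n)) * D b = 0 := by
  choose hA hF using hF
  have hpow : ∀ k : ℕ, D (b ^ k) = k * φ b ^ (k - 1) * D b := by
    intro k
    induction k with
    | zero =>
      have := hD 1 1
      simpa using this
    | succ k ih =>
      rw [pow_succ, hD, ih]
      rcases k with _ | k
      · simp
      · simp only [Nat.add_sub_cancel]
        push_cast
        rw [map_pow]
        ring
  have h1 : ∑ k ∈ F.support, (⟨F.coeff k, hA k⟩ * b ^ k : A) = 0 := by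
    apply Subtype.ext
    rw [Polynomial.eval_eq_sum, Polynomial.sum] at hb
    simpa using hb
  have h2 := congrArg D h1
  simp only [map_sum, hD, hF, hpow, mul_zero, add_zero, map_zero] at h2
  rw [Polynomial.derivative_eval, Polynomial.sum, map_sum, Finset.sum_mul, ← h2]
  refine Finset.sum_congr rfl fun k _ => ?_
  simp only [map_mul, map_pow, map_natCast]
  ring

/-- Let `D : A → K` be a derivation over `φ : S → K` that kills the invariants of the finite group
`W`. If every element of `W` acts trivially on `A` or is seen by `φ`, then `D = 0`: an element `b`
with `D b ≠ 0` can be chosen such that it is a root of its orbit polynomial that stays simple in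
`K`. -/
theorem derivation_eq_zero {W : Subgroup (Matrix.unitaryGroup (Fin n) ℂ)} [Finite W]
    {A : Subalgebra ℂ (S n)} {K : Type*} [CommRing K] [IsDomain K]
    [Algebra ℂ K] (φ : S n →ₐ[ℂ] K) (D : A →ₗ[ℂ] K)
    (hD : ∀ a b : A, D (a * b) = φ a * D b + φ b * D a)
    (h0 : ∀ p : S n, (∀ g ∈ W, actS g p = p) → ∃ h : p ∈ A, D ⟨p, h⟩ = 0)
    (hW : ∀ g ∈ W, (∀ a ∈ A, actS g a = a) ∨ ∃ a ∈ A, φ (actS g a) ≠ φ a) : D = 0 := by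
  classical
  by_contra hne
  have hker : LinearMap.ker D ≠ ⊤ := fun h => hne (LinearMap.ker_eq_top.mp h)
  let E : W → Submodule ℂ A := fun g =>
    LinearMap.ker ((φ.comp (actS (g : Matrix.unitaryGroup (Fin n) ℂ))).toLinearMap ∘ₗ
      A.val.toLinearMap - φ.toLinearMap ∘ₗ A.val.toLinearMap)
  let P : Option W → Submodule ℂ A := fun o =>
    o.elim (LinearMap.ker D) fun g => if ∀ a ∈ A, actS (g : Matrix.unitaryGroup (Fin n) ℂ) a = a
      then LinearMap.ker D else E g
  have hP : ∀ o, P o ≠ ⊤ := by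
    rintro (_ | g)
    · exact hker
    · by_cases h : ∀ a ∈ A, actS (g : Matrix.unitaryGroup (Fin n) ℂ) a = a
      · simpa only [P, Option.elim, if_pos h] using hker
      · simp only [P, Option.elim, if_neg h]
        obtain ⟨a, ha, hne'⟩ := (hW g g.2).resolve_left h
        intro htop
        have : (⟨a, ha⟩ : A) ∈ E g := htop ▸ Submodule.mem_top
        exact hne' (sub_eq_zero.mp this)
  have hU : ⋃ o, (P o : Set A) ≠ Set.univ := fun h =>
    let ⟨o, ho⟩ := Subspace.exists_eq_top_of_iUnion_eq_univ h
    hP o ho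
  obtain ⟨b, hb⟩ := (Set.ne_univ_iff_exists_notMem _).mp hU
  simp only [Set.mem_iUnion, not_exists] at hb
  have hDb : D b ≠ 0 := hb none
  have hsep : ∀ g ∈ W, actS g (b : S n) ≠ b → φ (actS g b) ≠ φ b := by
    intro g hg hgb h
    have h' := hb (some ⟨g, hg⟩)
    have hn : ¬ ∀ a ∈ A, actS g a = a := fun h => hgb (h b b.2)
    simp only [P, Option.elim, if_neg hn] at h'
    exact h' (sub_eq_zero.mpr h)
  have hfin : (Set.range fun g : W => actS (g : Matrix.unitaryGroup (Fin n) ℂ) (b : S n)).Finite :=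
    Set.finite_range _
  let O : Finset (S n) := hfin.toFinset
  have hO : ∀ z, z ∈ O ↔ ∃ g ∈ W, actS g (b : S n) = z := by
    intro z
    simp [O]
  have hbO : (b : S n) ∈ O := (hO _).mpr ⟨1, W.one_mem, by rw [actS_one]; rfl⟩
  let F : Polynomial (S n) := ∏ z ∈ O, (Polynomial.X - Polynomial.C z)
  have hFinv : ∀ g ∈ W, F.map (actS g).toRingHom = F := by
    intro g hg
    have hOg : O.image (actS g) = O := by
      refine Finset.eq_of_subset_of_card_le ?_
        (Finset.card_image_of_injective _ (actS_injective g)).ge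
      intro z hz
      obtain ⟨z', hz', rfl⟩ := Finset.mem_image.mp hz
      obtain ⟨k, hk, rfl⟩ := (hO z').mp hz'
      exact (hO _).mpr ⟨g * k, W.mul_mem hg hk, actS_mul_apply g k _⟩
    simp only [F, Polynomial.map_prod, Polynomial.map_sub, Polynomial.map_X, Polynomial.map_C]
    conv_rhs => rw [← hOg]
    rw [Finset.prod_image fun _ _ _ _ h => actS_injective g h]
    rfl
  have hcoeff : ∀ k, ∃ h : F.coeff k ∈ A, D ⟨F.coeff k, h⟩ = 0 := by
    refine fun k => h0 _ fun g hg => ?_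
    conv_rhs => rw [← hFinv g hg, Polynomial.coeff_map]
    rfl
  have hF : F = (Polynomial.X - Polynomial.C (b : S n))
      * ∏ z ∈ O.erase b, (Polynomial.X - Polynomial.C z) := (Finset.mul_prod_erase _ _ hbO).symm
  have hroot : F.eval (b : S n) = 0 := by rw [hF]; simp
  have hder : F.derivative.eval (b : S n) = ∏ z ∈ O.erase b, ((b : S n) - z) := by
    rw [hF]
    simp [Polynomial.eval_prod]
  have key := derivation_eval φ D hD F hcoeff b hroot
  rw [hder, map_prod] at key
  refine (mul_ne_zero (Finset.prod_ne_zero_iff.mpr fun z hz => ?_) hDb) key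
  obtain ⟨hzb, hz⟩ := Finset.mem_erase.mp hz
  obtain ⟨g, hg, rfl⟩ := (hO z).mp hz
  rw [map_sub, sub_ne_zero]
  exact (hsep g hg hzb).symm

/-- Dedekind's independence of characters, for a family with repetitions. -/
theorem sum_filter_eq_zero_of_forall {ι K : Type*} [Fintype ι] [CommRing K] [IsDomain K]
    [Algebra ℂ K] (χ : ι → S n →ₐ[ℂ] K) (c : ι → K) (h : ∀ q, ∑ i, c i * χ i q = 0)
    (P : ι → Prop) [DecidablePred P] (i₀ : ι) (hP : ∀ i, P i ↔ χ i = χ i₀) :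
    ∑ i with P i, c i = 0 := by
  classical
  let ψ : ι → (S n →* K) := fun i => (χ i : S n →* K)
  have hψ : ∀ i, P i ↔ ψ i = ψ i₀ := by
    intro i
    rw [hP]
    refine ⟨fun h => by simp only [ψ, h], fun h => AlgHom.ext fun q => ?_⟩
    exact congrArg (fun F : S n →* K => F q) h
  have hli := linearIndependent_iff'.mp (linearIndependent_monoidHom (S n) K)
    (Finset.univ.image ψ) (fun F => ∑ i with ψ i = F, c i) ?_ (ψ i₀)
      (Finset.mem_image_of_mem _ (Finset.mem_univ _))
  · rw [← hli]
    exact Finset.sum_congr (Finset.filter_congr fun i _ => hψ i) fun _ _ => rfl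
  · funext q
    rw [Finset.sum_apply]
    simp only [Pi.smul_apply, smul_eq_mul, Finset.sum_mul, Pi.zero_apply]
    rw [← h q, ← Finset.sum_fiberwise_of_maps_to (s := Finset.univ) (t := Finset.univ.image ψ)
      (g := ψ) (fun i _ => Finset.mem_image_of_mem _ (Finset.mem_univ _))]
    refine Finset.sum_congr rfl fun F _ => Finset.sum_congr rfl fun i hi => ?_
    rw [← (Finset.mem_filter.mp hi).2]
    rfl

/-- Averaging over `W` produces invariant derivations. -/
theorem reynolds_invariant (W : Subgroup (Matrix.unitaryGroup (Fin n) ℂ)) [Fintype W] (q : S n)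
    (m : Fin n) (g : Matrix.unitaryGroup (Fin n) ℂ) (hg : g ∈ W) (k : Fin n) :
    ∑ j, MvPolynomial.C (g k j) * actS g (∑ h : W, MvPolynomial.C
        ((h : Matrix.unitaryGroup (Fin n) ℂ) j m) * actS (h : Matrix.unitaryGroup (Fin n) ℂ) q)
      = ∑ h : W, MvPolynomial.C
        ((h : Matrix.unitaryGroup (Fin n) ℂ) k m) * actS (h : Matrix.unitaryGroup (Fin n) ℂ) q := by
  rw [← Equiv.sum_comp (Equiv.mulLeft (⟨g, hg⟩ : W))]
  simp only [map_sum, map_mul, actS_C, Finset.mul_sum, Equiv.coe_mulLeft, Subgroup.coe_mul,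
    actS_mul_apply]
  rw [Finset.sum_comm]
  refine Finset.sum_congr rfl fun h _ => ?_
  rw [Matrix.UnitaryGroup.mul_val, Matrix.mul_apply, map_sum, Finset.sum_mul]
  refine Finset.sum_congr rfl fun j _ => ?_
  rw [map_mul, mul_assoc]

theorem dvd_actS_sub {p : S n} {g : Matrix.unitaryGroup (Fin n) ℂ}
    (h : ∀ i, p ∣ actS g (MvPolynomial.X i) - MvPolynomial.X i) (q : S n) : p ∣ actS g q - q := by
  induction q using MvPolynomial.induction_on with
  | C c => simp
  | add a b ha hb =>
    rw [map_add, add_sub_add_comm]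
    exact dvd_add ha hb
  | mul_X a i ha =>
    rw [map_mul, show actS g a * actS g (MvPolynomial.X i) - a * MvPolynomial.X i
      = (actS g a - a) * actS g (MvPolynomial.X i)
        + a * (actS g (MvPolynomial.X i) - MvPolynomial.X i) by ring]
    exact dvd_add (ha.mul_right _) ((h i).mul_left _)

/-! ### Reduction modulo a prime -/

/-- Reduction modulo the polynomial `p`. -/
abbrev red (p : S n) : S n →ₐ[ℂ] S n ⧸ Ideal.span {p} := Ideal.Quotient.mkₐ ℂ (Ideal.span {p})

theorem red_eq_zero_iff {p q : S n} : red p q = 0 ↔ p ∣ q := by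
  rw [← Ideal.mem_span_singleton, ← Ideal.Quotient.eq_zero_iff_mem]
  rfl

theorem red_eq_iff {p q q' : S n} : red p q = red p q' ↔ p ∣ q - q' := by
  rw [← red_eq_zero_iff, map_sub, sub_eq_zero]

theorem isDomain_quotient {p : S n} (hp : Prime p) : IsDomain (S n ⧸ Ideal.span {p}) := by
  have := (Ideal.span_singleton_prime hp.ne_zero).mpr hp
  exact Ideal.Quotient.isDomain _

theorem red_comp_actS_eq_iff {p : S n} {g : Matrix.unitaryGroup (Fin n) ℂ} :
    (red p).comp (actS g) = red p ↔ ∀ i, p ∣ actS g (MvPolynomial.X i) - MvPolynomial.X i := by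
  refine ⟨fun h i => ?_, fun h => AlgHom.ext fun q => red_eq_iff.mpr (dvd_actS_sub h q)⟩
  exact red_eq_iff.mp (congrArg (fun F : S n →ₐ[ℂ] _ => F (MvPolynomial.X i)) h)

theorem exists_mulVec_red_eq_zero {p : S n} (hp : Prime p) {G : Matrix (Fin n) (Fin n) (S n)}
    (h : p ∣ G.det) : ∃ ξ : Fin n → S n ⧸ Ideal.span {p}, ξ ≠ 0 ∧
      ∀ i, ∑ j, red p (G i j) * ξ j = 0 := by
  have := isDomain_quotient hp
  have hdet : ((red p).mapMatrix G).det = 0 := by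
    rw [← AlgHom.map_det]
    exact red_eq_zero_iff.mpr h
  obtain ⟨ξ, hξ, h0⟩ := Matrix.exists_mulVec_eq_zero_iff.mpr hdet
  exact ⟨ξ, hξ, fun i => congrFun h0 i⟩

/-- `p` does not divide the Jacobian of generators of the invariants if its inertia group is
trivial. -/
theorem not_dvd_jac_of_unramified {W : Subgroup (Matrix.unitaryGroup (Fin n) ℂ)} [Finite W]
    {f : Fin n → S n}
    (hgen : ∀ q, (∀ g ∈ W, actS g q = q) → q ∈ Algebra.adjoin ℂ (Set.range f)) {p : S n}
    (hp : Prime p)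
    (hun : ∀ g ∈ W, (∀ i, p ∣ actS g (MvPolynomial.X i) - MvPolynomial.X i) → g = 1) :
    ¬ p ∣ jac f := by
  intro h
  have := isDomain_quotient hp
  obtain ⟨ξ, hξ, h0⟩ := exists_mulVec_red_eq_zero hp h
  let D : (⊤ : Subalgebra ℂ (S n)) →ₗ[ℂ] S n ⧸ Ideal.span {p} :=
    (∑ j, LinearMap.mulRight ℂ (ξ j) ∘ₗ (red p).toLinearMap ∘ₗ
      (MvPolynomial.pderiv j : Derivation ℂ (S n) (S n)).toLinearMap) ∘ₗ
        (⊤ : Subalgebra ℂ (S n)).val.toLinearMap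
  have hDapp : ∀ a : (⊤ : Subalgebra ℂ (S n)),
      D a = ∑ j, red p (MvPolynomial.pderiv j (a : S n)) * ξ j := by
    intro a
    simp [D]
  have hD : ∀ a b, D (a * b) = red p a * D b + red p b * D a := by
    intro a b
    simp only [hDapp, Finset.mul_sum, ← Finset.sum_add_distrib]
    refine Finset.sum_congr rfl fun j _ => ?_
    rw [show ((a * b : (⊤ : Subalgebra ℂ (S n))) : S n) = (a : S n) * (b : S n) from rfl,
      Derivation.leibniz, smul_eq_mul, smul_eq_mul, map_add, map_mul, map_mul]
    ring
  have hD0 : D = 0 := by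
    refine derivation_eq_zero (W := W) (red p) D hD (fun q hq => ?_) fun g hg => ?_
    · refine derivation_eq_zero_of_mem_adjoin (red p) D hD f (fun i => ⟨trivial, ?_⟩) (hgen q hq)
      rw [hDapp]
      exact h0 i
    · by_cases hg1 : ∀ i, p ∣ actS g (MvPolynomial.X i) - MvPolynomial.X i
      · left
        rw [hun g hg hg1, actS_one]
        exact fun _ _ => rfl
      · right
        push Not at hg1
        obtain ⟨i, hi⟩ := hg1
        exact ⟨MvPolynomial.X i, trivial, fun h => hi (red_eq_iff.mp h)⟩
  refine hξ (funext fun j => ?_)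
  have := hDapp ⟨MvPolynomial.X j, trivial⟩
  rw [hD0, Finset.sum_eq_single j] at this
  · simpa using this.symm
  · intro k _ hk
    simp [MvPolynomial.pderiv_X, hk.symm]
  · simp

/-- A linear relation modulo `p` between the coefficients of all invariant derivations gives a
linear relation for the matrices of the inertia group of `p`. -/
theorem sum_inertia_eq_zero {W : Subgroup (Matrix.unitaryGroup (Fin n) ℂ)} [Fintype W]
    {p : S n} (hp : Prime p) (t : Finset (Fin n)) (ξ : Fin n → S n ⧸ Ideal.span {p})
    (h : ∀ u : Fin n → S n, (∀ g ∈ W, ∀ k, ∑ j, MvPolynomial.C (g k j) * actS g (u j) = u k) →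
      ∑ j ∈ t, red p (u j) * ξ j = 0) (m : Fin n)
    (P : W → Prop) [DecidablePred P] (hP : ∀ g : W, P g ↔ ∀ i,
      p ∣ actS (g : Matrix.unitaryGroup (Fin n) ℂ) (MvPolynomial.X i) - MvPolynomial.X i) :
    ∑ g : W with P g, ∑ j ∈ t,
      red p (MvPolynomial.C ((g : Matrix.unitaryGroup (Fin n) ℂ) j m)) * ξ j = 0 := by
  have := isDomain_quotient hp
  refine sum_filter_eq_zero_of_forall
    (fun g : W => (red p).comp (actS (g : Matrix.unitaryGroup (Fin n) ℂ))) _ (fun q => ?_) P 1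
    fun g => ?_
  · rw [← h _ fun g hg k => reynolds_invariant W q m g hg k]
    simp only [Finset.sum_mul, map_sum, map_mul, AlgHom.comp_apply]
    rw [Finset.sum_comm]
    refine Finset.sum_congr rfl fun j _ => Finset.sum_congr rfl fun g _ => ?_
    ring
  · rw [hP, ← red_comp_actS_eq_iff, Subgroup.coe_one, actS_one, AlgHom.comp_id]

/-- `p` does not divide the determinant of basic derivations if its inertia group is trivial. -/
theorem not_dvd_derDet_of_unramified {W : Subgroup (Matrix.unitaryGroup (Fin n) ℂ)} [Finite W]
    {θ : Fin n → Fin n → S n}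
    (hspan : ∀ u : Fin n → S n, (∀ g ∈ W, ∀ k, ∑ j, MvPolynomial.C (g k j) * actS g (u j) = u k) →
      ∃ c : Fin n → S n, ∀ j, u j = ∑ i, c i * θ i j) {p : S n} (hp : Prime p)
    (hun : ∀ g ∈ W, (∀ i, p ∣ actS g (MvPolynomial.X i) - MvPolynomial.X i) → g = 1) :
    ¬ p ∣ derDet θ := by
  classical
  intro h
  have := Fintype.ofFinite W
  obtain ⟨ξ, hξ, h0⟩ := exists_mulVec_red_eq_zero hp h
  refine hξ (funext fun m => ?_)
  have key := sum_inertia_eq_zero (W := W) hp Finset.univ ξ (fun u hu => ?_) m (fun g => g = 1)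
    fun g => ⟨?_, fun hg => Subtype.ext (hun g g.2 hg)⟩
  · rw [Finset.sum_filter, Finset.sum_ite_eq' Finset.univ (1 : W)] at key
    simp only [Finset.mem_univ, if_true, Subgroup.coe_one, Matrix.UnitaryGroup.one_apply,
      Matrix.one_apply] at key
    rw [Finset.sum_eq_single m] at key
    · simpa using key
    · intro j _ hj
      simp [hj]
    · simp
  · obtain ⟨c, hc⟩ := hspan u hu
    simp only [hc, map_sum, map_mul, Finset.sum_mul]
    rw [Finset.sum_comm]
    refine Finset.sum_eq_zero fun i _ => ?_
    simp only [mul_assoc, ← Finset.mul_sum]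
    rw [show ∑ j, red p (θ i j) * ξ j = 0 from h0 i, mul_zero]
  · rintro rfl i
    simp [actS_one]

/-! ### A ramified coordinate hyperplane -/

/-- `s` is a diagonal reflection of order `e` in `W` with eigenvalue `ζ` on `y_{i₀}`, and it
generates the inertia group of the prime `x_{i₀}`: the elements of `W` that act trivially on
`S / (x_{i₀})`. -/
structure IsInertiaGenerator (W : Subgroup (Matrix.unitaryGroup (Fin n) ℂ)) (i₀ : Fin n)
    (s : Matrix.unitaryGroup (Fin n) ℂ) (ζ : ℂ) (e : ℕ) : Prop where
  mem : s ∈ W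
  diagonal : (s : Matrix (Fin n) (Fin n) ℂ) = Matrix.diagonal (Function.update 1 i₀ ζ)
  primitive : IsPrimitiveRoot ζ e
  two_le : 2 ≤ e
  generates : ∀ g ∈ W,
    (∀ i, MvPolynomial.X i₀ ∣ actS g (MvPolynomial.X i) - MvPolynomial.X i) → ∃ k : ℕ, g = s ^ k

theorem sum_C_mul_X_eval (b : Fin n → ℂ) (k : Fin n) :
    MvPolynomial.eval (Pi.single k 1) (∑ l, MvPolynomial.C (b l) * MvPolynomial.X l : S n)
      = b k := by
  simp [Pi.single_apply]

theorem X_dvd_linear_iff {i₀ : Fin n} {b : Fin n → ℂ} :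
    MvPolynomial.X i₀ ∣ (∑ k, MvPolynomial.C (b k) * MvPolynomial.X k : S n) ↔
      ∀ k, k ≠ i₀ → b k = 0 := by
  refine ⟨?_, fun h => Finset.dvd_sum fun k _ => ?_⟩
  · rintro ⟨q, hq⟩ k hk
    have := congrArg (MvPolynomial.eval (Pi.single k 1)) hq
    rw [sum_C_mul_X_eval] at this
    simpa [hk.symm] using this
  · by_cases hk : k = i₀
    · exact hk ▸ Dvd.intro_left _ rfl
    · rw [h k hk, map_zero, zero_mul]
      exact dvd_zero _

theorem X_dvd_actS_X_sub_iff {i₀ : Fin n} {g : Matrix.unitaryGroup (Fin n) ℂ} {i : Fin n} :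
    (MvPolynomial.X i₀ : S n) ∣ actS g (MvPolynomial.X i) - MvPolynomial.X i ↔
      ∀ k, k ≠ i₀ → g k i = (1 : Matrix (Fin n) (Fin n) ℂ) k i := by
  have e : actS g (MvPolynomial.X i) - MvPolynomial.X i
      = (∑ k, MvPolynomial.C (starRingEnd ℂ (g k i) - (1 : Matrix (Fin n) (Fin n) ℂ) k i)
        * MvPolynomial.X k : S n) := by
    simp only [actS_X, inv_apply, map_sub, sub_mul, Finset.sum_sub_distrib]
    congr 1
    simp [Matrix.one_apply]
  rw [e, X_dvd_linear_iff]
  refine forall₂_congr fun k _ => ?_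
  rw [sub_eq_zero]
  constructor
  · intro h
    rw [← Complex.conj_conj (g k i), h, Matrix.one_apply]
    split_ifs <;> simp
  · intro h
    rw [h, Matrix.one_apply]
    split_ifs <;> simp

namespace IsInertiaGenerator

variable {W : Subgroup (Matrix.unitaryGroup (Fin n) ℂ)} {i₀ : Fin n}
  {s : Matrix.unitaryGroup (Fin n) ℂ} {ζ : ℂ} {e : ℕ}

theorem conj_eq (h : IsInertiaGenerator W i₀ s ζ e) : starRingEnd ℂ ζ = ζ ^ (e - 1) := by
  have he : e ≠ 0 := by have := h.two_le; omega
  rw [← Complex.inv_eq_conj (Complex.norm_eq_one_of_pow_eq_one h.primitive.pow_eq_one he)]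
  refine inv_eq_of_mul_eq_one_right ?_
  rw [← pow_succ', Nat.sub_add_cancel (by omega), h.primitive.pow_eq_one]

theorem conj_mul (h : IsInertiaGenerator W i₀ s ζ e) : ζ * starRingEnd ℂ ζ = 1 := by
  have := h.two_le
  rw [h.conj_eq, ← pow_succ', Nat.sub_add_cancel (by omega), h.primitive.pow_eq_one]

theorem actS_X_self (h : IsInertiaGenerator W i₀ s ζ e) :
    actS s (MvPolynomial.X i₀) = MvPolynomial.C (starRingEnd ℂ ζ) * MvPolynomial.X i₀ := by
  rw [actS_X, Finset.sum_eq_single i₀]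
  · rw [inv_apply, h.diagonal, Matrix.diagonal_apply_eq, Function.update_self]
  · intro k _ hk
    rw [inv_apply, h.diagonal, Matrix.diagonal_apply_ne _ hk, map_zero, map_zero, zero_mul]
  · simp

theorem actS_X_of_ne (h : IsInertiaGenerator W i₀ s ζ e) {j : Fin n} (hj : j ≠ i₀) :
    actS s (MvPolynomial.X j) = MvPolynomial.X j := by
  rw [actS_X, Finset.sum_eq_single j]
  · rw [inv_apply, h.diagonal, Matrix.diagonal_apply_eq, Function.update_of_ne hj]
    simp
  · intro k _ hk
    rw [inv_apply, h.diagonal, Matrix.diagonal_apply_ne _ hk, map_zero, map_zero, zero_mul]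
  · simp

/-- Semi-invariants of `s` are divisible by powers of `x_{i₀}`: modulo `x_{i₀}` the action is
trivial, so a nontrivial character forces a factor `x_{i₀}`, and removing it changes the character
by one step. -/
theorem X_pow_dvd (h : IsInertiaGenerator W i₀ s ζ e) {k : ℕ} (hk : k < e) {q : S n}
    (hq : MvPolynomial.C (ζ ^ k) * actS s q = q) : MvPolynomial.X i₀ ^ k ∣ q := by
  induction k generalizing q with
  | zero => simp
  | succ k ih =>
    have h1 : (MvPolynomial.X i₀ : S n) ∣ actS s q - q := by
      refine dvd_actS_sub (fun i => ?_) q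
      by_cases hi : i = i₀
      · subst hi
        rw [h.actS_X_self]
        exact dvd_sub (Dvd.intro_left _ rfl) dvd_rfl
      · rw [h.actS_X_of_ne hi, sub_self]
        exact dvd_zero _
    have h2 : (MvPolynomial.X i₀ : S n) ∣ MvPolynomial.C (1 - ζ ^ (k + 1)) * q := by
      have e1 : MvPolynomial.C (1 - ζ ^ (k + 1)) * q
          = MvPolynomial.C (ζ ^ (k + 1)) * (actS s q - q) := by
        rw [mul_sub, hq, map_sub, sub_mul, map_one, one_mul]
      rw [e1]
      exact h1.mul_left _
    have h3 : IsUnit (MvPolynomial.C (1 - ζ ^ (k + 1)) : S n) := by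
      refine IsUnit.map _ (isUnit_iff_ne_zero.mpr (sub_ne_zero.mpr fun h' => ?_))
      exact h.primitive.pow_ne_one_of_pos_of_lt (Nat.succ_ne_zero k) hk h'.symm
    obtain ⟨q', rfl⟩ := (h3.dvd_mul_left).mp h2
    rw [pow_succ']
    refine mul_dvd_mul_left _ (ih (by omega) ?_)
    refine mul_left_cancel₀ (MvPolynomial.X_ne_zero i₀) ?_
    conv_rhs => rw [← hq]
    rw [map_mul, h.actS_X_self]
    have : MvPolynomial.C (ζ ^ (k + 1)) * MvPolynomial.C (starRingEnd ℂ ζ)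
        = (MvPolynomial.C (ζ ^ k) : S n) := by
      rw [← map_mul, pow_succ, mul_assoc, h.conj_mul, mul_one]
    rw [← this]
    ring

theorem X_dvd (h : IsInertiaGenerator W i₀ s ζ e) {q : S n}
    (hq : MvPolynomial.C ζ * actS s q = q) : MvPolynomial.X i₀ ∣ q := by
  have := h.X_pow_dvd (k := 1) (by have := h.two_le; omega) (q := q) (by rwa [pow_one])
  rwa [pow_one] at this

/-- The derivative of an `s`-invariant along `x_{i₀}` is a semi-invariant, on which `s` acts by
`ζ`. -/
theorem X_pow_dvd_pderiv (h : IsInertiaGenerator W i₀ s ζ e) {q : S n} (hq : actS s q = q) :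
    MvPolynomial.X i₀ ^ (e - 1) ∣ MvPolynomial.pderiv i₀ q := by
  refine h.X_pow_dvd (by have := h.two_le; omega) ?_
  conv_rhs => rw [← hq]
  rw [pderiv_actS, Finset.sum_eq_single i₀]
  · rw [inv_apply, h.diagonal, Matrix.diagonal_apply_eq, Function.update_self, h.conj_eq]
  · intro k _ hk
    rw [inv_apply, h.diagonal, Matrix.diagonal_apply_ne _ hk.symm, map_zero, map_zero, zero_mul]
  · simp

theorem X_dvd_der (h : IsInertiaGenerator W i₀ s ζ e) {u : Fin n → S n}
    (hu : ∀ g ∈ W, ∀ k, ∑ j, MvPolynomial.C (g k j) * actS g (u j) = u k) :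
    MvPolynomial.X i₀ ∣ u i₀ := by
  refine h.X_dvd ?_
  conv_rhs => rw [← hu s h.mem i₀]
  rw [Finset.sum_eq_single i₀]
  · rw [h.diagonal, Matrix.diagonal_apply_eq, Function.update_self]
  · intro k _ hk
    rw [h.diagonal, Matrix.diagonal_apply_ne _ hk.symm, map_zero, zero_mul]
  · simp

/-- By unitarity, an element of `W` that fixes the hyperplane `x_{i₀} = 0` modulo `y_{i₀}` fixes it
pointwise. -/
theorem exists_eq_pow (h : IsInertiaGenerator W i₀ s ζ e) {g : Matrix.unitaryGroup (Fin n) ℂ}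
    (hg : g ∈ W) (hX : ∀ i, i ≠ i₀ →
      MvPolynomial.X i₀ ∣ actS g (MvPolynomial.X i) - MvPolynomial.X i) : ∃ k : ℕ, g = s ^ k := by
  refine h.generates g hg fun i => X_dvd_actS_X_sub_iff.mpr fun k hk => ?_
  by_cases hi : i = i₀
  swap
  · exact X_dvd_actS_X_sub_iff.mp (hX i hi) k hk
  subst hi
  -- row `k` of `g` has norm one and contains the entry `1` at `k`
  have hcol := X_dvd_actS_X_sub_iff.mp (hX k hk) k hk
  have hrow : ∑ j, g k j * starRingEnd ℂ (g k j) = 1 := by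
    have e1 : ((g * g⁻¹ : Matrix.unitaryGroup (Fin n) ℂ) : Matrix (Fin n) (Fin n) ℂ) k k = 1 := by
      rw [mul_inv_cancel]
      simp
    rw [Matrix.UnitaryGroup.mul_val, Matrix.mul_apply] at e1
    exact e1
  simp only [Complex.mul_conj] at hrow
  have hrow' : ∑ j, Complex.normSq (g k j) = 1 := by exact_mod_cast hrow
  rw [Matrix.one_apply_eq] at hcol
  rw [← Finset.add_sum_erase _ _ (Finset.mem_univ k), hcol, map_one, add_eq_left,
    Finset.sum_eq_zero_iff_of_nonneg fun _ _ => Complex.normSq_nonneg _] at hrow'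
  have := hrow' i (Finset.mem_erase.mpr ⟨hk.symm, Finset.mem_univ _⟩)
  rw [Matrix.one_apply_ne hk]
  exact Complex.normSq_eq_zero.mp this

end IsInertiaGenerator

theorem prime_X (i : Fin n) : Prime (MvPolynomial.X i : S n) := MvPolynomial.X_prime

/-- Pull a power of a polynomial out of one column of a determinant. -/
theorem det_column_factor {ι : Type*} [Fintype ι] [DecidableEq ι] {X Y : Matrix ι ι (S n)}
    (v : ι → S n) (h : ∀ i j, X i j = v j * Y i j) : X.det = (∏ j, v j) * Y.det := by
  rw [← Matrix.det_mul_row]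
  congr 1
  exact Matrix.ext h

/-- The Jacobian of generators of the invariants is not divisible by the `e`-th power of a linear
form with inertia group of order `e`. Otherwise there is a nontrivial relation modulo `x_{i₀}`
between the columns of the Jacobian matrix, with the column of `∂/∂x_{i₀}` divided by
`x_{i₀} ^ (e - 1)`. It defines a derivation of the ring of `s`-invariants that kills the
`W`-invariants; its values at `x_{i₀} ^ e` and at the other coordinates give the relation back. -/
theorem not_X_pow_dvd_jac {W : Subgroup (Matrix.unitaryGroup (Fin n) ℂ)} [Finite W] {i₀ : Fin n}
    {s : Matrix.unitaryGroup (Fin n) ℂ} {ζ : ℂ} {e : ℕ} (h : IsInertiaGenerator W i₀ s ζ e)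
    {f : Fin n → S n} (hinv : ∀ i, ∀ g ∈ W, actS g (f i) = f i)
    (hgen : ∀ q, (∀ g ∈ W, actS g q = q) → q ∈ Algebra.adjoin ℂ (Set.range f)) :
    ¬ MvPolynomial.X i₀ ^ e ∣ jac f := by
  classical
  intro hdvd
  have he := h.two_le
  have := isDomain_quotient (prime_X i₀)
  let A : Subalgebra ℂ (S n) := AlgHom.equalizer (actS s) (AlgHom.id ℂ (S n))
  have hA : ∀ q, q ∈ A ↔ actS s q = q := fun q => Iff.rfl
  -- `E a` is the quotient of the derivative of `a` by `x_{i₀}^{e-1}`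
  have hex : ∀ a : A, ∃ b : S n,
      MvPolynomial.pderiv i₀ (a : S n) = MvPolynomial.X i₀ ^ (e - 1) * b :=
    fun a => h.X_pow_dvd_pderiv ((hA a).mp a.2)
  choose E hE using hex
  have hX0 : (MvPolynomial.X i₀ ^ (e - 1) : S n) ≠ 0 := pow_ne_zero _ (MvPolynomial.X_ne_zero i₀)
  have hE' : ∀ (a : A) (b : S n),
      MvPolynomial.pderiv i₀ (a : S n) = MvPolynomial.X i₀ ^ (e - 1) * b → E a = b := by
    intro a b hb
    exact mul_left_cancel₀ hX0 ((hE a).symm.trans hb)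
  let El : A →ₗ[ℂ] S n :=
    { toFun := E
      map_add' := fun a b => hE' _ _ (by
        rw [Subalgebra.coe_add, map_add, hE, hE, mul_add])
      map_smul' := fun c a => hE' _ _ (by
        rw [Subalgebra.coe_smul, Derivation.map_smul, hE, RingHom.id_apply, mul_smul_comm]) }
  have hfA : ∀ i, f i ∈ A := fun i => (hA _).mpr (hinv i s h.mem)
  let G : Matrix (Fin n) (Fin n) (S n) := Matrix.of fun i j =>
    if j = i₀ then E ⟨f i, hfA i⟩ else MvPolynomial.pderiv j (f i)
  have hG : jac f = MvPolynomial.X i₀ ^ (e - 1) * G.det := by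
    rw [jac, det_column_factor (Y := G) fun j => if j = i₀ then MvPolynomial.X i₀ ^ (e - 1) else 1]
    · rw [Finset.prod_ite_eq' Finset.univ i₀, if_pos (Finset.mem_univ _)]
    · intro i j
      by_cases hj : j = i₀
      · subst hj
        simpa [G] using hE ⟨f i, hfA i⟩
      · simp [G, hj]
  have hGdvd : MvPolynomial.X i₀ ∣ G.det := by
    rw [hG, show e = e - 1 + 1 by omega, pow_succ, Nat.add_sub_cancel] at hdvd
    exact (mul_dvd_mul_iff_left hX0).mp hdvd
  obtain ⟨ξ, hξ, h0⟩ := exists_mulVec_red_eq_zero (prime_X i₀) hGdvd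
  let T : Fin n → A →ₗ[ℂ] S n := fun j => if j = i₀ then El else
    (MvPolynomial.pderiv j : Derivation ℂ (S n) (S n)).toLinearMap ∘ₗ A.val.toLinearMap
  have hT₀ : ∀ a, T i₀ a = E a := by
    intro a
    simp [T, El]
  have hT : ∀ j, j ≠ i₀ → ∀ a : A, T j a = MvPolynomial.pderiv j (a : S n) := by
    intro j hj a
    simp [T, hj]
  have hTl : ∀ (j) (a b : A), T j (a * b) = a * T j b + b * T j a := by
    intro j a b
    by_cases hj : j = i₀
    · subst hj
      rw [hT₀, hT₀, hT₀]
      refine hE' _ _ ?_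
      rw [Subalgebra.coe_mul, Derivation.leibniz, hE, hE, smul_eq_mul, smul_eq_mul]
      ring
    · rw [hT j hj, hT j hj, hT j hj, Subalgebra.coe_mul, Derivation.leibniz, smul_eq_mul,
        smul_eq_mul]
  let D : A →ₗ[ℂ] S n ⧸ Ideal.span {(MvPolynomial.X i₀ : S n)} :=
    ∑ j, LinearMap.mulRight ℂ (ξ j) ∘ₗ (red (MvPolynomial.X i₀)).toLinearMap ∘ₗ T j
  have hDapp : ∀ a : A, D a = ∑ j, red (MvPolynomial.X i₀) (T j a) * ξ j := by
    intro a
    simp [D]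
  have hD : ∀ a b,
      D (a * b) = red (MvPolynomial.X i₀) a * D b + red (MvPolynomial.X i₀) b * D a := by
    intro a b
    simp only [hDapp, Finset.mul_sum, ← Finset.sum_add_distrib]
    refine Finset.sum_congr rfl fun j _ => ?_
    rw [hTl, map_add, map_mul, map_mul]
    ring
  have hD0 : D = 0 := by
    refine derivation_eq_zero (W := W) (red (MvPolynomial.X i₀)) D hD (fun q hq => ?_)
      fun g hg => ?_
    · refine derivation_eq_zero_of_mem_adjoin _ D hD f (fun i => ⟨hfA i, ?_⟩) (hgen q hq)
      rw [hDapp, ← h0 i]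
      refine Finset.sum_congr rfl fun j _ => ?_
      by_cases hj : j = i₀
      · subst hj
        rw [hT₀]
        simp [G]
      · rw [hT j hj]
        simp [G, hj]
    · by_cases hgX : ∀ i, i ≠ i₀ → MvPolynomial.X i₀ ∣ actS g (MvPolynomial.X i) - MvPolynomial.X i
      · left
        obtain ⟨k, rfl⟩ := h.exists_eq_pow hg hgX
        intro a ha
        clear hg hgX
        induction k with
        | zero => rw [pow_zero, actS_one]; rfl
        | succ k ih =>
          rw [pow_succ, actS_mul_apply, (hA a).mp ha, ih]
      · right
        push Not at hgX
        obtain ⟨i, hi, hi'⟩ := hgX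
        exact ⟨MvPolynomial.X i, (hA _).mpr (h.actS_X_of_ne hi), fun h => hi' (red_eq_iff.mp h)⟩
  refine hξ (funext fun j => ?_)
  by_cases hj : j = i₀
  · subst hj
    have hXe : (MvPolynomial.X j ^ e : S n) ∈ A := by
      rw [hA, map_pow, h.actS_X_self, mul_pow, ← map_pow, ← map_pow, h.primitive.pow_eq_one,
        map_one, map_one, one_mul]
    have h1 := hDapp ⟨MvPolynomial.X j ^ e, hXe⟩
    rw [hD0, Finset.sum_eq_single j] at h1
    · have h2 : E ⟨MvPolynomial.X j ^ e, hXe⟩ = MvPolynomial.C (e : ℂ) := by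
        refine hE' _ _ ?_
        rw [MvPolynomial.pderiv_pow, MvPolynomial.pderiv_X_self]
        simp [mul_comm]
      rw [hT₀, h2] at h1
      have h3 : IsUnit (red (MvPolynomial.X j : S n) (MvPolynomial.C (e : ℂ))) := by
        refine IsUnit.map _ (IsUnit.map _ (isUnit_iff_ne_zero.mpr ?_))
        exact_mod_cast (by omega : e ≠ 0)
      exact (h3.mul_right_eq_zero).mp h1.symm
    · intro k _ hk
      rw [hT k hk, MvPolynomial.pderiv_pow, MvPolynomial.pderiv_X_of_ne hk.symm]
      simp
    · simp
  · have hXA := (hA _).mpr (h.actS_X_of_ne hj)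
    have h1 := hDapp ⟨MvPolynomial.X j, hXA⟩
    rw [hD0, Finset.sum_eq_single j] at h1
    · rw [hT j hj] at h1
      simpa using h1.symm
    · intro k _ hk
      by_cases hk0 : k = i₀
      · subst hk0
        rw [hT₀, hE' _ 0]
        · simp
        · rw [MvPolynomial.pderiv_X_of_ne hj, mul_zero]
      · rw [hT k hk0, MvPolynomial.pderiv_X_of_ne hk.symm]
        simp
    · simp

/-- If `g` preserves the line spanned by `x_{i₀}`, then `y_{i₀}` is an eigenvector of `g`, and its
eigenvalue is inverse to that of `x_{i₀}`. -/
theorem apply_of_X_dvd_actS_X {i₀ : Fin n} {g : Matrix.unitaryGroup (Fin n) ℂ}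
    (h : (MvPolynomial.X i₀ : S n) ∣ actS g (MvPolynomial.X i₀)) :
    (∀ k, k ≠ i₀ → g k i₀ = 0) ∧
      MvPolynomial.C (g i₀ i₀) * actS g (MvPolynomial.X i₀) = MvPolynomial.X i₀ := by
  rw [actS_X, X_dvd_linear_iff] at h
  have h0 : ∀ k, k ≠ i₀ → g k i₀ = 0 := by
    intro k hk
    have := h k hk
    rwa [inv_apply, map_eq_zero] at this
  refine ⟨h0, ?_⟩
  rw [actS_X, Finset.sum_eq_single i₀ (fun k _ hk => by rw [h k hk, map_zero, zero_mul]) (by simp),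
    ← mul_assoc, ← map_mul]
  have e1 : ((g⁻¹ * g : Matrix.unitaryGroup (Fin n) ℂ) : Matrix (Fin n) (Fin n) ℂ) i₀ i₀ = 1 := by
    rw [inv_mul_cancel]
    simp
  rw [Matrix.UnitaryGroup.mul_val, Matrix.mul_apply,
    Finset.sum_eq_single i₀ (fun k _ hk => by rw [h0 k hk, mul_zero]) (by simp), mul_comm] at e1
  rw [e1, map_one, one_mul]

/-- The determinant of basic derivations is not divisible by the square of a linear form with
nontrivial inertia group. Otherwise there is a nontrivial relation modulo `x_{i₀}` between the
columns of the coefficient matrix, with column `i₀` divided by `x_{i₀}`; it extends to the averages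
over `W` of `q ⊗ y_m` for all polynomials `q`. -/
theorem not_X_sq_dvd_derDet {W : Subgroup (Matrix.unitaryGroup (Fin n) ℂ)} [Finite W] {i₀ : Fin n}
    {s : Matrix.unitaryGroup (Fin n) ℂ} {ζ : ℂ} {e : ℕ} (h : IsInertiaGenerator W i₀ s ζ e)
    {θ : Fin n → Fin n → S n}
    (hinv : ∀ i, ∀ g ∈ W, ∀ k, ∑ j, MvPolynomial.C (g k j) * actS g (θ i j) = θ i k)
    (hspan : ∀ u : Fin n → S n, (∀ g ∈ W, ∀ k, ∑ j, MvPolynomial.C (g k j) * actS g (u j) = u k) →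
      ∃ c : Fin n → S n, ∀ j, u j = ∑ i, c i * θ i j) :
    ¬ MvPolynomial.X i₀ ^ 2 ∣ derDet θ := by
  classical
  intro hdvd
  have := Fintype.ofFinite W
  have hdom := isDomain_quotient (prime_X i₀)
  have hX0 : (MvPolynomial.X i₀ : S n) ≠ 0 := MvPolynomial.X_ne_zero i₀
  choose E hE using fun i => h.X_dvd_der (hinv i)
  let G : Matrix (Fin n) (Fin n) (S n) := Matrix.of fun i j => if j = i₀ then E i else θ i j
  have hG : derDet θ = MvPolynomial.X i₀ * G.det := by
    rw [derDet, det_column_factor (Y := G) fun j => if j = i₀ then MvPolynomial.X i₀ else 1]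
    · rw [Finset.prod_ite_eq' Finset.univ i₀, if_pos (Finset.mem_univ _)]
    · intro i j
      by_cases hj : j = i₀
      · subst hj
        simpa [G] using hE i
      · simp [G, hj]
  have hGdvd : MvPolynomial.X i₀ ∣ G.det := by
    rw [hG, pow_two] at hdvd
    exact (mul_dvd_mul_iff_left hX0).mp hdvd
  obtain ⟨ξ, hξ, h0⟩ := exists_mulVec_red_eq_zero (prime_X i₀) hGdvd
  -- the relation carries over from the basic derivations to all invariant derivations
  have hrel : ∀ u : Fin n → S n,
      (∀ g ∈ W, ∀ k, ∑ j, MvPolynomial.C (g k j) * actS g (u j) = u k) →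
      ∀ b, u i₀ = MvPolynomial.X i₀ * b → red (MvPolynomial.X i₀) b * ξ i₀
        + ∑ j ∈ Finset.univ.erase i₀, red (MvPolynomial.X i₀) (u j) * ξ j = 0 := by
    intro u hu b hb
    obtain ⟨c, hc⟩ := hspan u hu
    have hb' : b = ∑ i, c i * G i i₀ := by
      refine mul_left_cancel₀ hX0 ?_
      rw [← hb, hc, Finset.mul_sum]
      refine Finset.sum_congr rfl fun i _ => ?_
      rw [hE, show G i i₀ = E i by simp [G]]
      ring
    have hj' : ∀ j ∈ Finset.univ.erase i₀, red (MvPolynomial.X i₀) (u j) * ξ j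
        = red (MvPolynomial.X i₀) (∑ i, c i * G i j) * ξ j := by
      intro j hj
      rw [hc]
      congr 2
      refine Finset.sum_congr rfl fun i _ => ?_
      simp [G, (Finset.mem_erase.mp hj).1]
    rw [Finset.sum_congr rfl hj', hb', Finset.add_sum_erase Finset.univ
      (fun j => red (MvPolynomial.X i₀) (∑ i, c i * G i j) * ξ j) (Finset.mem_univ i₀)]
    simp only [map_sum, map_mul, Finset.sum_mul]
    rw [Finset.sum_comm]
    refine Finset.sum_eq_zero fun i _ => ?_
    simp only [mul_assoc, ← Finset.mul_sum]
    rw [h0 i, mul_zero]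
  -- `Q` lies in `g⁻¹(x_{i₀})` for every `g` that moves the hyperplane, but not in `(x_{i₀})`
  let N : W → Prop := fun g =>
    (MvPolynomial.X i₀ : S n) ∣ actS (g : Matrix.unitaryGroup (Fin n) ℂ) (MvPolynomial.X i₀)
  let Q : S n := ∏ g : W with ¬ N g,
    actS (g : Matrix.unitaryGroup (Fin n) ℂ)⁻¹ (MvPolynomial.X i₀)
  have hQ0 : ¬ MvPolynomial.X i₀ ∣ Q := by
    intro hQ
    obtain ⟨g, hg, hgX⟩ := ((prime_X i₀).dvd_finsetProd_iff _).mp hQ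
    refine (Finset.mem_filter.mp hg).2 ?_
    have h1 := (apply_of_X_dvd_actS_X hgX).2
    have h2 : actS (g : Matrix.unitaryGroup (Fin n) ℂ) (MvPolynomial.X i₀)
        = MvPolynomial.C (((g : Matrix.unitaryGroup (Fin n) ℂ)⁻¹ : Matrix.unitaryGroup (Fin n) ℂ)
          i₀ i₀) * MvPolynomial.X i₀ := by
      conv_lhs => rw [← h1]
      rw [map_mul, actS_C, actS_apply_inv]
    show MvPolynomial.X i₀ ∣ _
    rw [h2]
    exact Dvd.intro_left _ rfl
  have hQN : ∀ g : W, ¬ N g →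
      MvPolynomial.X i₀ ∣ actS (g : Matrix.unitaryGroup (Fin n) ℂ) Q := by
    intro g hg
    have h1 : actS (g : Matrix.unitaryGroup (Fin n) ℂ)⁻¹ (MvPolynomial.X i₀) ∣ Q :=
      Finset.dvd_prod_of_mem (fun g : W => actS (g : Matrix.unitaryGroup (Fin n) ℂ)⁻¹
        (MvPolynomial.X i₀)) (Finset.mem_filter.mpr ⟨Finset.mem_univ _, hg⟩)
    simpa using map_dvd (actS (g : Matrix.unitaryGroup (Fin n) ℂ)) h1
  have hξ0 : ξ i₀ = 0 := by
    have hdd : ∀ q : S n, ∑ g : W, (if N g then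
        red (MvPolynomial.X i₀) (actS (g : Matrix.unitaryGroup (Fin n) ℂ) (Q ^ 2)) * ξ i₀ else 0)
        * ((red (MvPolynomial.X i₀)).comp (actS (g : Matrix.unitaryGroup (Fin n) ℂ))) q = 0 := by
      intro q
      have hex : ∀ g : W, ∃ b, (¬ N g → MvPolynomial.X i₀ ^ 2 * b
          = actS (g : Matrix.unitaryGroup (Fin n) ℂ) (Q ^ 2)) := by
        intro g
        by_cases hg : N g
        · exact ⟨0, fun h => absurd hg h⟩
        · obtain ⟨b, hb⟩ := pow_dvd_pow_of_dvd (hQN g hg) 2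
          exact ⟨b, fun _ => by rw [map_pow, hb]⟩
      choose b hb using hex
      have hu := reynolds_invariant W (Q ^ 2 * MvPolynomial.X i₀ * q) i₀
      have hrel' := hrel _ (fun g hg k => hu g hg k)
        (∑ g : W, if N g then actS (g : Matrix.unitaryGroup (Fin n) ℂ) (Q ^ 2)
            * actS (g : Matrix.unitaryGroup (Fin n) ℂ) q
          else MvPolynomial.C ((g : Matrix.unitaryGroup (Fin n) ℂ) i₀ i₀) * (MvPolynomial.X i₀ * b g
            * actS (g : Matrix.unitaryGroup (Fin n) ℂ) (MvPolynomial.X i₀ * q))) ?_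
      · have hz : ∑ j ∈ Finset.univ.erase i₀, red (MvPolynomial.X i₀)
            (∑ h : W, MvPolynomial.C ((h : Matrix.unitaryGroup (Fin n) ℂ) j i₀)
              * actS (h : Matrix.unitaryGroup (Fin n) ℂ) (Q ^ 2 * MvPolynomial.X i₀ * q)) * ξ j
            = 0 := by
          refine Finset.sum_eq_zero fun j hj => ?_
          rw [red_eq_zero_iff.mpr, zero_mul]
          refine Finset.dvd_sum fun g _ => ?_
          by_cases hg : N g
          · rw [(apply_of_X_dvd_actS_X hg).1 j (Finset.mem_erase.mp hj).1, map_zero, zero_mul]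
            exact dvd_zero _
          · refine Dvd.dvd.mul_left ?_ _
            rw [map_mul, map_mul, map_pow, pow_two]
            exact (((hQN g hg).mul_right _).mul_right _).mul_right _
        rw [hz, add_zero, map_sum, Finset.sum_mul] at hrel'
        refine Eq.trans (Finset.sum_congr rfl fun g _ => ?_) hrel'
        by_cases hg : N g
        · rw [if_pos hg, if_pos hg, AlgHom.comp_apply, map_mul]
          ring
        · rw [if_neg hg, if_neg hg, zero_mul, red_eq_zero_iff.mpr, zero_mul]
          refine Dvd.intro (MvPolynomial.C ((g : Matrix.unitaryGroup (Fin n) ℂ) i₀ i₀) * (b g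
            * actS (g : Matrix.unitaryGroup (Fin n) ℂ) (MvPolynomial.X i₀ * q))) ?_
          ring
      · rw [Finset.mul_sum]
        refine Finset.sum_congr rfl fun g _ => ?_
        by_cases hg : N g
        · rw [if_pos hg, map_mul, map_mul]
          conv_rhs => rw [← (apply_of_X_dvd_actS_X hg).2]
          ring
        · rw [if_neg hg, mul_assoc, map_mul _ (Q ^ 2), ← hb g hg]
          ring
    have key := sum_filter_eq_zero_of_forall _ _ hdd
      (fun g => (red (MvPolynomial.X i₀ : S n)).comp (actS (g : Matrix.unitaryGroup (Fin n) ℂ))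
        = red (MvPolynomial.X i₀)) (1 : W) fun g => by
          rw [Subgroup.coe_one, actS_one, AlgHom.comp_id]
    have hterm : ∀ g : W, (red (MvPolynomial.X i₀ : S n)).comp
        (actS (g : Matrix.unitaryGroup (Fin n) ℂ)) = red (MvPolynomial.X i₀) →
        (if N g then red (MvPolynomial.X i₀)
          (actS (g : Matrix.unitaryGroup (Fin n) ℂ) (Q ^ 2)) * ξ i₀ else 0)
        = red (MvPolynomial.X i₀) (Q ^ 2) * ξ i₀ := by
      intro g hg
      have h1 : ∀ q, red (MvPolynomial.X i₀) (actS (g : Matrix.unitaryGroup (Fin n) ℂ) q)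
          = red (MvPolynomial.X i₀) q := fun q => congrArg (fun F : S n →ₐ[ℂ] _ => F q) hg
      have hN : N g := red_eq_zero_iff.mp (by rw [h1, red_eq_zero_iff])
      rw [if_pos hN, h1]
    rw [Finset.sum_congr rfl fun g hg => hterm g (Finset.mem_filter.mp hg).2, Finset.sum_const,
      ← Nat.cast_smul_eq_nsmul ℂ, smul_eq_zero] at key
    rcases key with hc | hc
    · rw [Nat.cast_eq_zero, Finset.card_eq_zero] at hc
      have : (1 : W) ∈ (∅ : Finset W) := by
        rw [← hc, Finset.mem_filter]
        exact ⟨Finset.mem_univ _, by rw [Subgroup.coe_one, actS_one, AlgHom.comp_id]⟩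
      simp at this
    · refine (mul_eq_zero.mp hc).resolve_left fun h' => hQ0 ?_
      exact (prime_X i₀).dvd_of_dvd_pow (red_eq_zero_iff.mp h')
  refine hξ (funext fun m => ?_)
  by_cases hm : m = i₀
  · rw [hm, hξ0]; rfl
  have key := sum_inertia_eq_zero (W := W) (prime_X i₀) (Finset.univ.erase i₀) ξ (fun u hu => ?_) m
    (fun g => ∀ i, MvPolynomial.X i₀ ∣
      actS (g : Matrix.unitaryGroup (Fin n) ℂ) (MvPolynomial.X i) - MvPolynomial.X i)
    fun g => Iff.rfl
  · have hterm : ∀ g : W, (∀ i, MvPolynomial.X i₀ ∣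
        actS (g : Matrix.unitaryGroup (Fin n) ℂ) (MvPolynomial.X i) - MvPolynomial.X i) →
        ∑ j ∈ Finset.univ.erase i₀, red (MvPolynomial.X i₀)
          (MvPolynomial.C ((g : Matrix.unitaryGroup (Fin n) ℂ) j m)) * ξ j = ξ m := by
      intro g hg
      rw [Finset.sum_eq_single m]
      · rw [X_dvd_actS_X_sub_iff.mp (hg m) m hm, Matrix.one_apply_eq, map_one, map_one, one_mul]
      · intro j hj hjm
        rw [X_dvd_actS_X_sub_iff.mp (hg m) j (Finset.mem_erase.mp hj).1, Matrix.one_apply_ne hjm,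
          map_zero, map_zero, zero_mul]
      · exact fun h => absurd (Finset.mem_erase.mpr ⟨hm, Finset.mem_univ _⟩) h
    rw [Finset.sum_congr rfl fun g hg => hterm g (Finset.mem_filter.mp hg).2, Finset.sum_const,
      ← Nat.cast_smul_eq_nsmul ℂ, smul_eq_zero] at key
    refine key.resolve_left fun hc => ?_
    rw [Nat.cast_eq_zero, Finset.card_eq_zero] at hc
    have : (1 : W) ∈ (∅ : Finset W) := by
      rw [← hc, Finset.mem_filter]
      exact ⟨Finset.mem_univ _, fun i => by simp [actS_one]⟩
    simp at this
  · obtain ⟨b, hb⟩ := h.X_dvd_der hu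
    have := hrel u hu b hb
    rwa [hξ0, mul_zero, zero_add] at this

/-! ### Determinants of invariant forms -/

theorem card_finset_notMem (i₀ : Fin n) :
    (Finset.univ.filter fun A : Finset (Fin n) => i₀ ∉ A).card = 2 ^ (n - 1) := by
  have : (Finset.univ.filter fun A : Finset (Fin n) => i₀ ∉ A)
      = (Finset.univ.erase i₀).powerset := by
    ext A
    simp [Finset.subset_erase]
  rw [this, Finset.card_powerset, Finset.card_erase_of_mem (Finset.mem_univ _), Finset.card_univ,
    Fintype.card_fin]

theorem card_finset_mem (i₀ : Fin n) :
    (Finset.univ.filter fun A : Finset (Fin n) => i₀ ∈ A).card = 2 ^ (n - 1) := by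
  have h := Finset.card_filter_add_card_filter_not (s := (Finset.univ : Finset (Finset (Fin n))))
    (fun A => i₀ ∈ A)
  have h2 : 2 ^ n = 2 * 2 ^ (n - 1) := by
    rw [← pow_succ', Nat.sub_add_cancel i₀.pos]
  rw [card_finset_notMem, Finset.card_univ, Fintype.card_finset, Fintype.card_fin] at h
  omega

theorem card_subtype_notMem (i₀ : Fin n) (r : ℕ) :
    (Finset.univ.filter fun B : {B : Finset (Fin n) // B.card = r} => i₀ ∉ B.1).card
      = (n - 1).choose r := by
  have : (Finset.univ.filter fun B : {B : Finset (Fin n) // B.card = r} => i₀ ∉ B.1).map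
      (Function.Embedding.subtype _) = (Finset.univ.erase i₀).powersetCard r := by
    ext A
    simp [Finset.mem_powersetCard, Finset.subset_erase, and_comm]
  rw [← Finset.card_map, this, Finset.card_powersetCard,
    Finset.card_erase_of_mem (Finset.mem_univ _), Finset.card_univ, Fintype.card_fin]

theorem card_subtype_mem (i₀ : Fin n) {r : ℕ} (hr : 1 ≤ r) :
    (Finset.univ.filter fun B : {B : Finset (Fin n) // B.card = r} => i₀ ∈ B.1).card
      = (n - 1).choose (r - 1) := by
  have h := Finset.card_filter_add_card_filter_not
    (s := (Finset.univ : Finset {B : Finset (Fin n) // B.card = r})) (fun B => i₀ ∈ B.1)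
  rw [card_subtype_notMem, Finset.card_univ, Fintype.card_finset_len, Fintype.card_fin] at h
  have h2 := Nat.choose_succ_succ (n - 1) (r - 1)
  rw [Nat.succ_eq_add_one, Nat.succ_eq_add_one, Nat.sub_add_cancel i₀.pos,
    Nat.sub_add_cancel hr] at h2
  omega

/-- A reflection along `x_{i₀}` that fixes a form makes its coefficient at `x_A ⊗ y_B` a
semi-invariant. This gives a factor `x_{i₀} ^ (e - 1)` if `i₀ ∈ A \ B` and a factor `x_{i₀}` if
`i₀ ∈ B \ A`, and the exponent counts these columns. -/
theorem X_pow_dvd_det_coordMatrix {W : Subgroup (Matrix.unitaryGroup (Fin n) ℂ)} {i₀ : Fin n}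
    {s : Matrix.unitaryGroup (Fin n) ℂ} {ζ : ℂ} {e : ℕ} (h : IsInertiaGenerator W i₀ s ζ e)
    {r : ℕ} (hr : 1 ≤ r) {w : Col n r → Forms n} (hw : ∀ q, actForms s (w q) = w q) :
    MvPolynomial.X i₀ ^ ((e - 1) * (2 ^ (n - 1) * (n - 1).choose r)
      + 2 ^ (n - 1) * (n - 1).choose (r - 1)) ∣ (coordMatrix (r := r) w).det := by
  classical
  let m : Col n r → ℕ := fun c =>
    (if i₀ ∈ c.1 ∧ i₀ ∉ c.2.1 then e - 1 else 0) + if i₀ ∉ c.1 ∧ i₀ ∈ c.2.1 then 1 else 0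
  have hprod : ∀ (A : Finset (Fin n)) (F : ℂ →+* ℂ),
      ∏ i ∈ A, F (Function.update (1 : Fin n → ℂ) i₀ ζ i) = if i₀ ∈ A then F ζ else 1 := by
    intro A F
    rw [← Finset.prod_ite_eq' A i₀ fun _ => F ζ]
    refine Finset.prod_congr rfl fun i _ => ?_
    by_cases hi : i = i₀
    · rw [hi, Function.update_self, if_pos rfl]
    · rw [Function.update_of_ne hi, if_neg hi, Pi.one_apply, map_one]
  have hdvd : ∀ q (c : Col n r), MvPolynomial.X i₀ ^ m c ∣ coordMatrix (r := r) w q c := by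
    rintro q ⟨A, B, hB⟩
    have h1 := repr_actForms_of_diagonal s _ h.diagonal (w q) A B
    rw [hw q, hprod A (starRingEnd ℂ), show ∏ i ∈ B, Function.update (1 : Fin n → ℂ) i₀ ζ i = _ from
      hprod B (RingHom.id ℂ)] at h1
    show MvPolynomial.X i₀ ^ m (A, ⟨B, hB⟩) ∣ (formBasis n).repr (w q) (A, B)
    by_cases hA : i₀ ∈ A <;> by_cases hB' : i₀ ∈ B
    · simp [m, hA, hB']
    · simp only [m, hA, hB', not_false_iff, and_self, if_true, not_true, if_false, add_zero,
        mul_one, h.conj_eq] at h1 ⊢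
      exact h.X_pow_dvd (by have := h.two_le; omega) h1.symm
    · simp only [m, hA, hB', not_false_iff, and_self, if_true, not_true, if_false, zero_add,
        one_mul, pow_one] at h1 ⊢
      exact h.X_dvd h1.symm
    · simp [m, hA, hB']
  choose Y hY using hdvd
  rw [det_column_factor (Y := Matrix.of Y) (fun c => MvPolynomial.X i₀ ^ m c) hY,
    Finset.prod_pow_eq_pow_sum]
  have hsum : ∑ c, m c = (e - 1) * (2 ^ (n - 1) * (n - 1).choose r)
      + 2 ^ (n - 1) * (n - 1).choose (r - 1) := by
    simp only [m, Finset.sum_add_distrib]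
    rw [← Finset.sum_filter, ← Finset.sum_filter, Finset.sum_const, Finset.sum_const,
      smul_eq_mul, smul_eq_mul, mul_one, mul_comm (e - 1), ← card_finset_mem i₀,
      ← card_subtype_notMem i₀ r, ← card_subtype_mem i₀ hr, ← Finset.card_product]
    conv_rhs => rw [card_finset_mem i₀, ← card_finset_notMem i₀, ← Finset.card_product]
    rw [← Finset.univ_product_univ, Finset.filter_product (fun A : Finset (Fin n) => i₀ ∈ A)
        (fun B : {B : Finset (Fin n) // B.card = r} => i₀ ∉ B.1),
      Finset.filter_product (fun A : Finset (Fin n) => i₀ ∉ A)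
        (fun B : {B : Finset (Fin n) // B.card = r} => i₀ ∈ B.1)]
  rw [hsum]
  exact Dvd.intro _ rfl

/-! ### Primes and their inertia groups -/

theorem actDer_mul (g h : Matrix.unitaryGroup (Fin n) ℂ) (u : Fin n → S n) :
    actDer (g * h) u = actDer g (actDer h u) := by
  funext k
  simp only [actDer, map_sum, map_mul, actS_C, Finset.mul_sum, actS_mul_apply,
    Matrix.UnitaryGroup.mul_val, Matrix.mul_apply, Finset.sum_mul]
  rw [Finset.sum_comm]
  exact Finset.sum_congr rfl fun j _ => Finset.sum_congr rfl fun i _ => mul_assoc _ _ _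

theorem actDer_one (u : Fin n → S n) : actDer 1 u = u := by
  funext k
  simp [actDer, actS_one, Matrix.one_apply]

theorem actDer_sum (g : Matrix.unitaryGroup (Fin n) ℂ) (c : Fin n → S n) (θ : Fin n → Fin n → S n)
    (k : Fin n) : actDer g (fun j => ∑ i, c i * θ i j) k
      = ∑ i, actS g (c i) * actDer g (θ i) k := by
  simp only [actDer, map_sum, map_mul, Finset.mul_sum]
  rw [Finset.sum_comm]
  refine Finset.sum_congr rfl fun i _ => Finset.sum_congr rfl fun j _ => ?_
  ring

/-- The inertia group of the prime `x_{i₀}` consists of diagonal reflections with respect to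
`y_{i₀}`. -/
theorem eq_diagonal_of_inertia {i₀ : Fin n} {g : Matrix.unitaryGroup (Fin n) ℂ}
    (h : (red (MvPolynomial.X i₀)).comp (actS g) = red (MvPolynomial.X i₀)) :
    (g : Matrix (Fin n) (Fin n) ℂ) = Matrix.diagonal (Function.update 1 i₀ (g i₀ i₀)) := by
  have h' : (red (MvPolynomial.X i₀)).comp (actS g⁻¹) = red (MvPolynomial.X i₀) := by
    conv_lhs => rw [← h]
    rw [AlgHom.comp_assoc, ← actS_mul, mul_inv_cancel, actS_one, AlgHom.comp_id]
  have h1 := fun i => X_dvd_actS_X_sub_iff.mp (red_comp_actS_eq_iff.mp h i)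
  have h2 := fun i => X_dvd_actS_X_sub_iff.mp (red_comp_actS_eq_iff.mp h' i)
  refine Matrix.ext fun k i => ?_
  by_cases hk : k = i₀
  · by_cases hi : i = i₀
    · rw [hk, hi, Matrix.diagonal_apply_eq, Function.update_self]
    · have h3 := h2 k i hi
      rw [inv_apply, Matrix.one_apply_ne (fun h => hi (h.trans hk)), map_eq_zero] at h3
      rw [h3, Matrix.diagonal_apply_ne _ fun h => hi (h.symm.trans hk)]
  · rw [h1 i k hk]
    by_cases hki : k = i
    · subst hki
      rw [Matrix.one_apply_eq, Matrix.diagonal_apply_eq, Function.update_of_ne hk, Pi.one_apply]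
    · rw [Matrix.one_apply_ne hki, Matrix.diagonal_apply_ne _ hki]

/-- The inertia group of `x_{i₀}` is cyclic, as it embeds into `ℂˣ` through its action on
`y_{i₀}`. -/
theorem exists_isInertiaGenerator (W : Subgroup (Matrix.unitaryGroup (Fin n) ℂ)) [Finite W]
    (i₀ : Fin n) (hex : ∃ g ∈ W, g ≠ 1 ∧
      ∀ i, MvPolynomial.X i₀ ∣ actS g (MvPolynomial.X i) - MvPolynomial.X i) :
    ∃ s ζ e, IsInertiaGenerator W i₀ s ζ e := by
  let I : Subgroup W :=
    { carrier := {g | (red (MvPolynomial.X i₀ : S n)).comp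
        (actS (g : Matrix.unitaryGroup (Fin n) ℂ)) = red (MvPolynomial.X i₀)}
      one_mem' := by
        rw [Set.mem_ofPred_eq, Subgroup.coe_one, actS_one, AlgHom.comp_id]
      mul_mem' := fun {a b} ha hb => by
        rw [Set.mem_ofPred_eq] at ha hb ⊢
        rw [Subgroup.coe_mul, actS_mul, ← AlgHom.comp_assoc, ha, hb]
      inv_mem' := fun {a} ha => by
        rw [Set.mem_ofPred_eq] at ha ⊢
        conv_lhs => rw [← ha]
        rw [AlgHom.comp_assoc, ← actS_mul, Subgroup.coe_inv, mul_inv_cancel, actS_one,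
          AlgHom.comp_id] }
  have hdiag : ∀ g : I, ((g : W) : Matrix.unitaryGroup (Fin n) ℂ) = Matrix.diagonal
      (Function.update 1 i₀ (((g : W) : Matrix.unitaryGroup (Fin n) ℂ) i₀ i₀)) :=
    fun g => eq_diagonal_of_inertia g.2
  let χ : I →* ℂ :=
    { toFun := fun g => ((g : W) : Matrix.unitaryGroup (Fin n) ℂ) i₀ i₀
      map_one' := by simp
      map_mul' := fun a b => by
        rw [Subgroup.coe_mul, Subgroup.coe_mul, Matrix.UnitaryGroup.mul_val, Matrix.mul_apply,
          Finset.sum_eq_single i₀ _ (by simp)]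
        intro k _ hk
        rw [hdiag a, Matrix.diagonal_apply_ne _ hk.symm, zero_mul] }
  have hχ : Function.Injective χ := by
    intro a b hab
    refine Subtype.ext (Subtype.ext (Subtype.ext ?_))
    rw [hdiag a, hdiag b]
    congr 2
  have hcyc : IsCyclic I := isCyclic_of_injective_ringHom χ hχ
  obtain ⟨s, hs⟩ := hcyc.exists_generator
  have hfin : IsOfFinOrder (χ s) := χ.isOfFinOrder (isOfFinOrder_of_finite s)
  refine ⟨s, χ s, orderOf (χ s), s.1.2, hdiag s, IsPrimitiveRoot.orderOf _, ?_, ?_⟩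
  · have h0 := hfin.orderOf_pos
    have h1 : orderOf (χ s) ≠ 1 := by
      intro h1
      rw [orderOf_injective χ hχ, orderOf_eq_one_iff] at h1
      obtain ⟨g, hg, hg1, hgX⟩ := hex
      have hgI : (⟨g, hg⟩ : W) ∈ I := red_comp_actS_eq_iff.mpr hgX
      have := hs ⟨⟨g, hg⟩, hgI⟩
      rw [h1, Subgroup.zpowers_one_eq_bot, Subgroup.mem_bot] at this
      exact hg1 (congrArg (fun x : I => ((x : W) : Matrix.unitaryGroup (Fin n) ℂ)) this)
    omega
  · intro g hg hgX
    have hgI : (⟨g, hg⟩ : W) ∈ I := red_comp_actS_eq_iff.mpr hgX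
    obtain ⟨k, hk⟩ := mem_powers_iff_mem_zpowers.mpr (hs ⟨⟨g, hg⟩, hgI⟩)
    refine ⟨k, ?_⟩
    have := congrArg (fun x : I => ((x : W) : Matrix.unitaryGroup (Fin n) ℂ)) hk
    simpa using this.symm

/-- A nonzero linear form is a unitary substitution away from a coordinate. -/
theorem exists_unitary_associated (b : Fin n → ℂ) (i₀ : Fin n) (hb : b ≠ 0) :
    ∃ P : Matrix.unitaryGroup (Fin n) ℂ,
      Associated (∑ k, MvPolynomial.C (b k) * MvPolynomial.X k : S n)
        (actS P (MvPolynomial.X i₀)) := by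
  let v : EuclideanSpace ℂ (Fin n) := WithLp.toLp 2 fun k => starRingEnd ℂ (b k)
  have hv : v ≠ 0 := by
    intro h
    refine hb (funext fun k => ?_)
    have := congrArg (fun w : EuclideanSpace ℂ (Fin n) => w k) h
    simpa [v] using this
  have hn : ‖v‖ ≠ 0 := norm_ne_zero_iff.mpr hv
  let u : EuclideanSpace ℂ (Fin n) := ((‖v‖⁻¹ : ℝ) : ℂ) • v
  have hu : ‖u‖ = 1 := by
    rw [norm_smul, Complex.norm_real, norm_inv, norm_norm, inv_mul_cancel₀ hn]
  obtain ⟨B, hB⟩ := Orthonormal.exists_orthonormalBasis_extension_of_card_eq (𝕜 := ℂ)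
    (E := EuclideanSpace ℂ (Fin n)) (ι := Fin n) (by simp) (v := fun _ => u) (s := {i₀})
    ⟨fun _ => hu, fun i j hij => absurd (Subsingleton.elim i j) hij⟩
  have hBu : B i₀ = u := hB i₀ rfl
  let P : Matrix.unitaryGroup (Fin n) ℂ :=
    ⟨(EuclideanSpace.basisFun (Fin n) ℂ).toBasis.toMatrix B,
      OrthonormalBasis.toMatrix_orthonormalBasis_mem_unitary _ _⟩
  have hP : ∀ k, P k i₀ = ((‖v‖⁻¹ : ℝ) : ℂ) * starRingEnd ℂ (b k) := by
    intro k
    show (EuclideanSpace.basisFun (Fin n) ℂ).toBasis.toMatrix B k i₀ = _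
    simp [Module.Basis.toMatrix_apply, hBu, u, v]
  refine ⟨P, ?_⟩
  have : actS P (MvPolynomial.X i₀)
      = (∑ k, MvPolynomial.C (b k) * MvPolynomial.X k) * MvPolynomial.C ((‖v‖⁻¹ : ℝ) : ℂ) := by
    rw [actS_X, Finset.sum_mul]
    refine Finset.sum_congr rfl fun k _ => ?_
    rw [inv_apply, hP, map_mul, Complex.conj_conj, Complex.conj_ofReal, map_mul]
    ring
  rw [this]
  refine associated_mul_unit_right _ _ (IsUnit.map _ (isUnit_iff_ne_zero.mpr ?_))
  exact_mod_cast inv_ne_zero hn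

/-- A prime with a nontrivial inertia group is a linear form. -/
theorem exists_associated_of_ramified {p : S n} (hp : Prime p)
    {g : Matrix.unitaryGroup (Fin n) ℂ} (hg : g ≠ 1)
    (h : ∀ i, p ∣ actS g (MvPolynomial.X i) - MvPolynomial.X i) :
    ∃ (P : Matrix.unitaryGroup (Fin n) ℂ) (i₀ : Fin n),
      Associated p (actS P (MvPolynomial.X i₀)) := by
  have hex : ∃ i, actS g (MvPolynomial.X i) ≠ MvPolynomial.X i := by
    by_contra! hall
    have h1 : actS g⁻¹ = AlgHom.id ℂ (S n) := MvPolynomial.algHom_ext fun i => by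
      conv_lhs => rw [← hall i]
      rw [actS_inv_apply]
      rfl
    refine hg (Subtype.ext (Matrix.ext fun j k => ?_))
    have h2 := congrArg (fun F : S n →ₐ[ℂ] S n =>
      MvPolynomial.eval (Pi.single k 1) (F (MvPolynomial.X j))) h1
    simp only [actS_X, inv_inv, sum_C_mul_X_eval] at h2
    rw [h2]
    simp [Pi.single_apply, Matrix.one_apply]
  obtain ⟨i, hi⟩ := hex
  let b : Fin n → ℂ := fun k => (g⁻¹ : Matrix.unitaryGroup (Fin n) ℂ) i k
    - (1 : Matrix (Fin n) (Fin n) ℂ) i k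
  have hbX : actS g (MvPolynomial.X i) - MvPolynomial.X i
      = ∑ k, MvPolynomial.C (b k) * MvPolynomial.X k := by
    simp only [b, actS_X, map_sub, sub_mul, Finset.sum_sub_distrib]
    congr 1
    simp [Matrix.one_apply]
  have hb0 : b ≠ 0 := by
    intro hb
    refine hi (sub_eq_zero.mp ?_)
    rw [hbX]
    simp [hb]
  obtain ⟨P, hP⟩ := exists_unitary_associated b i hb0
  refine ⟨P, i, Associated.trans ?_ hP⟩
  have hdvd := h i
  rw [hbX] at hdvd
  refine hp.irreducible.associated_of_dvd ?_ hdvd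
  refine hP.symm.irreducible ?_
  have hX : Irreducible (MvPolynomial.X i : S n) := (prime_X i).irreducible
  refine Prime.irreducible ⟨fun h => ?_, fun h => ?_, ?_⟩
  · exact hX.ne_zero (actS_injective P (by rw [h, map_zero]))
  · exact hX.not_isUnit (by simpa using h.map (actS P⁻¹))
  · intro u v huv
    have := map_dvd (actS P⁻¹) huv
    rw [actS_inv_apply, map_mul] at this
    refine ((prime_X i).dvd_or_dvd this).imp ?_ ?_ <;>
    · intro h
      simpa using map_dvd (actS P) h

/-- The local comparison at a prime `p`. The exponents are `x = e - 1` and `y = 1` if `p` defines a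
reflecting hyperplane with inertia group of order `e`, and `x = y = 0` otherwise. -/
theorem exists_local_bounds {W : Subgroup (Matrix.unitaryGroup (Fin n) ℂ)} [Finite W]
    {f : Fin n → S n} (hf : ∀ i, ∀ g ∈ W, actS g (f i) = f i)
    (hgen : ∀ q, (∀ g ∈ W, actS g q = q) → q ∈ Algebra.adjoin ℂ (Set.range f))
    {θ : Fin n → Fin n → S n} (hθ : ∀ i, ∀ g ∈ W, actDer g (θ i) = θ i)
    (hspan : ∀ u : Fin n → S n, (∀ g ∈ W, actDer g u = u) →
      ∃ c : Fin n → S n, ∀ j, u j = ∑ i, c i * θ i j) {p : S n} (hp : Prime p) :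
    ∃ x y : ℕ, ¬ p ^ (x + 1) ∣ jac f ∧ ¬ p ^ (y + 1) ∣ derDet θ ∧
      ∀ r, 1 ≤ r → ∀ w : Col n r → Forms n, (∀ q, w q ∈ block n r) →
        (∀ q, ∀ g ∈ W, actForms g (w q) = w q) →
        p ^ (x * (2 ^ (n - 1) * (n - 1).choose r) + y * (2 ^ (n - 1) * (n - 1).choose (r - 1)))
          ∣ (coordMatrix (r := r) w).det := by
  by_cases hun : ∀ g ∈ W, (∀ i, p ∣ actS g (MvPolynomial.X i) - MvPolynomial.X i) → g = 1
  · refine ⟨0, 0, ?_, ?_, fun r _ w _ _ => by simp⟩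
    · simpa using not_dvd_jac_of_unramified hgen hp hun
    · simpa using not_dvd_derDet_of_unramified
        (fun u hu => hspan u fun g hg => funext fun k => hu g hg k) hp hun
  push Not at hun
  obtain ⟨g, hgW, hgX, hg1⟩ := hun
  obtain ⟨P, i₀, hP⟩ := exists_associated_of_ramified hp hg1 hgX
  -- the conjugate group `P⁻¹WP` is ramified along the coordinate `x_{i₀}`
  let W' : Subgroup (Matrix.unitaryGroup (Fin n) ℂ) := W.map (MulAut.conj P⁻¹).toMonoidHom
  have hW' : ∀ k ∈ W', ∃ g ∈ W, k = P⁻¹ * g * P := by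
    rintro _ ⟨g, hg, rfl⟩
    exact ⟨g, hg, by simp⟩
  have hWW' : ∀ g ∈ W, P⁻¹ * g * P ∈ W' := fun g hg => ⟨g, hg, by simp⟩
  have hfinW' : Finite W' := Finite.of_surjective
    (fun g : W => (⟨P⁻¹ * g * P, hWW' g g.2⟩ : W')) fun k => by
      obtain ⟨g, hg, hk⟩ := hW' k k.2
      exact ⟨⟨g, hg⟩, Subtype.ext hk.symm⟩
  have hPdvd : ∀ {k : ℕ} {q : S n}, p ^ k ∣ q ↔ MvPolynomial.X i₀ ^ k ∣ actS P⁻¹ q := by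
    intro k q
    rw [(hP.pow_pow (n := k)).dvd_iff_dvd_left, ← actS_dvd_iff P⁻¹, map_pow, actS_inv_apply]
  obtain ⟨s, ζ, e, hs⟩ := exists_isInertiaGenerator W' i₀ ⟨P⁻¹ * g * P, hWW' g hgW, by
    intro h
    refine hg1 ?_
    have h1 : g = P * (P⁻¹ * g * P) * P⁻¹ := by group
    rw [h1, h]
    group, fun i => by
    have h1 := dvd_actS_sub hgX (actS P (MvPolynomial.X i))
    rw [← pow_one p, hPdvd, pow_one, map_sub, actS_inv_apply] at h1
    rwa [actS_mul_apply, actS_mul_apply]⟩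
  have hsW : ∃ g ∈ W, s = P⁻¹ * g * P := hW' s hs.mem
  have hcancel : ∀ g, P * (P⁻¹ * g * P) = g * P := fun g => by group
  refine ⟨e - 1, 1, ?_, ?_, ?_⟩
  · rw [Nat.sub_add_cancel (by have := hs.two_le; omega), hPdvd,
      ← (associated_jac_act P⁻¹ f).dvd_iff_dvd_right]
    refine not_X_pow_dvd_jac hs (fun i k hk => ?_) fun q hq => ?_
    · obtain ⟨g, hg, rfl⟩ := hW' k hk
      rw [actS_mul_apply, actS_mul_apply, actS_apply_inv, hf i g hg]
    · have h1 : actS P q ∈ Algebra.adjoin ℂ (Set.range f) := by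
        refine hgen _ fun g hg => ?_
        rw [← actS_mul_apply, ← hcancel g, actS_mul_apply, hq _ (hWW' g hg)]
      have h2 := Subalgebra.mem_map.mpr ⟨_, h1, actS_inv_apply P q⟩
      rwa [AlgHom.map_adjoin, ← Set.range_comp] at h2
  · rw [hPdvd, ← (associated_derDet_act P⁻¹ θ).dvd_iff_dvd_right]
    refine not_X_sq_dvd_derDet hs (fun i k hk => ?_) fun u hu => ?_
    · obtain ⟨g, hg, rfl⟩ := hW' k hk
      have : actDer (P⁻¹ * g * P) (actDer P⁻¹ (θ i)) = actDer P⁻¹ (θ i) := by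
        rw [← actDer_mul, mul_assoc, mul_inv_cancel, mul_one, actDer_mul, hθ i g hg]
      exact congrFun this
    · obtain ⟨c, hc⟩ := hspan (actDer P u) fun g hg => by
        rw [← actDer_mul, ← hcancel g, actDer_mul]
        congr 1
        exact funext (hu _ (hWW' g hg))
      refine ⟨fun i => actS P⁻¹ (c i), fun j => ?_⟩
      rw [← actDer_sum, ← show actDer P u = fun j => ∑ i, c i * θ i j from funext hc, ← actDer_mul,
        inv_mul_cancel, actDer_one]
  · intro r hr w hwb hw
    obtain ⟨v, hv, hdet⟩ := exists_det_coordMatrix_act (r := r) P⁻¹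
    rw [hPdvd, ← hv.dvd_mul_right, ← hdet w hwb, one_mul]
    refine X_pow_dvd_det_coordMatrix hs hr fun q => ?_
    obtain ⟨g, hg, rfl⟩ := hsW
    rw [← actForms_mul_apply, mul_assoc, mul_inv_cancel, mul_one, actForms_mul_apply, hw q g hg]

/-- The determinant of any family of invariant forms is divisible by the product of powers of the
Jacobian and of the determinant of basic derivations. -/
theorem jac_pow_mul_derDet_pow_dvd {W : Subgroup (Matrix.unitaryGroup (Fin n) ℂ)} [Finite W]
    {f : Fin n → S n} (hf : ∀ i, ∀ g ∈ W, actS g (f i) = f i)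
    (hgen : ∀ q, (∀ g ∈ W, actS g q = q) → q ∈ Algebra.adjoin ℂ (Set.range f))
    {θ : Fin n → Fin n → S n} (hθ : ∀ i, ∀ g ∈ W, actDer g (θ i) = θ i)
    (hspan : ∀ u : Fin n → S n, (∀ g ∈ W, actDer g u = u) →
      ∃ c : Fin n → S n, ∀ j, u j = ∑ i, c i * θ i j) {r : ℕ} (hr : 1 ≤ r) (hrn : r ≤ n)
    {w : Col n r → Forms n} (hwb : ∀ q, w q ∈ block n r)
    (hw : ∀ q, ∀ g ∈ W, actForms g (w q) = w q) :
    jac f ≠ 0 ∧ derDet θ ≠ 0 ∧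
    jac f ^ (2 ^ (n - 1) * (n - 1).choose r) * derDet θ ^ (2 ^ (n - 1) * (n - 1).choose (r - 1))
      ∣ (coordMatrix (r := r) w).det := by
  have h0 : jac f ≠ 0 ∧ derDet θ ≠ 0 := by
    obtain ⟨x, y, hx, hy, -⟩ := exists_local_bounds hf hgen hθ hspan (prime_X ⟨0, by omega⟩)
    exact ⟨fun h => hx (h ▸ dvd_zero _), fun h => hy (h ▸ dvd_zero _)⟩
  refine ⟨h0.1, h0.2, ?_⟩
  rw [UniqueFactorizationMonoid.dvd_iff_emultiplicity_le
    (mul_ne_zero (pow_ne_zero _ h0.1) (pow_ne_zero _ h0.2))]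
  intro p hp
  obtain ⟨x, y, hx, hy, hxy⟩ := exists_local_bounds hf hgen hθ hspan hp
  rw [emultiplicity_mul hp, emultiplicity_pow hp, emultiplicity_pow hp]
  have hx' : emultiplicity p (jac f) ≤ x :=
    Order.le_of_lt_add_one (by exact_mod_cast emultiplicity_lt_iff_not_dvd.mpr hx)
  have hy' : emultiplicity p (derDet θ) ≤ y :=
    Order.le_of_lt_add_one (by exact_mod_cast emultiplicity_lt_iff_not_dvd.mpr hy)
  refine le_trans (add_le_add (mul_le_mul_right hx' _) (mul_le_mul_right hy' _)) ?_
  have := le_emultiplicity_of_pow_dvd (hxy r hr w hwb hw)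
  refine le_trans (le_of_eq ?_) this
  push_cast
  ring

/-! ### The exterior subalgebra generated by the differentials -/

theorem d_mul_d_add_swap (f h : S n) : d f * d h + d h * d f = 0 := by
  simp only [d, Finset.sum_mul, Finset.mul_sum, Algebra.TensorProduct.tmul_mul_tmul]
  conv_lhs => arg 1; rw [Finset.sum_comm]
  rw [← Finset.sum_add_distrib]
  refine Finset.sum_eq_zero fun i _ => ?_
  rw [← Finset.sum_add_distrib]
  refine Finset.sum_eq_zero fun j _ => ?_
  rw [mul_comm (MvPolynomial.pderiv j h), ← TensorProduct.tmul_add, ExteriorAlgebra.ι_add_mul_swap,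
    TensorProduct.tmul_zero]

theorem d_mul_d_swap (f h : S n) : d f * d h = -(d h * d f) :=
  eq_neg_of_add_eq_zero_left (d_mul_d_add_swap f h)

theorem d_mul_self (f : S n) : d f * d f = 0 := by
  have h := d_mul_d_add_swap f f
  rw [← two_smul ℂ] at h
  exact (smul_eq_zero.mp h).resolve_left two_ne_zero

theorem exists_smul_prod_of_perm {A : Type*} [Ring A] {m : ℕ} {F : Fin m → A}
    (hF : ∀ i j, F i * F j = -(F j * F i)) {l l' : List (Fin m)} (h : l.Perm l') :
    ∃ ε : ℤ, (l.map F).prod = ε • (l'.map F).prod := by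
  induction h with
  | nil => exact ⟨1, (one_smul _ _).symm⟩
  | cons a _ ih =>
    obtain ⟨ε, h⟩ := ih
    refine ⟨ε, ?_⟩
    rw [List.map_cons, List.prod_cons, h, List.map_cons, List.prod_cons, mul_smul_comm]
  | swap a b l =>
    refine ⟨-1, ?_⟩
    simp only [List.map_cons, List.prod_cons]
    rw [← mul_assoc, hF b a, neg_one_smul, neg_mul, mul_assoc]
  | trans _ _ ih ih' =>
    obtain ⟨ε, h⟩ := ih
    obtain ⟨ε', h'⟩ := ih'
    exact ⟨ε * ε', by rw [h, h', mul_smul]⟩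

/-- Every product of anticommuting elements of square zero is a multiple of an ordered one. -/
theorem exists_smul_prod_sort {A : Type*} [Ring A] {m : ℕ} {F : Fin m → A}
    (hF : ∀ i j, F i * F j = -(F j * F i)) (hF0 : ∀ i, F i * F i = 0) (l : List (Fin m)) :
    ∃ ε : ℤ, (l.map F).prod = ε • ((l.toFinset.sort (· ≤ ·)).map F).prod := by
  by_cases hl : l.Nodup
  · refine exists_smul_prod_of_perm hF ?_
    rw [List.perm_ext_iff_of_nodup hl (Finset.sort_nodup _ _)]
    simp
  · refine ⟨0, ?_⟩
    rw [zero_smul]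
    obtain ⟨a, ha⟩ := List.exists_duplicate_iff_not_nodup.mpr hl
    obtain ⟨l', hl'⟩ := (List.duplicate_iff_sublist.mp ha).exists_perm_append
    obtain ⟨ε, hε⟩ := exists_smul_prod_of_perm hF hl'
    rw [hε]
    simp only [List.cons_append, List.nil_append, List.map_cons, List.prod_cons]
    rw [← mul_assoc, hF0, zero_mul, smul_zero]

variable {W : Subgroup (Matrix.unitaryGroup (Fin n) ℂ)}

/-- `df_L` as an invariant form. -/
def dWedgeInv (f : Fin n → invS W) (r : ℕ) (L : Finset (Fin (n - r))) : invDForms W :=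
  ((L.sort (· ≤ ·)).map fun l => dInv (f (Fin.castLE (n.sub_le r) l))).prod

theorem coe_list_prod_dInv (f : Fin n → invS W) {m : ℕ} (c : Fin m → Fin n) (l : List (Fin m)) :
    (((l.map fun i => dInv (f (c i))).prod : invDForms W) : DForms n)
      = (l.map fun i => d (f (c i) : S n)).prod := by
  induction l with
  | nil => rfl
  | cons a l ih =>
    simp only [List.map_cons, List.prod_cons]
    rw [← ih]
    rfl

theorem coe_dWedgeInv (f : Fin n → invS W) (r : ℕ) (L : Finset (Fin (n - r))) :
    (dWedgeInv f r L : DForms n) = dWedge f r L :=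
  coe_list_prod_dInv f _ _

theorem dWedgeInv_mem (f : Fin n → invS W) (r : ℕ) (L : Finset (Fin (n - r))) :
    dWedgeInv f r L ∈ R f r := by
  refine Subalgebra.list_prod_mem _ fun a ha => ?_
  obtain ⟨l, -, rfl⟩ := List.mem_map.mp ha
  exact Algebra.subset_adjoin ⟨l, rfl⟩

theorem dWedge_invariant (f : Fin n → invS W) (r : ℕ) (L : Finset (Fin (n - r)))
    {g : Matrix.unitaryGroup (Fin n) ℂ} (hg : g ∈ W) :
    actDForms g (dWedge f r L) = dWedge f r L := by
  rw [← coe_dWedgeInv]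
  exact (dWedgeInv f r L).2 g hg

set_option synthInstance.maxHeartbeats 400000 in
/-- The forms `df_L` span `R_r` over the invariants. -/
theorem exists_sum_dWedge (f : Fin n → invS W) (r : ℕ) {ρ : invDForms W} (hρ : ρ ∈ R f r) :
    ∃ c : Finset (Fin (n - r)) → invS W, (ρ : DForms n) = ∑ L, (c L : S n) • dWedge f r L := by
  have hspan : ρ ∈ Submodule.span (invS W) (Set.range (dWedgeInv f r)) := by
    have h1 : ρ ∈ Subalgebra.toSubmodule (R f r) := hρ
    rw [R, Algebra.adjoin_eq_span] at h1
    refine Submodule.span_le.mpr ?_ h1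
    intro z hz
    have hlist : ∃ l : List (Fin (n - r)),
        z = (l.map fun i => dInv (f (Fin.castLE (n.sub_le r) i))).prod := by
      induction hz using Submonoid.closure_induction with
      | mem _ h => obtain ⟨i, rfl⟩ := h; exact ⟨[i], by simp⟩
      | one => exact ⟨[], rfl⟩
      | mul _ _ _ _ h h' =>
        obtain ⟨l, rfl⟩ := h
        obtain ⟨l', rfl⟩ := h'
        exact ⟨l ++ l', by rw [List.map_append, List.prod_append]⟩
    obtain ⟨l, rfl⟩ := hlist
    obtain ⟨ε, hε⟩ := exists_smul_prod_sort
      (F := fun i => dInv (f (Fin.castLE (n.sub_le r) i)))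
      (fun i j => Subtype.ext (d_mul_d_swap _ _)) (fun i => Subtype.ext (d_mul_self _)) l
    rw [hε, SetLike.mem_coe]
    have h2 : dWedgeInv f r l.toFinset ∈ Submodule.span (invS W) (Set.range (dWedgeInv f r)) :=
      Submodule.subset_span (Set.mem_range_self _)
    exact zsmul_mem h2 ε
  obtain ⟨c, hc⟩ := (Submodule.mem_span_range_iff_exists_fun _).mp hspan
  refine ⟨c, ?_⟩
  rw [← hc, AddSubmonoidClass.coe_finsetSum]
  refine Finset.sum_congr rfl fun L _ => ?_
  rw [← coe_dWedgeInv]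
  rfl

set_option synthInstance.maxHeartbeats 400000 in
theorem exists_coe_eq_sum_dWedge (f : Fin n → invS W) (r : ℕ)
    (c : Finset (Fin (n - r)) → invS W) :
    ∃ ρ : R f r, ((ρ : invDForms W) : DForms n) = ∑ L, (c L : S n) • dWedge f r L := by
  refine ⟨⟨∑ L, c L • dWedgeInv f r L, Subalgebra.sum_mem _ fun L _ =>
    Subalgebra.smul_mem _ (dWedgeInv_mem f r L) _⟩, ?_⟩
  rw [AddSubmonoidClass.coe_finsetSum]
  refine Finset.sum_congr rfl fun L _ => ?_
  rw [← coe_dWedgeInv]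
  rfl

/-! ### The candidate basis consists of invariant forms -/

theorem derivForm_mem_block (h : Fin n → S n) : derivForm h ∈ block n 1 :=
  Submodule.sum_mem _ fun j _ => Submodule.tmul_mem_baseChange_of_mem _ (by
    have h1 : ExteriorAlgebra.ι ℂ (y j) ∈ LinearMap.range (ExteriorAlgebra.ι ℂ (M := V n)) ^ 1 := by
      rw [pow_one]
      exact ⟨y j, rfl⟩
    exact h1)

theorem mul_mem_block {r t : ℕ} {ω ω' : Forms n} (h : ω ∈ block n r) (h' : ω' ∈ block n t) :
    ω * ω' ∈ block n (r + t) := by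
  refine block_induction (P := fun ω => ω * ω' ∈ block n (r + t)) ?_ ?_ ?_ h
  · rw [zero_mul]; exact Submodule.zero_mem _
  · intro a b ha hb
    rw [add_mul]
    exact Submodule.add_mem _ ha hb
  · intro p η v hv
    refine block_induction (P := fun ω' => ((p ⊗ₜ η) ⊗ₜ v : Forms n) * ω' ∈ block n (r + t))
      ?_ ?_ ?_ h'
    · rw [mul_zero]; exact Submodule.zero_mem _
    · intro a b ha hb
      rw [mul_add]
      exact Submodule.add_mem _ ha hb
    · intro q ξ u hu
      rw [Algebra.TensorProduct.tmul_mul_tmul]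
      refine Submodule.tmul_mem_baseChange_of_mem _ ?_
      have h1 : v * u ∈ LinearMap.range (ExteriorAlgebra.ι ℂ (M := V n)) ^ (r + t) := by
        rw [pow_add]
        exact Submodule.mul_mem_mul hv hu
      exact h1

theorem thetaWedge_mem_block (θ : Fin n → Fin n → S n) (J : Finset (Fin n)) :
    thetaWedge θ J ∈ block n J.card := by
  rw [thetaWedge, ← Finset.length_sort (· ≤ ·)]
  induction J.sort (· ≤ ·) with
  | nil =>
    refine Submodule.tmul_mem_baseChange_of_mem _ ?_
    have h1 : (1 : ExteriorAlgebra ℂ (V n))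
        ∈ LinearMap.range (ExteriorAlgebra.ι ℂ (M := V n)) ^ 0 := by
      rw [pow_zero]
      exact Submodule.one_le.mp le_rfl
    exact h1
  | cons a l ih =>
    rw [List.map_cons, List.prod_cons, List.length_cons, add_comm]
    exact mul_mem_block (derivForm_mem_block _) ih

theorem tilde_mem_block (h : Fin n → S n) {r : ℕ} {ω : Forms n} (hω : ω ∈ block n r) :
    tilde h ω ∈ block n r := by
  refine block_induction (P := fun ω => tilde h ω ∈ block n r) ?_ ?_ ?_ hω
  · rw [map_zero]; exact Submodule.zero_mem _
  · intro a b ha hb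
    rw [map_add]
    exact Submodule.add_mem _ ha hb
  · intro p η v hv
    rw [tilde_tmul]
    exact Submodule.sum_mem _ fun j _ => Submodule.tmul_mem_baseChange_of_mem _ hv

theorem elt_mem_block (θ : Fin n → Fin n → S n) {r : ℕ} (hr : r ≤ n) (p : Idx n r) :
    elt θ hr p ∈ block n r := by
  have h : thetaWedge θ p.2.1 ∈ block n r := by
    have := thetaWedge_mem_block θ p.2.1
    rwa [p.2.2] at this
  rw [elt, tildeProd]
  induction p.1.sort (· ≤ ·) with
  | nil => exact h
  | cons a l ih => exact tilde_mem_block _ ih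

theorem actForms_elt {θ : Fin n → Fin n → S n} {g : Matrix.unitaryGroup (Fin n) ℂ}
    (hθ : ∀ i, actDer g (θ i) = θ i) {r : ℕ} (hr : r ≤ n) (p : Idx n r) :
    actForms g (elt θ hr p) = elt θ hr p := by
  have h : actForms g (thetaWedge θ p.2.1) = thetaWedge θ p.2.1 := by
    rw [thetaWedge, map_list_prod, List.map_map]
    congr 2
    funext i
    exact (actForms_derivForm g (θ i)).trans (congrArg derivForm (hθ i))
  rw [elt, tildeProd]
  induction p.1.sort (· ≤ ·) with
  | nil => exact h
  | cons a l ih =>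
    exact (actForms_tilde g (fun k => congrFun (hθ _) k) _).trans (congrArg (tilde _) ih)

theorem elt_mem {θ : Fin n → Fin n → S n} (hθ : ∀ i, ∀ g ∈ W, actDer g (θ i) = θ i) {r : ℕ}
    (hr : r ≤ n) (p : Idx n r) : elt θ hr p ∈ M W r :=
  ⟨fun g hg => actForms_elt (fun i => hθ i g hg) hr p, elt_mem_block θ hr p⟩

/-! ### The sum of the degrees -/

theorem sum_finset_sum (m : ℕ) (u : Fin m → ℤ) :
    2 * ∑ L : Finset (Fin m), ∑ l ∈ L, u l = 2 ^ m * ∑ l, u l := by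
  have h : ∑ L : Finset (Fin m), ∑ l ∈ L, u l
      = ∑ l, ∑ L : Finset (Fin m) with l ∈ L, u l := by
    rw [Finset.sum_comm' (t' := Finset.univ) (s' := fun l => Finset.univ.filter fun L => l ∈ L)]
    simp
  rw [h, Finset.mul_sum, Finset.mul_sum]
  refine Finset.sum_congr rfl fun l _ => ?_
  rw [Finset.sum_const, card_finset_mem, nsmul_eq_mul, ← mul_assoc]
  push_cast
  rw [← pow_succ', Nat.sub_add_cancel l.pos]

theorem sum_subtype_sum {r : ℕ} (hr : 1 ≤ r) (u : Fin n → ℤ) :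
    ∑ J : {J : Finset (Fin n) // J.card = r}, ∑ j ∈ J.1, u j
      = (n - 1).choose (r - 1) * ∑ j, u j := by
  have h : ∑ J : {J : Finset (Fin n) // J.card = r}, ∑ j ∈ J.1, u j
      = ∑ j, ∑ J : {J : Finset (Fin n) // J.card = r} with j ∈ J.1, u j := by
    rw [Finset.sum_comm' (t' := Finset.univ) (s' := fun l => Finset.univ.filter
      fun L : {J : Finset (Fin n) // J.card = r} => l ∈ L.1)]
    simp
  rw [h, Finset.mul_sum]
  refine Finset.sum_congr rfl fun l _ => ?_
  rw [Finset.sum_const, card_subtype_mem l hr, nsmul_eq_mul]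

theorem sum_arithmetic (m : ℕ) (c a : ℤ) :
    2 * ∑ l : Fin m, (c + l * a) = m * (2 * c + (m - 1) * a) := by
  rw [Fin.sum_univ_eq_sum_range fun l => c + (l : ℤ) * a]
  induction m with
  | zero => simp
  | succ m ih =>
    rw [Finset.sum_range_succ, mul_add, ih]
    push_cast
    ring

/-- If exponents and coexponents are arithmetic sequences with the same gap, the degrees of the
forms `df_L θ̃_I(θ_J)` add up to the degree of the product of powers of the Jacobian and of the
determinant of basic derivations. -/
theorem sum_degrees {r : ℕ} (hr₁ : 1 ≤ r) (hr : r ≤ n) {c c' a : ℤ} {u v : Fin n → ℤ}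
    (hu : ∀ i, u i = c + i * a) (hv : ∀ i, v i = c' + i * a) :
    ∑ q : Finset (Fin (n - r)) × Idx n r, (∑ l ∈ q.1, u (Fin.castLE (n.sub_le r) l)
      + (∑ j ∈ q.2.2.1, v j - ∑ i ∈ q.2.1, v (Fin.castLE hr i)))
    = (2 ^ (n - 1) * (n - 1).choose r : ℕ) * ∑ i, u i
      + (2 ^ (n - 1) * (n - 1).choose (r - 1) : ℕ) * ∑ i, v i := by
  obtain ⟨m, rfl⟩ : ∃ m, n = m + r := ⟨n - r, by omega⟩
  have hA := sum_finset_sum (m + r - r) fun l => u (Fin.castLE ((m + r).sub_le r) l)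
  have hB := sum_finset_sum r fun i => v (Fin.castLE hr i)
  have hC := sum_subtype_sum hr₁ v
  have h1 := sum_arithmetic (m + r - r) c a
  have h2 := sum_arithmetic r c' a
  have h3 := sum_arithmetic (m + r) c a
  have h4 := sum_arithmetic (m + r) c' a
  rw [← Finset.sum_congr rfl fun i _ => hu i] at h3
  rw [← Finset.sum_congr rfl fun i _ => hv i] at h4
  rw [Finset.sum_congr rfl fun l _ => hu (Fin.castLE ((m + r).sub_le r) l)] at hA
  rw [Finset.sum_congr rfl fun l _ => hv (Fin.castLE hr l)] at hB
  simp only [Fin.val_castLE] at hA hB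
  simp only [Fintype.sum_prod_type, Finset.sum_add_distrib, Finset.sum_sub_distrib,
    Finset.sum_const, Finset.card_univ, Fintype.card_finset, Fintype.card_fin,
    Fintype.card_finset_len, nsmul_eq_mul, ← Finset.mul_sum]
  have hcard : Fintype.card (Idx (m + r) r) = 2 ^ r * (m + r).choose r := by
    rw [Fintype.card_prod, Fintype.card_finset, Fintype.card_fin, Fintype.card_finset_len,
      Fintype.card_fin]
  rw [hcard, hC]
  generalize (∑ L : Finset (Fin (m + r - r)), ∑ l ∈ L, u (Fin.castLE ((m + r).sub_le r) l)) = SA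
    at hA ⊢
  generalize (∑ L : Finset (Fin r), ∑ l ∈ L, v (Fin.castLE hr l)) = SB at hB ⊢
  generalize (∑ l : Fin (m + r - r), (c + ((l : ℕ) : ℤ) * a)) = T₁ at hA h1
  generalize (∑ l : Fin r, (c' + ((l : ℕ) : ℤ) * a)) = T₂ at hB h2
  generalize (∑ i, u i) = U at h3 ⊢
  generalize (∑ i, v i) = V at h4 ⊢
  rw [Nat.add_sub_cancel] at hA h1 ⊢
  have hP : (2 : ℤ) ^ m * 2 ^ r = 2 * 2 ^ (m + r - 1) := by
    rw [← pow_add, ← pow_succ', Nat.sub_add_cancel (by omega)]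
  have hC₁ : ((m : ℤ) + r) * (m + r - 1).choose (r - 1) = r * (m + r).choose r := by
    have h := Nat.add_one_mul_choose_eq (m + r - 1) (r - 1)
    rw [Nat.sub_add_cancel hr₁,
      Nat.sub_add_cancel (by omega)] at h
    rw [mul_comm (r : ℤ)]
    exact_mod_cast h
  have hC₀ : ((m : ℤ) + r) * (m + r - 1).choose r = m * (m + r).choose r := by
    have h := Nat.choose_succ_succ (m + r - 1) (r - 1)
    rw [Nat.succ_eq_add_one, Nat.succ_eq_add_one, Nat.sub_add_cancel hr₁,
      Nat.sub_add_cancel (by omega)] at h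
    have h' : ((m + r).choose r : ℤ) = (m + r - 1).choose (r - 1) + (m + r - 1).choose r := by
      exact_mod_cast h
    linear_combination -hC₁ - ((m : ℤ) + r) * h'
  push_cast at h3 h4 ⊢
  generalize ((m + r).choose r : ℤ) = N at hC₁ hC₀ ⊢
  generalize ((m + r - 1).choose r : ℤ) = N₀ at hC₀ ⊢
  generalize ((m + r - 1).choose (r - 1) : ℤ) = N₁ at hC₁ ⊢
  -- the common gap `a` is what makes the two sides agree
  have key : N * T₁ + N₁ * V - N * T₂ = N₀ * U := by
    have hne : (2 * ((m : ℤ) + r)) ≠ 0 := by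
      have : (1 : ℤ) ≤ r := by exact_mod_cast hr₁
      positivity
    refine mul_left_cancel₀ hne ?_
    linear_combination ((m : ℤ) + r) * N * h1 + ((m : ℤ) + r) * N₁ * h4 - ((m : ℤ) + r) * N * h2
      - ((m : ℤ) + r) * N₀ * h3 + (m + r) * (2 * c' + (m + r - 1) * a) * hC₁
      - (m + r) * (2 * c + (m + r - 1) * a) * hC₀
  refine mul_left_cancel₀ (two_ne_zero (α := ℤ)) ?_
  linear_combination 2 ^ r * N * hA - 2 ^ m * N * hB + (N * T₁ + 2 * N₁ * V - N * T₂) * hP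
    + 2 * 2 ^ (m + r - 1) * key

/-! ### The determinant criterion -/

theorem det_coordMatrix_ne_zero {r : ℕ} {w : Col n r → Forms n} (hwb : ∀ q, w q ∈ block n r)
    (hw : LinearIndependent (S n) w) : (coordMatrix (r := r) w).det ≠ 0 := by
  classical
  intro hdet
  obtain ⟨v, hv, h0⟩ := Matrix.exists_vecMul_eq_zero_iff.mpr hdet
  refine hv (funext (Fintype.linearIndependent_iff.mp hw v ?_))
  have hmem : ∑ q, v q • w q ∈ block n r :=
    Submodule.sum_mem _ fun q _ => smul_mem_block _ (hwb q)
  rw [eq_sum_of_mem_block hmem]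
  refine Finset.sum_eq_zero fun c _ => ?_
  have : (formBasis n).repr (∑ q, v q • w q) (c.1, c.2.1) = 0 := by
    rw [map_sum, Finsupp.coe_finsetSum, Finset.sum_apply]
    simp only [map_smul, Finsupp.smul_apply, smul_eq_mul]
    exact congrFun h0 c
  rw [this, zero_smul]

/-- Cramer's rule: if the determinant of a family of forms divides every determinant obtained by
exchanging one member for `ω`, then `ω` is a combination of the family. -/
theorem exists_combination_of_dvd {r : ℕ} {w : Col n r → Forms n} (hwb : ∀ q, w q ∈ block n r)
    (h0 : (coordMatrix (r := r) w).det ≠ 0) {ω : Forms n} (hω : ω ∈ block n r)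
    (hdvd : ∀ q, (coordMatrix (r := r) w).det ∣
      (coordMatrix (r := r) (Function.update w q ω)).det) :
    ∃ k : Col n r → S n, ω = ∑ q, k q • w q := by
  classical
  choose k hk using hdvd
  refine ⟨k, ?_⟩
  set X : Matrix (Col n r) (Col n r) (S n) := coordMatrix w
  let y : Col n r → S n := fun c => (formBasis n).repr ω (c.1, c.2.1)
  have hcr : Matrix.cramer X.transpose y = X.det • k := by
    funext q
    rw [Matrix.cramer_transpose_apply, Pi.smul_apply, smul_eq_mul, ← hk q]
    congr 1
    refine Matrix.ext fun i c => ?_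
    by_cases hi : i = q
    · subst hi
      simp [coordMatrix, y]
    · simp [coordMatrix, X, hi]
  have hsol := Matrix.mulVec_cramer X.transpose y
  rw [hcr, Matrix.mulVec_smul, Matrix.det_transpose] at hsol
  have hsol' : ∀ c, ∑ q, k q * X q c = y c := by
    intro c
    have h1 := congrFun hsol c
    rw [Pi.smul_apply, Pi.smul_apply, smul_eq_mul, smul_eq_mul] at h1
    rw [← mul_left_cancel₀ h0 h1]
    exact Finset.sum_congr rfl fun q _ => mul_comm _ _
  have hmem : ∑ q, k q • w q ∈ block n r :=
    Submodule.sum_mem _ fun q _ => smul_mem_block _ (hwb q)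
  rw [eq_sum_of_mem_block hω, eq_sum_of_mem_block hmem]
  refine Finset.sum_congr rfl fun c _ => ?_
  congr 1
  rw [map_sum, Finsupp.coe_finsetSum, Finset.sum_apply]
  simp only [map_smul, Finsupp.smul_apply, smul_eq_mul]
  exact (hsol' c).symm

theorem linearIndependent_of_fractionRing {ι : Type*} {w : ι → Forms n}
    (h : LinearIndependent (FractionRing (S n))
      fun q => (1 : FractionRing (S n)) ⊗ₜ[S n] w q) : LinearIndependent (S n) w := by
  have h1 : LinearIndependent (S n) fun q => (1 : FractionRing (S n)) ⊗ₜ[S n] w q := by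
    refine h.restrict_scalars fun a b hab => ?_
    simpa [Algebra.smul_def] using hab
  exact h1.of_comp (TensorProduct.mk (S n) (FractionRing (S n)) (Forms n) 1)

theorem isUnit_of_eq_mul {p q u : S n} {k : ℤ} (hp : p ∈ homZ n k) (hq : q ∈ homZ n k)
    (hp0 : p ≠ 0) (h : p = q * u) : IsUnit u := by
  have hq0 : q ≠ 0 := fun h0 => hp0 (by rw [h, h0, zero_mul])
  have hu0 : u ≠ 0 := fun h0 => hp0 (by rw [h, h0, mul_zero])
  have h1 := totalDegree_of_mem_homZ hp hp0
  have h2 := totalDegree_of_mem_homZ hq hq0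
  have h3 := MvPolynomial.totalDegree_mul_of_isDomain hq0 hu0
  rw [← h] at h3
  have h4 : u.totalDegree = 0 := by omega
  rw [MvPolynomial.totalDegree_eq_zero_iff_eq_C] at h4
  rw [h4]
  refine IsUnit.map _ (isUnit_iff_ne_zero.mpr fun h5 => hu0 ?_)
  rw [h4, h5, map_zero]

/-- A linearly independent family of invariant forms whose degrees add up to the degree of the
product of powers of the Jacobian and of the determinant of basic derivations spans the invariant
forms over `S`. -/
theorem exists_combination {W : Subgroup (Matrix.unitaryGroup (Fin n) ℂ)} [Finite W]
    {f : Fin n → S n} (hf : ∀ i, ∀ g ∈ W, actS g (f i) = f i)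
    (hgen : ∀ q, (∀ g ∈ W, actS g q = q) → q ∈ Algebra.adjoin ℂ (Set.range f))
    {θ : Fin n → Fin n → S n} (hθ : ∀ i, ∀ g ∈ W, actDer g (θ i) = θ i)
    (hspan : ∀ u : Fin n → S n, (∀ g ∈ W, actDer g u = u) →
      ∃ c : Fin n → S n, ∀ j, u j = ∑ i, c i * θ i j)
    {u v : Fin n → ℤ} (hu : ∀ i j, MvPolynomial.pderiv j (f i) ∈ homZ n (u i))
    (hv : ∀ i j, θ i j ∈ homZ n (v i)) {r : ℕ} (hr : 1 ≤ r) (hrn : r ≤ n)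
    {w : Col n r → Forms n} (hwb : ∀ q, w q ∈ block n r)
    (hw : ∀ q, ∀ g ∈ W, actForms g (w q) = w q) (hli : LinearIndependent (S n) w)
    {k : Col n r → ℤ} (hk : ∀ q, w q ∈ formsZ n (k q))
    (hdeg : ∑ q, k q = (2 ^ (n - 1) * (n - 1).choose r : ℕ) * ∑ i, u i
      + (2 ^ (n - 1) * (n - 1).choose (r - 1) : ℕ) * ∑ i, v i)
    {ω : Forms n} (hωb : ω ∈ block n r) (hω : ∀ g ∈ W, actForms g ω = ω) :
    ∃ c : Col n r → S n, ω = ∑ q, c q • w q := by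
  classical
  have h0 := det_coordMatrix_ne_zero hwb hli
  obtain ⟨-, -, z, hz⟩ := jac_pow_mul_derDet_pow_dvd hf hgen hθ hspan hr hrn hwb hw
  have hunit : IsUnit z := by
    refine isUnit_of_eq_mul (k := ∑ q, k q)
      (det_mem_homZ _ k fun q c => repr_mem_homZ (hk q) _) ?_ h0 hz
    rw [hdeg]
    exact mul_mem_homZ (pow_mem_homZ (det_mem_homZ _ u fun i j => hu i j) _)
      (pow_mem_homZ (det_mem_homZ _ v fun i j => hv i j) _)
  refine exists_combination_of_dvd hwb h0 hωb fun q => ?_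
  rw [hz, hunit.mul_right_dvd]
  refine (jac_pow_mul_derDet_pow_dvd hf hgen hθ hspan hr hrn (fun q' => ?_) fun q' => ?_).2.2
  · by_cases h : q' = q
    · subst h
      rwa [Function.update_self]
    · rw [Function.update_of_ne h]
      exact hwb q'
  · by_cases h : q' = q
    · subst h
      rwa [Function.update_self]
    · rw [Function.update_of_ne h]
      exact hw q'

/-- By uniqueness, the coefficients of an invariant form in terms of linearly independent invariant
forms are invariant. -/
theorem invariant_of_combination {W : Subgroup (Matrix.unitaryGroup (Fin n) ℂ)} {ι : Type*}
    [Fintype ι] {w : ι → Forms n} (hw : ∀ q, ∀ g ∈ W, actForms g (w q) = w q)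
    (hli : LinearIndependent (S n) w) {c : ι → S n}
    (hc : ∀ g ∈ W, actForms g (∑ q, c q • w q) = ∑ q, c q • w q) (q : ι) : c q ∈ invS W := by
  intro g hg
  have h := hc g hg
  simp only [map_sum, actForms_smul_poly] at h
  rw [Finset.sum_congr rfl fun q _ => by rw [hw q g hg], ← sub_eq_zero,
    ← Finset.sum_sub_distrib] at h
  simp only [← sub_smul] at h
  exact sub_eq_zero.mp (Fintype.linearIndependent_iff.mp hli _ h q)

/-- The rank of `S ⊗ ∧V* ⊗ ∧^r V` is the number of forms `df_L θ̃_I(θ_J)`. -/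
theorem card_idx {r : ℕ} (hr : r ≤ n) :
    Fintype.card (Col n r) = Fintype.card (Finset (Fin (n - r)) × Idx n r) := by
  rw [Fintype.card_prod, Fintype.card_prod, Fintype.card_prod, Fintype.card_finset,
    Fintype.card_finset, Fintype.card_finset, Fintype.card_fin, Fintype.card_fin, Fintype.card_fin,
    ← mul_assoc, ← pow_add, Nat.sub_add_cancel hr]

theorem coe_smul_M {W : Subgroup (Matrix.unitaryGroup (Fin n) ℂ)} {f : Fin n → invS W} {r : ℕ}
    (ρ : R f r) (ω : M W r) :
    ((ρ • ω : M W r) : Forms n) = ((ρ : invDForms W) : DForms n) • (ω : Forms n) := rfl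

theorem coe_sum_smul_M {W : Subgroup (Matrix.unitaryGroup (Fin n) ℂ)} {f : Fin n → invS W} {r : ℕ}
    {κ : Type*} [Fintype κ] (b : κ → M W r) {ρ : κ → R f r}
    {c : κ → Finset (Fin (n - r)) → invS W}
    (hc : ∀ p, ((ρ p : invDForms W) : DForms n) = ∑ L, (c p L : S n) • dWedge f r L) :
    ((∑ p, ρ p • b p : M W r) : Forms n)
      = ∑ q : Finset (Fin (n - r)) × κ, (c q.2 q.1 : S n) • dWedge f r q.1 • (b q.2 : Forms n) := by
  rw [Submodule.coe_sum, Fintype.sum_prod_type_right]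
  refine Finset.sum_congr rfl fun p _ => ?_
  rw [coe_smul_M, hc, Finset.sum_smul]
  exact Finset.sum_congr rfl fun L _ => smul_assoc _ _ _

/-- Since the `df_L` span `R_r` over the invariants, a family in `M_r` is a basis over `R_r` as soon
as its products with the `df_L` are linearly independent and span `M_r` over the invariants. -/
theorem exists_basis {W : Subgroup (Matrix.unitaryGroup (Fin n) ℂ)} {f : Fin n → invS W} {r : ℕ}
    {κ : Type*} [Fintype κ] (b : κ → M W r)
    (hli : LinearIndependent (S n)
      fun q : Finset (Fin (n - r)) × κ => dWedge f r q.1 • (b q.2 : Forms n))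
    (hspan : ∀ ω ∈ M W r, ∃ c : Finset (Fin (n - r)) × κ → invS W,
      ω = ∑ q, (c q : S n) • dWedge f r q.1 • (b q.2 : Forms n)) :
    ∃ B : Module.Basis κ (R f r) (M W r), ∀ p, B p = b p := by
  have hlib : LinearIndependent (R f r) b := by
    refine Fintype.linearIndependent_iffₛ.mpr fun ρ ρ' hρ p => ?_
    choose c hc using fun p => exists_sum_dWedge f r (ρ p).2
    choose c' hc' using fun p => exists_sum_dWedge f r (ρ' p).2
    have h1 := congrArg (Subtype.val : M W r → Forms n) hρ
    rw [coe_sum_smul_M b hc, coe_sum_smul_M b hc'] at h1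
    have h2 := Fintype.linearIndependent_iffₛ.mp hli _ _ h1
    refine Subtype.ext (Subtype.ext ?_)
    rw [hc, hc']
    exact Finset.sum_congr rfl fun L _ => by rw [h2 (L, p)]
  have hspanb : ⊤ ≤ Submodule.span (R f r) (Set.range b) := by
    rintro ω -
    obtain ⟨c, hc⟩ := hspan ω ω.2
    choose ρ hρ using fun p => exists_coe_eq_sum_dWedge f r fun L => c (L, p)
    rw [show ω = ∑ p, ρ p • b p from Subtype.ext (hc.trans (coe_sum_smul_M b hρ).symm)]
    exact Submodule.sum_mem _ fun p _ => Submodule.smul_mem _ _ (Submodule.subset_span ⟨p, rfl⟩)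
  exact ⟨Module.Basis.mk hlib hspanb, fun p => Module.Basis.mk_apply _ _ p⟩

end MixedForms

end


open MixedForms

theorem proposition6p4 {n : ℕ} (W : Subgroup (Matrix.unitaryGroup (Fin n) ℂ))
    (hW : IsCoincidental W)
    (f : Fin n → invS W) (deg : Fin n → ℕ) (hf : IsBasicInvariants f deg)
    (θ : Module.Basis (Fin n) (invS W) (invDer W)) (coexp : Fin n → ℕ)
    (hθ : IsBasicDerivations θ coexp)
    (r : ℕ) (hr₁ : 1 ≤ r) (hr : r ≤ n)
    (hind : LinearIndependent (FractionRing (S n))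
      fun p : Finset (Fin (n - r)) × Idx n r =>
        (1 : FractionRing (S n)) ⊗ₜ[S n]
          (dWedge f r p.1 • elt (fun i => (θ i : Fin n → S n)) hr p.2)) :
    (∃ b : Module.Basis (Idx n r) (R f r) (M W r),
        ∀ p, (b p : Forms n) = elt (fun i => (θ i : Fin n → S n)) hr p) ∧
      Module.Free (R f r) (M W r) := by
  classical
  have hfin : Finite W := hW.finite
  suffices hb : ∃ b : Module.Basis (Idx n r) (R f r) (M W r),
      ∀ p, (b p : Forms n) = elt (fun i => (θ i : Fin n → S n)) hr p from
    ⟨hb, let ⟨b, _⟩ := hb; Module.Free.of_basis b⟩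
  have hfinv : ∀ i, ∀ g ∈ W, actS g (f i : S n) = f i := fun i => (f i).2
  have hgen : ∀ q, (∀ g ∈ W, actS g q = q) →
      q ∈ Algebra.adjoin ℂ (Set.range fun i => (f i : S n)) := by
    intro q hq
    have h1 : (⟨q, hq⟩ : invS W) ∈ Algebra.adjoin ℂ (Set.range f) := by
      rw [hf.generate]
      trivial
    have h2 : (invS W).val ⟨q, hq⟩ ∈ (Algebra.adjoin ℂ (Set.range f)).map (invS W).val :=
      Subalgebra.mem_map.mpr ⟨_, h1, rfl⟩
    rw [AlgHom.map_adjoin, ← Set.range_comp] at h2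
    exact h2
  have hθinv : ∀ i, ∀ g ∈ W, actDer g (θ i : Fin n → S n) = θ i :=
    fun i g hg => funext (mem_invDer_iff.mp (θ i).2 g hg)
  have hspan : ∀ u : Fin n → S n, (∀ g ∈ W, actDer g u = u) →
      ∃ c : Fin n → S n, ∀ j, u j = ∑ i, c i * (θ i : Fin n → S n) j := by
    intro u hu
    let u' : invDer W := ⟨u, mem_invDer_iff.mpr fun g hg k => congrFun (hu g hg) k⟩
    refine ⟨fun i => (θ.repr u' i : S n), fun j => ?_⟩
    have h1 := congrArg (fun t : invDer W => (t : Fin n → S n) j) (θ.sum_repr u')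
    simp only [Submodule.coe_sum, Finset.sum_apply] at h1
    exact h1.symm
  -- exponents and coexponents are arithmetic sequences with the same gap
  obtain ⟨e₁, a, -, harith⟩ := hW.arithmetic deg ⟨f, hf⟩
  have hdual := hW.duality deg coexp ⟨f, hf⟩ ⟨θ, hθ⟩
  let u : Fin n → ℤ := fun i => ((deg i - 1 : ℕ) : ℤ)
  let v : Fin n → ℤ := fun i => (coexp i : ℤ)
  have hu : ∀ i, u i = e₁ + (i : ℕ) * a := fun i => by
    simp only [u, harith i]
    push_cast
    rfl
  have hv : ∀ i, v i = ((Finset.univ.sup deg : ℕ) - e₁ - (n - 1) * a : ℤ) + (i : ℕ) * a := by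
    intro i
    have h1 := hdual (Fin.rev i)
    rw [Fin.rev_rev, harith, Fin.val_rev] at h1
    have h2 : ((n - (i + 1) : ℕ) : ℤ) = n - (i + 1) := by
      have := i.2
      omega
    have h3 : ((e₁ : ℤ) + ((n - (i + 1) : ℕ) : ℤ) * a) + v i = (Finset.univ.sup deg : ℕ) := by
      simp only [v]
      exact_mod_cast h1
    rw [h2] at h3
    linear_combination h3
  have hfd : ∀ i j, MvPolynomial.pderiv j (f i : S n) ∈ homZ n (u i) := fun i j =>
    mem_homZ_of_isHomogeneous (hf.homogeneous i).pderiv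
  have hθd : ∀ i j, (θ i : Fin n → S n) j ∈ homZ n (v i) := fun i j =>
    mem_homZ_of_isHomogeneous (hθ.homogeneous i j)
  let E : Col n r ≃ Finset (Fin (n - r)) × Idx n r := Fintype.equivOfCardEq (card_idx hr)
  let w : Finset (Fin (n - r)) × Idx n r → Forms n :=
    fun q => dWedge f r q.1 • elt (fun i => (θ i : Fin n → S n)) hr q.2
  have hli : LinearIndependent (S n) w := linearIndependent_of_fractionRing hind
  have hwb : ∀ q, w q ∈ block n r := fun q => Submodule.smul_mem _ _ (elt_mem_block _ hr _)
  have hw : ∀ q, ∀ g ∈ W, actForms g (w q) = w q := fun q g hg => by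
    rw [actForms_smul, dWedge_invariant f r _ hg, actForms_elt fun i => hθinv i g hg]
  have hM : ∀ p, elt (fun i => (θ i : Fin n → S n)) hr p ∈ M W r := elt_mem hθinv hr
  have hcomb : ∀ ω ∈ M W r, ∃ c : Finset (Fin (n - r)) × Idx n r → invS W,
      ω = ∑ q, (c q : S n) • w q := by
    intro ω hω
    obtain ⟨c, hc⟩ := exists_combination hfinv hgen hθinv hspan hfd hθd hr₁ hr
      (w := w ∘ E) (fun q => hwb _) (fun q => hw _) (hli.comp _ E.injective)
      (k := fun q => ∑ l ∈ (E q).1, u (Fin.castLE (n.sub_le r) l)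
        + (∑ j ∈ (E q).2.2.1, v j - ∑ i ∈ (E q).2.1, v (Fin.castLE hr i)))
      (fun q => dWedge_smul_mem_formsZ hfd _ (tildeProd_mem_formsZ hθd hr _
        (thetaWedge_mem_formsZ hθd _)))
      ((E.sum_comp fun q => ∑ l ∈ q.1, u (Fin.castLE (n.sub_le r) l)
        + (∑ j ∈ q.2.2.1, v j - ∑ i ∈ q.2.1, v (Fin.castLE hr i))).trans
          (sum_degrees hr₁ hr hu hv)) hω.2 hω.1
    have hc' : ω = ∑ q, c (E.symm q) • w q := by
      rw [hc, ← E.sum_comp]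
      simp
    refine ⟨fun q => ⟨c (E.symm q), invariant_of_combination (c := fun q => c (E.symm q)) hw hli
      (fun g hg => ?_) q⟩, hc'⟩
    rw [← hc', hω.1 g hg]
  obtain ⟨b, hb⟩ := exists_basis (fun p => (⟨_, hM p⟩ : M W r)) hli hcomb
  exact ⟨b, fun p => congrArg Subtype.val (hb p)⟩
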